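/- Setting. Let $n,p\ge 1$ and let $\mathbb X\subseteq\mathbb R^p$ be closed and convex with $r\,\mathbb B^p\subseteq\mathbb X\subseteq R\,\mathbb B^p$, where $r=r(\mathbb X)>0$, $R=R(\mathbb X)$ and $\mathbb B^p$ is the closed Euclidean unit ball. For agents $i\in[n]=\{1,\dots,n\}$ and iterations $t=1,2,\dots$ let $f_{i,t}:\mathbb X\to\mathbb R$ and $g_{i,t}:\mathbb X\to\mathbb R^{m_i}$ be fixed (chosen in advance of the algorithm's randomness). Put $f_t=\frac1n\sum_{j=1}^n f_{j,t}$, let $g_t=\mathrm{col}(g_{1,t},\dots,g_{n,t})$ be the stacked constraint function, and let $\mathcal X_T=\{x\in\mathbb X: g_t(x)\le 0\ \text{for all } t\in[T]\}$. Write $[v]_+$ for the componentwise positive part, $\mathcal P_K$ for the Euclidean projection onto $K$, and $\|\cdot\|$ for the Euclidean (for matrices: operator) norm. Assumptions. (0) $\mathcal X_T\ne\emptyset$ for every $T\ge1$. (1) $|f_{i,t}(x)|\le F$ for all $i,t$ and $x\in\mathbb X$. (2) All $f_{i,t}$ and all components of all $g_{i,t}$ are convex on $\mathbb X$, and at each $x\in\mathbb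 X$ there are a subgradient $\partial f_{i,t}(x)$ with $\|\partial f_{i,t}(x)\|\le G_1$ and a matrix $\partial g_{i,t}(x)$, whose rows are subgradients of the components of $g_{i,t}$, with $\|\partial g_{i,t}(x)\|\le G_2$, where $G_2>0$. (3) $\mathcal G_t=([n],\mathcal E_t)$ are directed graphs and $W_t\in\mathbb R^{n\times n}$ are matrices such that, for a constant $w\in(0,1)$, $[W_t]_{ij}\ge w$ if $(j,i)\in\mathcal E_t$ or $i=j$, and $[W_t]_{ij}=0$ otherwise; all row and column sums of $W_t$ equal $1$; and for an integer $B>0$ the graph $([n],\bigcup_{l=0}^{B-1}\mathcal E_{t+l})$ is strongly connected for every $t\ge1$. Algorithm. Let $u_{i,t}$ ($i\in[n]$, $t\ge1$) be independent random vectors, uniformly distributed on the unit sphere of $\mathbb R^p$. Start from $z_{i,1}\in(1-\xi_1)\mathbb X$ and for $t\ge1$ put $$x_{i,t}=\sum_{j=1}^n[W_t]_{ij}z_{j,t},\qquad q_{i,t+1}=\gamma_t[g_{i,t}(x_{i,t})]_+,$$ $$\hat\omega_{i,t+1}=\tfrac{p}{\delta_t}\big(f_{i,t}(x_{i,t}+\delta_tu_{i,t})-f_{i,t}(x_{i,t})\big)u_{i,t}+\tfrac{p}{\delta_t}\Big(\big(g_{i,t}(x_{i,t}+\delta_tu_{i,t})-g_{i,t}(x_{i,t})\big)^{T}\otimes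 u_{i,t}\Big)q_{i,t+1},$$ $$z_{i,t+1}=\mathcal P_{(1-\xi_{t+1})\mathbb X}\big(x_{i,t}-\alpha_t\hat\omega_{i,t+1}\big),$$ with $\alpha_t=t^{-c}$, $\gamma_t=\gamma_0/\alpha_t$, $\xi_t=\alpha_t$, $\delta_t=r\alpha_t$, where $c\in(0,1)$ and $\gamma_0\in\big(0,\,1/(4(p^2+1)G_2^2)\big]$. Theorem. There is a constant $C$, depending only on $n,p,r,R,F,G_1,G_2,w,B,c,\gamma_0$, such that for every $T\ge1$ $$\mathbf E\Big[\frac1n\sum_{i=1}^n\Big(\sum_{t=1}^Tf_t(x_{i,t})-\min_{x\in\mathcal X_T}\sum_{t=1}^Tf_t(x)\Big)\Big]\le C\,T^{\max\{c,1-c\}}$$ and $$\mathbf E\Big[\frac1n\sum_{i=1}^n\sum_{t=1}^T\big\|[g_t(x_{i,t})]_+\big\|\Big]\le C\,T^{1-c/2},$$ both expectations being finite. -/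

import Mathlib

namespace DistBandit

open scoped Matrix

/-- Componentwise projection `[v]_+` onto the nonnegative orthant. -/
noncomputable def clip {ι : Type*} (v : EuclideanSpace ℝ ι) : EuclideanSpace ℝ ι :=
  WithLp.toLp 2 (fun k => max (v k) 0)

/-- `v` is a subgradient at `x` of the function `f : X → ℝ` (values off `X` are irrelevant). -/
def IsSubgradientAt {p : ℕ} (X : Set (EuclideanSpace ℝ (Fin p)))
    (f : EuclideanSpace ℝ (Fin p) → ℝ) (x v : EuclideanSpace ℝ (Fin p)) : Prop :=
  ∀ y ∈ X, f x + inner ℝ v (y - x) ≤ f y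

/-- `A` is a subgradient at `x` of the vector-valued function `g : X → ℝ^d`: the `k`-th row of
the linear map `A` is a subgradient of the `k`-th component of `g`. -/
def IsVecSubgradientAt {p d : ℕ} (X : Set (EuclideanSpace ℝ (Fin p)))
    (g : EuclideanSpace ℝ (Fin p) → EuclideanSpace ℝ (Fin d)) (x : EuclideanSpace ℝ (Fin p))
    (A : EuclideanSpace ℝ (Fin p) →L[ℝ] EuclideanSpace ℝ (Fin d)) : Prop :=
  ∀ y ∈ X, ∀ k, g x k + A (y - x) k ≤ g y k

/-- `y` is a (the, if `K` is closed and convex) Euclidean projection of `x` onto `K`. -/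
def IsProjection {p : ℕ} (K : Set (EuclideanSpace ℝ (Fin p)))
    (x y : EuclideanSpace ℝ (Fin p)) : Prop :=
  y ∈ K ∧ ∀ y' ∈ K, ‖x - y‖ ≤ ‖x - y'‖

/-- The uniform probability distribution on the unit sphere of `ℝ^p`. -/
noncomputable def sphereUniform (p : ℕ) :
    MeasureTheory.Measure (Metric.sphere (0 : EuclideanSpace ℝ (Fin p)) 1) :=
  ((MeasureTheory.volume : MeasureTheory.Measure (EuclideanSpace ℝ (Fin p))).toSphere
      Set.univ)⁻¹ •
    (MeasureTheory.volume : MeasureTheory.Measure (EuclideanSpace ℝ (Fin p))).toSphere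

/-- The set `X` is closed and convex and lies between the balls of radii `r` and `R`. -/
structure SetAssumption {p : ℕ} (X : Set (EuclideanSpace ℝ (Fin p))) (r R : ℝ) : Prop where
  closed : IsClosed X
  convex : Convex ℝ X
  ball_subset : Metric.closedBall 0 r ⊆ X
  subset_ball : X ⊆ Metric.closedBall 0 R

/-- The local losses `f i t`, `t ≥ 1`, are bounded by `F` on `X`, convex on `X`, and have at each
point of `X` a subgradient of norm at most `G₁`. -/
structure LossAssumption {n p : ℕ} (X : Set (EuclideanSpace ℝ (Fin p)))
    (f : Fin n → ℕ → EuclideanSpace ℝ (Fin p) → ℝ) (F G₁ : ℝ) : Prop where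
  bounded : ∀ i t, 1 ≤ t → ∀ x ∈ X, |f i t x| ≤ F
  convex : ∀ i t, 1 ≤ t → ConvexOn ℝ X (f i t)
  subgradient : ∀ i t, 1 ≤ t → ∀ x ∈ X, ∃ v, IsSubgradientAt X (f i t) x v ∧ ‖v‖ ≤ G₁

/-- The local constraint functions `g i t`, `t ≥ 1`, are componentwise convex on `X` and have at
each point of `X` a subgradient of (operator) norm at most `G₂`. -/
structure ConstraintAssumption {n p : ℕ} {m : Fin n → ℕ} (X : Set (EuclideanSpace ℝ (Fin p)))
    (g : (i : Fin n) → ℕ → EuclideanSpace ℝ (Fin p) → EuclideanSpace ℝ (Fin (m i)))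
    (G₂ : ℝ) : Prop where
  convex : ∀ i t, 1 ≤ t → ∀ k, ConvexOn ℝ X (fun x => g i t x k)
  subgradient : ∀ i t, 1 ≤ t → ∀ x ∈ X, ∃ A, IsVecSubgradientAt X (g i t) x A ∧ ‖A‖ ≤ G₂

/-- The time-varying directed graphs `G t` (`(G t).Adj j i`: agent `i` receives from agent `j`)
and the mixing matrices `W t`, `t ≥ 1`. -/
structure NetworkAssumption {n : ℕ} (G : ℕ → Digraph (Fin n))
    (W : ℕ → Matrix (Fin n) (Fin n) ℝ) (w : ℝ) (B : ℕ) : Prop where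
  weight_ge : ∀ t, 1 ≤ t → ∀ i j, ((G t).Adj j i ∨ i = j) → w ≤ W t i j
  weight_zero : ∀ t, 1 ≤ t → ∀ i j, ¬ ((G t).Adj j i ∨ i = j) → W t i j = 0
  row_sum : ∀ t, 1 ≤ t → ∀ i, ∑ j, W t i j = 1
  col_sum : ∀ t, 1 ≤ t → ∀ j, ∑ i, W t i j = 1
  /-- The union of the graphs over any `B` consecutive iterations is strongly connected. -/
  connected : ∀ t, 1 ≤ t → ∀ i j,
    Relation.ReflTransGen (fun a b => ∃ l < B, (G (t + l)).Adj a b) i j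

/-- Two-point estimator of the subgradient of a real-valued function. -/
noncomputable def gradEst {p : ℕ} (f : EuclideanSpace ℝ (Fin p) → ℝ) (δ : ℝ)
    (x u : EuclideanSpace ℝ (Fin p)) : EuclideanSpace ℝ (Fin p) :=
  ((p : ℝ) / δ * (f (x + δ • u) - f x)) • u

/-- Two-point estimator of the subgradient of a vector-valued function, a `p × d` matrix. -/
noncomputable def vecGradEst {p d : ℕ}
    (g : EuclideanSpace ℝ (Fin p) → EuclideanSpace ℝ (Fin d)) (δ : ℝ)
    (x u : EuclideanSpace ℝ (Fin p)) : Matrix (Fin p) (Fin d) ℝ :=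
  Matrix.of (fun a k => (p : ℝ) / δ * (g (x + δ • u) k - g x k) * u a)

/-- The sequences `z, x, q, ω` (local estimates, decisions, dual variables, update directions) are
generated by the distributed bandit online primal-dual algorithm on the set `X` with losses `f`,
constraints `g`, mixing matrices `W`, parameters `α, γ, ξ, δ` and exploration directions `u`.
Time starts at `t = 1`; nothing is required of the values at time `0`. -/
structure IsRun {n p : ℕ} {m : Fin n → ℕ} (X : Set (EuclideanSpace ℝ (Fin p)))
    (f : Fin n → ℕ → EuclideanSpace ℝ (Fin p) → ℝ)
    (g : (i : Fin n) → ℕ → EuclideanSpace ℝ (Fin p) → EuclideanSpace ℝ (Fin (m i)))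
    (W : ℕ → Matrix (Fin n) (Fin n) ℝ) (α γ ξ δ : ℕ → ℝ)
    (u z x : Fin n → ℕ → EuclideanSpace ℝ (Fin p))
    (q : (i : Fin n) → ℕ → EuclideanSpace ℝ (Fin (m i)))
    (ω : Fin n → ℕ → EuclideanSpace ℝ (Fin p)) : Prop where
  init : ∀ i, z i 1 ∈ (fun y : EuclideanSpace ℝ (Fin p) => (1 - ξ 1) • y) '' X
  consensus : ∀ i t, 1 ≤ t → x i t = ∑ j, W t i j • z j t
  dual : ∀ i t, 1 ≤ t → q i (t + 1) = γ t • clip (g i t (x i t))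
  direction : ∀ i t, 1 ≤ t → ω i (t + 1) = gradEst (f i t) (δ t) (x i t) (u i t) +
    WithLp.toLp 2 (vecGradEst (g i t) (δ t) (x i t) (u i t) *ᵥ (q i (t + 1)).ofLp)
  primal : ∀ i t, 1 ≤ t →
    IsProjection ((fun y : EuclideanSpace ℝ (Fin p) => (1 - ξ (t + 1)) • y) '' X)
      (x i t - α t • ω i (t + 1)) (z i (t + 1))

/-- Global loss at iteration `t`. -/
noncomputable def globalLoss {n p : ℕ} (f : Fin n → ℕ → EuclideanSpace ℝ (Fin p) → ℝ)
    (t : ℕ) (x : EuclideanSpace ℝ (Fin p)) : ℝ :=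
  (1 / (n : ℝ)) * ∑ j, f j t x

/-- Global constraint function at iteration `t`: the local ones stacked into one vector. -/
noncomputable def globalConstraint {n p : ℕ} {m : Fin n → ℕ}
    (g : (i : Fin n) → ℕ → EuclideanSpace ℝ (Fin p) → EuclideanSpace ℝ (Fin (m i)))
    (t : ℕ) (x : EuclideanSpace ℝ (Fin p)) : EuclideanSpace ℝ (Σ i, Fin (m i)) :=
  WithLp.toLp 2 (fun k => g k.1 t x k.2)

/-- Points of `X` that satisfy all constraints of the iterations `1, …, T`. -/
def feasibleSet {n p : ℕ} {m : Fin n → ℕ} (X : Set (EuclideanSpace ℝ (Fin p)))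
    (g : (i : Fin n) → ℕ → EuclideanSpace ℝ (Fin p) → EuclideanSpace ℝ (Fin (m i)))
    (T : ℕ) : Set (EuclideanSpace ℝ (Fin p)) :=
  {x | x ∈ X ∧ ∀ t ∈ Finset.Icc 1 T, ∀ k, globalConstraint g t x k ≤ 0}

/-- Network regret of the decisions `x` over the iterations `1, …, T`. -/
noncomputable def netReg {n p : ℕ} {m : Fin n → ℕ} (X : Set (EuclideanSpace ℝ (Fin p)))
    (f : Fin n → ℕ → EuclideanSpace ℝ (Fin p) → ℝ)
    (g : (i : Fin n) → ℕ → EuclideanSpace ℝ (Fin p) → EuclideanSpace ℝ (Fin (m i)))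
    (x : Fin n → ℕ → EuclideanSpace ℝ (Fin p)) (T : ℕ) : ℝ :=
  (1 / (n : ℝ)) * ∑ i, (∑ t ∈ Finset.Icc 1 T, globalLoss f t (x i t) -
    sInf ((fun y => ∑ t ∈ Finset.Icc 1 T, globalLoss f t y) '' feasibleSet X g T))

/-- Network cumulative constraint violation of `x` over the iterations `1, …, T`. -/
noncomputable def netCCV {n p : ℕ} {m : Fin n → ℕ}
    (g : (i : Fin n) → ℕ → EuclideanSpace ℝ (Fin p) → EuclideanSpace ℝ (Fin (m i)))
    (x : Fin n → ℕ → EuclideanSpace ℝ (Fin p)) (T : ℕ) : ℝ :=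
  (1 / (n : ℝ)) * ∑ i, ∑ t ∈ Finset.Icc 1 T, ‖clip (globalConstraint g t (x i t))‖

end DistBandit

/-! ### Projections, positive parts, Lipschitz bounds and shrunken sets. -/

namespace DistBandit

open scoped Matrix

/-! Fix a feasible comparator `y` and follow the potential `A t = ∑ i, ‖z i t - (1 - α t) • y‖ ^ 2`.
Doubly stochastic mixing does not increase the sum of squared distances, and projections are
nonexpansive. Expanding one step gives `PrimalRun.potential_succ_le`: `A (t + 1)`, plus `2 α t`
times the local loss differences, plus `γ₀ / 2` times the squared local violations, plus a noise
term, is at most `A t + O(α t ^ 2)`. The squared violations appear because the update direction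
estimates a subgradient of `f + ⟪q, g⟫` with `q = γ [g]_+`: the inner product contributes `γ ‖[g]_+‖
^ 2` at the decision and nothing positive at a feasible point. The bound on `γ₀` lets this gain pay
for the squared length of the step.

The noise term is the excess of the estimated decrease over what an approximate subgradient
inequality guarantees. Its mean is nonnegative: averaged over the sphere, the two-point estimator is
a subgradient up to an error `2 K δ` (`le_integral_inner_gradEst`). This is the divergence theorem
on a ball combined with convexity; no differentiability of the loss is needed, since difference
quotients are moved onto radial cutoff functions. Because `u i t` is independent of `x i t`, it can
be integrated out first (`integrable_lagrangianGap`).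

Passing from local to global quantities costs the disagreement between agents. Over `n * B` steps
the mixing matrices contract it by a fixed factor (`disagreement_add_le`), so its sum is controlled
by the summed displacements, that is, by `∑ α t` and the summed violations
(`PrimalRun.sum_disagreement_le`).

For the regret, the one-step inequality is divided by `2 α t` and summed by parts: the potential
contributes `T ^ c`, the remainders `T ^ (1 - c)`, and the violations coming from disagreement are
absorbed by the quadratic term. For the violation, the inequality is summed undivided, so the
squares add up to `O(T ^ (1 - c))`, and a weighted arithmetic-geometric mean inequality turns this
into `T ^ (1 - c / 2)`. All bounds are pathwise with the noise kept; expectations serve only to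
discard the noise. -/

theorem IsProjection.inner_le_zero {p : ℕ} {K : Set (EuclideanSpace ℝ (Fin p))}
    (hK : Convex ℝ K) {x y : EuclideanSpace ℝ (Fin p)} (h : IsProjection K x y) :
    ∀ v ∈ K, inner ℝ (x - y) (v - y) ≤ 0 := by
  have : Nonempty K := ⟨⟨y, h.1⟩⟩
  refine (norm_eq_iInf_iff_real_inner_le_zero hK h.1).1 (le_antisymm ?_ ?_)
  · exact le_ciInf fun v => h.2 v v.2
  · exact ciInf_le (f := fun v : K => ‖x - v‖)
      ⟨0, by rintro _ ⟨v, rfl⟩; exact norm_nonneg _⟩ ⟨y, h.1⟩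

theorem isProjection_self {p : ℕ} {K : Set (EuclideanSpace ℝ (Fin p))}
    {y : EuclideanSpace ℝ (Fin p)} (hy : y ∈ K) : IsProjection K y y :=
  ⟨hy, fun y' _ => by simp⟩

/-- Projections onto convex sets are nonexpansive. -/
theorem IsProjection.norm_sub_le {p : ℕ} {K : Set (EuclideanSpace ℝ (Fin p))}
    (hK : Convex ℝ K) {x y x' y' : EuclideanSpace ℝ (Fin p)} (h : IsProjection K x y)
    (h' : IsProjection K x' y') : ‖y - y'‖ ≤ ‖x - x'‖ := by
  have h1 := h.inner_le_zero hK y' h'.1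
  have h2 := h'.inner_le_zero hK y h.1
  have h3 : ‖y - y'‖ * ‖y - y'‖ ≤ inner ℝ (x - x') (y - y') := by
    rw [← real_inner_self_eq_norm_mul_norm]
    have e : inner ℝ (x - x') (y - y') = inner ℝ (y - y') (y - y')
        - inner ℝ (x - y) (y' - y) - inner ℝ (x' - y') (y - y') := by
      simp only [inner_sub_left, inner_sub_right]; ring
    rw [e]; linarith
  have h4 := real_inner_le_norm (x - x') (y - y')
  by_contra hlt
  push Not at hlt
  have : 0 < ‖y - y'‖ := lt_of_le_of_lt (norm_nonneg _) hlt
  nlinarith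

/-- Continuity of the projection is what later makes the iterates measurable. -/
theorem exists_continuous_isProjection {p : ℕ} {K : Set (EuclideanSpace ℝ (Fin p))}
    (hK : Convex ℝ K) (hc : IsClosed K) (hne : K.Nonempty) :
    ∃ π : EuclideanSpace ℝ (Fin p) → EuclideanSpace ℝ (Fin p),
      Continuous π ∧ ∀ x y, IsProjection K x y → y = π x := by
  have hex : ∀ x, ∃ y, IsProjection K x y := fun x => by
    obtain ⟨y, hy, hd⟩ := hc.exists_infDist_eq_dist hne x
    refine ⟨y, hy, fun y' hy' => ?_⟩
    rw [← dist_eq_norm, ← dist_eq_norm, ← hd]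
    exact Metric.infDist_le_dist_of_mem hy'
  choose π hπ using hex
  refine ⟨π, ?_, fun x y h => ?_⟩
  · refine (LipschitzWith.of_dist_le_mul (K := 1) fun x y => ?_).continuous
    rw [dist_eq_norm, dist_eq_norm, NNReal.coe_one, one_mul]
    exact (hπ x).norm_sub_le hK (hπ y)
  · have := h.norm_sub_le hK (hπ x)
    rw [sub_self, norm_zero] at this
    exact sub_eq_zero.1 (norm_le_zero_iff.1 this)

theorem clip_apply {ι : Type*} (v : EuclideanSpace ℝ ι) (k : ι) : clip v k = max (v k) 0 := rfl

theorem clip_nonneg {ι : Type*} (v : EuclideanSpace ℝ ι) (k : ι) : 0 ≤ clip v k :=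
  le_max_right _ _

theorem continuous_clip {ι : Type*} [Fintype ι] :
    Continuous (clip : EuclideanSpace ℝ ι → _) := by
  unfold clip
  fun_prop

theorem norm_le_norm_of_abs_le {ι : Type*} [Fintype ι] {u v : EuclideanSpace ℝ ι}
    (h : ∀ k, |u k| ≤ |v k|) : ‖u‖ ≤ ‖v‖ := by
  rw [EuclideanSpace.norm_eq, EuclideanSpace.norm_eq]
  refine Real.sqrt_le_sqrt (Finset.sum_le_sum fun k _ => ?_)
  rw [Real.norm_eq_abs, Real.norm_eq_abs]
  exact pow_le_pow_left₀ (abs_nonneg _) (h k) 2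

theorem norm_clip_sub_clip_le {ι : Type*} [Fintype ι] (u v : EuclideanSpace ℝ ι) :
    ‖clip u - clip v‖ ≤ ‖u - v‖ := by
  refine norm_le_norm_of_abs_le fun k => ?_
  simp only [PiLp.sub_apply, clip_apply]
  exact abs_max_sub_max_le_abs _ _ _

theorem inner_clip_self {ι : Type*} [Fintype ι] (v : EuclideanSpace ℝ ι) :
    inner ℝ (clip v) v = ‖clip v‖ ^ 2 := by
  rw [EuclideanSpace.norm_sq_eq, PiLp.inner_apply]
  refine Finset.sum_congr rfl fun k _ => ?_
  simp only [clip_apply, RCLike.inner_apply, conj_trivial, Real.norm_eq_abs, sq_abs]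
  rcases le_total (v k) 0 with h | h
  · simp [max_eq_right h]
  · rw [max_eq_left h]; ring

theorem inner_clip_nonpos {ι : Type*} [Fintype ι] (v a : EuclideanSpace ℝ ι)
    (ha : ∀ k, a k ≤ 0) : inner ℝ (clip v) a ≤ 0 := by
  rw [PiLp.inner_apply]
  refine Finset.sum_nonpos fun k _ => ?_
  simp only [RCLike.inner_apply, conj_trivial]
  exact mul_nonpos_of_nonpos_of_nonneg (ha k) (clip_nonneg v k)

/-- The Euclidean norm of a stacked vector is at most the sum of the norms of its blocks. -/
theorem norm_clip_globalConstraint_le {n p : ℕ} {m : Fin n → ℕ}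
    (g : (i : Fin n) → ℕ → EuclideanSpace ℝ (Fin p) → EuclideanSpace ℝ (Fin (m i)))
    (t : ℕ) (x : EuclideanSpace ℝ (Fin p)) :
    ‖clip (globalConstraint g t x)‖ ≤ ∑ j, ‖clip (g j t x)‖ := by
  have h : ‖clip (globalConstraint g t x)‖ ^ 2 = ∑ j, ‖clip (g j t x)‖ ^ 2 := by
    simp only [EuclideanSpace.norm_sq_eq, Fintype.sum_sigma]
    rfl
  refine (sq_le_sq₀ (norm_nonneg _) (Finset.sum_nonneg fun _ _ => norm_nonneg _)).1 ?_
  rw [h]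
  exact Finset.sum_sq_le_sq_sum_of_nonneg fun _ _ => norm_nonneg _

/-- Lipschitz bound for a function with bounded subgradients. -/
theorem abs_sub_le_of_subgradient {p : ℕ} {X : Set (EuclideanSpace ℝ (Fin p))}
    {f : EuclideanSpace ℝ (Fin p) → ℝ} {G₁ : ℝ}
    (h : ∀ x ∈ X, ∃ v, IsSubgradientAt X f x v ∧ ‖v‖ ≤ G₁) {x y : EuclideanSpace ℝ (Fin p)}
    (hx : x ∈ X) (hy : y ∈ X) : |f x - f y| ≤ G₁ * ‖x - y‖ := by
  have key : ∀ x ∈ X, ∀ y ∈ X, f x - f y ≤ G₁ * ‖x - y‖ := fun x hx y hy => by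
    obtain ⟨v, hv, hn⟩ := h x hx
    have h1 := hv y hy
    have h2 := real_inner_le_norm v (x - y)
    have h3 : inner ℝ v (y - x) = - inner ℝ v (x - y) := by rw [← inner_neg_right, neg_sub]
    have h4 := mul_le_mul_of_nonneg_right hn (norm_nonneg (x - y))
    linarith
  refine abs_sub_le_iff.2 ⟨key x hx y hy, ?_⟩
  rw [norm_sub_rev]
  exact key y hy x hx

/-- Each component difference is bounded by the subgradient row at `x` or by the one at `y`,
depending on its sign. The sign may vary with the component, so both matrices enter the sum of
squares, whence the factor `√2`. -/
theorem norm_sub_le_of_vecSubgradient {p d : ℕ} {X : Set (EuclideanSpace ℝ (Fin p))}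
    {g : EuclideanSpace ℝ (Fin p) → EuclideanSpace ℝ (Fin d)} {G₂ : ℝ} (hG : 0 ≤ G₂)
    (h : ∀ x ∈ X, ∃ A, IsVecSubgradientAt X g x A ∧ ‖A‖ ≤ G₂)
    {x y : EuclideanSpace ℝ (Fin p)} (hx : x ∈ X) (hy : y ∈ X) :
    ‖g x - g y‖ ≤ √2 * G₂ * ‖x - y‖ := by
  obtain ⟨A, hA, hAn⟩ := h x hx
  obtain ⟨A', hA', hAn'⟩ := h y hy
  have hb : ‖A (y - x)‖ ≤ G₂ * ‖x - y‖ := by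
    rw [norm_sub_rev x y]
    exact (A.le_opNorm _).trans (mul_le_mul_of_nonneg_right hAn (norm_nonneg _))
  have hb' : ‖A' (x - y)‖ ≤ G₂ * ‖x - y‖ :=
    (A'.le_opNorm _).trans (mul_le_mul_of_nonneg_right hAn' (norm_nonneg _))
  have hs : ‖g x - g y‖ ^ 2 ≤ ‖A (y - x)‖ ^ 2 + ‖A' (x - y)‖ ^ 2 := by
    simp only [EuclideanSpace.norm_sq_eq, ← Finset.sum_add_distrib]
    refine Finset.sum_le_sum fun k _ => ?_
    simp only [Real.norm_eq_abs, sq_abs, PiLp.sub_apply]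
    have h1 := hA y hy k
    have h2 := hA' x hx k
    rcases le_total (g x k) (g y k) with h3 | h3 <;> nlinarith
  refine (sq_le_sq₀ (norm_nonneg _) (by positivity)).1 ?_
  have h1 := pow_le_pow_left₀ (norm_nonneg _) hb 2
  have h2 := pow_le_pow_left₀ (norm_nonneg _) hb' 2
  have h3 : (√2 * G₂ * ‖x - y‖) ^ 2 = 2 * (G₂ * ‖x - y‖) ^ 2 := by
    rw [mul_assoc, mul_pow, Real.sq_sqrt (by norm_num)]
  linarith

/-- The loss with the constraint function added, weighted by the dual variable `q`. -/
noncomputable def penalized {p d : ℕ} (f : EuclideanSpace ℝ (Fin p) → ℝ)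
    (g : EuclideanSpace ℝ (Fin p) → EuclideanSpace ℝ (Fin d)) (q : EuclideanSpace ℝ (Fin d))
    (v : EuclideanSpace ℝ (Fin p)) : ℝ :=
  f v + inner ℝ q (g v)

/-- The estimator is linear in the function, so the whole update direction is the estimator of one
real-valued function, which is convex when `q ≥ 0`. The analysis needs only this scalar case. -/
theorem gradEst_add_vecGradEst {p d : ℕ} (f : EuclideanSpace ℝ (Fin p) → ℝ)
    (g : EuclideanSpace ℝ (Fin p) → EuclideanSpace ℝ (Fin d)) (q : EuclideanSpace ℝ (Fin d))
    (δ : ℝ) (x u : EuclideanSpace ℝ (Fin p)) :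
    gradEst f δ x u + WithLp.toLp 2 (vecGradEst g δ x u *ᵥ q.ofLp) =
      gradEst (penalized f g q) δ x u := by
  ext a
  simp only [gradEst, vecGradEst, penalized, PiLp.add_apply, PiLp.smul_apply, smul_eq_mul,
    Matrix.mulVec, dotProduct, Matrix.of_apply, PiLp.inner_apply, RCLike.inner_apply,
    conj_trivial]
  have : ∑ k, (p : ℝ) / δ * (g (x + δ • u) k - g x k) * u a * q k
      = (p : ℝ) / δ * (∑ k, g (x + δ • u) k * q k - ∑ k, g x k * q k) * u a := by
    rw [← Finset.sum_sub_distrib, Finset.mul_sum, Finset.sum_mul]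
    exact Finset.sum_congr rfl fun k _ => by ring
  rw [this]; ring

theorem convexOn_penalized {p d : ℕ} {X : Set (EuclideanSpace ℝ (Fin p))}
    {f : EuclideanSpace ℝ (Fin p) → ℝ}
    {g : EuclideanSpace ℝ (Fin p) → EuclideanSpace ℝ (Fin d)} {q : EuclideanSpace ℝ (Fin d)}
    (hf : ConvexOn ℝ X f) (hg : ∀ k, ConvexOn ℝ X fun x => g x k) (hq : ∀ k, 0 ≤ q k) :
    ConvexOn ℝ X (penalized f g q) := by
  refine ⟨hf.1, fun x hx y hy a b ha hb hab => ?_⟩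
  have h1 := hf.2 hx hy ha hb hab
  have h2 : inner ℝ q (g (a • x + b • y)) ≤ a • inner ℝ q (g x) + b • inner ℝ q (g y) := by
    simp only [PiLp.inner_apply, RCLike.inner_apply, conj_trivial, smul_eq_mul, Finset.mul_sum,
      ← Finset.sum_add_distrib]
    refine Finset.sum_le_sum fun k _ => ?_
    have h3 := mul_le_mul_of_nonneg_right ((hg k).2 hx hy ha hb hab) (hq k)
    simp only [smul_eq_mul] at h3
    linarith
  simp only [penalized, smul_eq_mul] at h1 h2 ⊢
  linarith

theorem abs_penalized_sub_le {p d : ℕ} {X : Set (EuclideanSpace ℝ (Fin p))}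
    {f : EuclideanSpace ℝ (Fin p) → ℝ}
    {g : EuclideanSpace ℝ (Fin p) → EuclideanSpace ℝ (Fin d)} {q : EuclideanSpace ℝ (Fin d)}
    {G₁ L : ℝ} (hf : ∀ x ∈ X, ∀ y ∈ X, |f x - f y| ≤ G₁ * ‖x - y‖)
    (hg : ∀ x ∈ X, ∀ y ∈ X, ‖g x - g y‖ ≤ L * ‖x - y‖)
    {x y : EuclideanSpace ℝ (Fin p)} (hx : x ∈ X) (hy : y ∈ X) :
    |penalized f g q x - penalized f g q y| ≤ (G₁ + L * ‖q‖) * ‖x - y‖ := by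
  have h1 : penalized f g q x - penalized f g q y = (f x - f y) + inner ℝ q (g x - g y) := by
    rw [penalized, penalized, inner_sub_right]; ring
  rw [h1]
  have h2 := abs_real_inner_le_norm q (g x - g y)
  have h3 := mul_le_mul_of_nonneg_left (hg x hx y hy) (norm_nonneg q)
  have h4 := hf x hx y hy
  have h5 := abs_add_le (f x - f y) (inner ℝ q (g x - g y))
  linarith

theorem SetAssumption.isCompact {p : ℕ} {X : Set (EuclideanSpace ℝ (Fin p))} {r R : ℝ}
    (hX : SetAssumption X r R) : IsCompact X :=
  (isCompact_closedBall 0 R).of_isClosed_subset hX.closed hX.subset_ball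

theorem SetAssumption.zero_mem {p : ℕ} {X : Set (EuclideanSpace ℝ (Fin p))} {r R : ℝ}
    (hX : SetAssumption X r R) (hr : 0 ≤ r) : 0 ∈ X :=
  hX.ball_subset (Metric.mem_closedBall_self hr)

theorem SetAssumption.norm_le {p : ℕ} {X : Set (EuclideanSpace ℝ (Fin p))} {r R : ℝ}
    (hX : SetAssumption X r R) {x : EuclideanSpace ℝ (Fin p)} (hx : x ∈ X) : ‖x‖ ≤ R := by
  simpa using hX.subset_ball hx

/-- The shrunken set `(1 - a) X`. -/
def shrink {p : ℕ} (X : Set (EuclideanSpace ℝ (Fin p))) (a : ℝ) :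
    Set (EuclideanSpace ℝ (Fin p)) :=
  (fun y => (1 - a) • y) '' X

theorem SetAssumption.isCompact_shrink {p : ℕ} {X : Set (EuclideanSpace ℝ (Fin p))} {r R : ℝ}
    (hX : SetAssumption X r R) (a : ℝ) : IsCompact (shrink X a) :=
  hX.isCompact.image (continuous_const_smul _)

theorem SetAssumption.convex_shrink {p : ℕ} {X : Set (EuclideanSpace ℝ (Fin p))} {r R : ℝ}
    (hX : SetAssumption X r R) (a : ℝ) : Convex ℝ (shrink X a) :=
  hX.convex.smul (1 - a)

/-- `X` is convex and contains `0`, hence is star-shaped about `0`. -/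
theorem SetAssumption.shrink_mono {p : ℕ} {X : Set (EuclideanSpace ℝ (Fin p))} {r R : ℝ}
    (hX : SetAssumption X r R) (hr : 0 ≤ r) {a b : ℝ} (hab : a ≤ b) (hb : b ≤ 1) :
    shrink X b ⊆ shrink X a := by
  rintro _ ⟨y, hy, rfl⟩
  rcases eq_or_lt_of_le (hab.trans hb) with h | h
  · exact ⟨y, hy, by simp [show b = a by linarith]⟩
  · have h0 : 0 < 1 - a := by linarith
    refine ⟨((1 - b) / (1 - a)) • y, ?_, ?_⟩
    · exact hX.convex.smul_mem_of_zero_mem (hX.zero_mem hr) hy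
        ⟨div_nonneg (by linarith) h0.le, (div_le_one h0).2 (by linarith)⟩
    · simp only [smul_smul]
      rw [mul_div_cancel₀ _ h0.ne']

/-- A point `v` of the ball around `(1 - a) • y` is the convex combination of `y` and `a⁻¹ • (v - (1
- a) • y)`, which lies in the ball of radius `r`. This is why `δ t = r * ξ t` keeps all query points
in `X`. -/
theorem SetAssumption.closedBall_subset {p : ℕ} {X : Set (EuclideanSpace ℝ (Fin p))} {r R : ℝ}
    (hX : SetAssumption X r R) {a : ℝ} (ha : 0 < a) (ha1 : a ≤ 1)
    {x : EuclideanSpace ℝ (Fin p)} (hx : x ∈ shrink X a) :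
    Metric.closedBall x (r * a) ⊆ X := by
  obtain ⟨y, hy, rfl⟩ := hx
  intro v hv
  rw [Metric.mem_closedBall, dist_eq_norm] at hv
  have h1 : a⁻¹ • (v - (1 - a) • y) ∈ X := by
    refine hX.ball_subset ?_
    rw [mem_closedBall_zero_iff, norm_smul, norm_inv, Real.norm_of_nonneg ha.le,
      inv_mul_le_iff₀ ha]
    linarith
  have h2 := hX.convex hy h1 (by linarith : 0 ≤ 1 - a) ha.le (by ring)
  rwa [smul_inv_smul₀ ha.ne', add_sub_cancel] at h2

theorem SetAssumption.shrink_subset {p : ℕ} {X : Set (EuclideanSpace ℝ (Fin p))} {r R : ℝ}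
    (hX : SetAssumption X r R) (hr : 0 < r) {a : ℝ} (ha : 0 < a) (ha1 : a ≤ 1) :
    shrink X a ⊆ X := fun x hx =>
  hX.closedBall_subset ha ha1 hx (Metric.mem_closedBall_self (by positivity))

end DistBandit

/-! ### The mean of the two-point estimator over the sphere. -/

namespace DistBandit

open MeasureTheory Filter Topology Metric Set

/-- Polar coordinates; neither factor needs to be integrable, since `integral_prod_mul` holds for
arbitrary functions. -/
theorem setIntegral_ball_mul_radial {E : Type*} [NormedAddCommGroup E] [InnerProductSpace ℝ E]
    [FiniteDimensional ℝ E] [Nontrivial E] [MeasurableSpace E] [BorelSpace E]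
    (μ : Measure E) [μ.IsAddHaarMeasure] (a : ℝ → ℝ) (b : E → ℝ) :
    ∫ v in ball 0 1, a ‖v‖ * b (‖v‖⁻¹ • v) ∂μ =
      (∫ u : sphere (0 : E) 1, b u ∂μ.toSphere) *
        ∫ ρ in (0 : ℝ)..1, ρ ^ (Module.finrank ℝ E - 1) * a ρ := by
  -- Moving the restriction to the ball into the radial factor keeps the integrand over the whole
  -- space a product.
  let a' : ℝ → ℝ := (Iio 1).indicator a
  have h1 : ∫ v in ball 0 1, a ‖v‖ * b (‖v‖⁻¹ • v) ∂μ
      = ∫ v, a' ‖v‖ * b (‖v‖⁻¹ • v) ∂μ := by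
    rw [← integral_indicator measurableSet_ball]
    refine integral_congr_ae (Eventually.of_forall fun v => ?_)
    by_cases hv : ‖v‖ < 1
    · simp [a', indicator, hv]
    · simp [a', indicator, hv]
  rw [h1]
  calc ∫ v, a' ‖v‖ * b (‖v‖⁻¹ • v) ∂μ
      = ∫ v : ({0}ᶜ : Set E), a' ‖v.1‖ * b (‖v.1‖⁻¹ • v.1) ∂(μ.comap (↑)) := by
        rw [integral_subtype_comap (measurableSet_singleton _).compl
          fun v => a' ‖v‖ * b (‖v‖⁻¹ • v), restrict_compl_singleton]
    _ = ∫ z, b z.1 * a' z.2 ∂(μ.toSphere.prod (.volumeIoiPow (Module.finrank ℝ E - 1))) := by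
        have := μ.measurePreserving_homeomorphUnitSphereProd.integral_comp
          (Homeomorph.measurableEmbedding _) (fun z => b z.1.1 * a' z.2.1)
        rw [← this]
        refine integral_congr_ae (Eventually.of_forall fun v => ?_)
        simp [mul_comm]
    _ = (∫ u : sphere (0 : E) 1, b u ∂μ.toSphere) *
          ∫ ρ : Ioi (0 : ℝ), a' ρ ∂(.volumeIoiPow (Module.finrank ℝ E - 1)) :=
        integral_prod_mul (fun u : sphere (0 : E) 1 => b u) (fun ρ : Ioi (0 : ℝ) => a' ρ)
    _ = _ := by
        congr 1
        simp only [Measure.volumeIoiPow, ENNReal.ofReal]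
        rw [integral_withDensity_eq_integral_smul
            (measurable_subtype_coe.pow_const _).real_toNNReal,
          integral_subtype_comap measurableSet_Ioi
            fun ρ => Real.toNNReal (ρ ^ (Module.finrank ℝ E - 1)) • a' ρ,
          intervalIntegral.integral_of_le zero_le_one, integral_Ioc_eq_integral_Ioo,
          ← integral_indicator measurableSet_Ioi, ← integral_indicator measurableSet_Ioo]
        refine integral_congr_ae (Eventually.of_forall fun ρ => ?_)
        by_cases h0 : 0 < ρ
        · by_cases h1 : ρ < 1
          · simp [a', indicator, h0, h1, NNReal.smul_def,
              Real.coe_toNNReal _ (pow_nonneg h0.le _)]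
          · simp [a', indicator, h0, h1]
        · simp [indicator, h0]

theorem integral_pow_mul_pow (d k : ℕ) (c : ℝ) :
    ∫ ρ in (0 : ℝ)..1, ρ ^ d * (c * ρ ^ k) = c / ((d : ℝ) + k + 1) := by
  have : ∀ ρ : ℝ, ρ ^ d * (c * ρ ^ k) = c * ρ ^ (d + k) := fun ρ => by ring
  simp only [this]
  rw [intervalIntegral.integral_const_mul, integral_pow]
  simp [div_eq_mul_inv]

/-- A compactly supported Lipschitz approximation of the indicator function of the unit ball. -/
noncomputable def radialCutoff {E : Type*} [NormedAddCommGroup E] (k : ℕ) (v : E) : ℝ :=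
  1 - min ‖v‖ 1 ^ k

theorem lipschitzWith_radialCutoff {E : Type*} [NormedAddCommGroup E] (k : ℕ) :
    LipschitzWith k (radialCutoff k : E → ℝ) := by
  refine LipschitzWith.of_dist_le_mul fun v w => ?_
  rw [Real.dist_eq, dist_eq_norm]
  have h1 : |min ‖v‖ 1 - min ‖w‖ 1| ≤ ‖v - w‖ :=
    (abs_min_sub_min_le_max _ _ _ _).trans
      (by simpa using abs_norm_sub_norm_le v w)
  have h2 := abs_pow_sub_pow_le (min ‖v‖ 1) (min ‖w‖ 1) k
  have h3 : max |min ‖v‖ 1| |min ‖w‖ 1| ^ (k - 1) ≤ 1 := by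
    refine pow_le_one₀ (le_max_of_le_left (abs_nonneg _)) (max_le ?_ ?_) <;>
    · rw [abs_of_nonneg (le_min (norm_nonneg _) zero_le_one)]
      exact min_le_right _ _
  have h4 : radialCutoff k v - radialCutoff k w = - (min ‖v‖ 1 ^ k - min ‖w‖ 1 ^ k) := by
    simp only [radialCutoff]; ring
  rw [h4, abs_neg]
  calc _ ≤ _ := h2
    _ ≤ |min ‖v‖ 1 - min ‖w‖ 1| * k * 1 := by gcongr
    _ ≤ ‖v - w‖ * k * 1 := by gcongr
    _ = _ := by simp [mul_comm]

theorem radialCutoff_nonneg {E : Type*} [NormedAddCommGroup E] (k : ℕ) (v : E) :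
    0 ≤ radialCutoff k v :=
  sub_nonneg.2 (pow_le_one₀ (le_min (norm_nonneg _) zero_le_one) (min_le_right _ _))

theorem radialCutoff_of_one_le {E : Type*} [NormedAddCommGroup E] (k : ℕ) {v : E}
    (hv : 1 ≤ ‖v‖) : radialCutoff k v = 0 := by
  simp [radialCutoff, min_eq_right hv]

theorem hasCompactSupport_radialCutoff {E : Type*} [NormedAddCommGroup E] [ProperSpace E]
    (k : ℕ) : HasCompactSupport (radialCutoff k : E → ℝ) := by
  refine HasCompactSupport.of_support_subset_isCompact (isCompact_closedBall 0 1) fun v hv => ?_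
  by_contra h
  rw [mem_closedBall_zero_iff, not_le] at h
  exact hv (radialCutoff_of_one_le k h.le)

/-- The exponent is even so that the power of the norm is a power of `‖v‖ ^ 2`, which is
differentiable also at the origin. -/
theorem lineDeriv_radialCutoff {E : Type*} [NormedAddCommGroup E] [InnerProductSpace ℝ E]
    (j : ℕ) {v : E} (h : E) (hv : ‖v‖ < 1) :
    lineDeriv ℝ (radialCutoff (2 * (j + 1))) v (-h) =
      2 * (j + 1) * ‖v‖ ^ (2 * j) * inner ℝ v h := by
  have h1 := ((hasStrictFDerivAt_norm_sq v).hasFDerivAt.pow (j + 1)).const_sub 1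
  have h2 : (radialCutoff (2 * (j + 1)) : E → ℝ) =ᶠ[𝓝 v] fun v => 1 - (‖v‖ ^ 2) ^ (j + 1) := by
    filter_upwards [continuous_norm.continuousAt.eventually_lt continuousAt_const hv] with w hw
    rw [radialCutoff, min_eq_left hw.le, pow_mul]
  rw [h2.lineDeriv_eq, h1.hasLineDerivAt (-h) |>.lineDeriv]
  simp [← pow_mul]
  ring

theorem lineDeriv_radialCutoff_of_one_lt {E : Type*} [NormedAddCommGroup E]
    [InnerProductSpace ℝ E] (k : ℕ) {v : E} (h : E) (hv : 1 < ‖v‖) :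
    lineDeriv ℝ (radialCutoff k) v h = 0 := by
  have h2 : (radialCutoff k : E → ℝ) =ᶠ[𝓝 v] fun _ => 0 := by
    filter_upwards [continuousAt_const.eventually_lt continuous_norm.continuousAt hv] with w hw
    exact radialCutoff_of_one_le k hw.le
  rw [h2.lineDeriv_eq]
  simp [lineDeriv]


/-- Integration by parts without a derivative of `F`: translation invariance moves the difference
quotient from the cutoff to `F`. For step lengths in `(0, 1]`, convexity bounds the quotient at `v`
by `F (v + h) - F v`, and the Lipschitz bound on the unit ball replaces this by `F h - F 0 + 2 κ`.
-/
theorem integral_lineDeriv_radialCutoff_mul_le {E : Type*} [NormedAddCommGroup E]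
    [InnerProductSpace ℝ E] [FiniteDimensional ℝ E] [MeasurableSpace E] [BorelSpace E]
    (μ : Measure E) [μ.IsAddHaarMeasure] {F : E → ℝ} {κ : NNReal} (hF : LipschitzWith κ F)
    {Y : Set E} (hc : ConvexOn ℝ Y F) {h : E} (h0 : closedBall 0 1 ⊆ Y)
    (h1 : closedBall h 1 ⊆ Y) (k : ℕ) :
    ∫ v, lineDeriv ℝ (radialCutoff k) v (-h) * F v ∂μ ≤
      (F h - F 0 + 2 * κ) * ∫ v, radialCutoff k v ∂μ := by
  have hφ := lipschitzWith_radialCutoff (E := E) k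
  have hs := hasCompactSupport_radialCutoff (E := E) k
  have key := hφ.integral_inv_smul_sub_mul_tendsto_integral_lineDeriv_mul' (μ := μ) hs
    hF.continuous (-h)
  have hint : ∀ G : E → ℝ, Continuous G → Integrable (fun v => radialCutoff k v * G v) μ :=
    fun G hG => (hφ.continuous.mul hG).integrable_of_hasCompactSupport hs.mul_right
  refine le_of_tendsto key ?_
  filter_upwards [Ioc_mem_nhdsGT zero_lt_one] with t ht
  have e1 : ∫ v, radialCutoff k (v + t • (-h)) * F v ∂μ
      = ∫ v, radialCutoff k v * F (v + t • h) ∂μ := by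
    rw [← integral_add_right_eq_self _ (t • h)]
    simp
  have i1 : Integrable (fun v => radialCutoff k (v + t • (-h)) * F v) μ := by
    have := (hint (fun v => F (v + t • h)) (hF.continuous.comp (by fun_prop))).comp_add_right
      (t • (-h))
    simpa using this
  have e2 : ∫ v, (t⁻¹ • (radialCutoff k (v + t • (-h)) - radialCutoff k v)) * F v ∂μ
      = ∫ v, radialCutoff k v * (t⁻¹ * (F (v + t • h) - F v)) ∂μ := by
    have a1 : ∀ v, (t⁻¹ • (radialCutoff k (v + t • (-h)) - radialCutoff k v)) * F v
        = t⁻¹ * (radialCutoff k (v + t • (-h)) * F v - radialCutoff k v * F v) := fun v => by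
      rw [smul_eq_mul]; ring
    have a2 : ∀ v, radialCutoff k v * (t⁻¹ * (F (v + t • h) - F v))
        = t⁻¹ * (radialCutoff k v * F (v + t • h) - radialCutoff k v * F v) := fun v => by ring
    simp only [a1, a2]
    rw [integral_const_mul, integral_const_mul, integral_sub i1 (hint F hF.continuous), e1,
      integral_sub (hint (fun v => F (v + t • h)) (hF.continuous.comp (by fun_prop)))
        (hint F hF.continuous)]
  rw [e2, ← integral_const_mul]
  refine integral_mono (hint (fun v => t⁻¹ * (F (v + t • h) - F v)) ?_) ?_ fun v => ?_
  · have := hF.continuous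
    fun_prop
  · exact (hφ.continuous.integrable_of_hasCompactSupport hs).const_mul _
  · by_cases hv : 1 ≤ ‖v‖
    · simp [radialCutoff_of_one_le k hv]
    push Not at hv
    have m1 : v ∈ Y := h0 (by simpa using hv.le)
    have m2 : v + h ∈ Y := h1 (by simpa [mem_closedBall, dist_eq_norm] using hv.le)
    have c1 := hc.2 m1 m2 (sub_nonneg.2 ht.2) ht.1.le (by ring)
    have c2 : (1 - t) • v + t • (v + h) = v + t • h := by module
    rw [c2, smul_eq_mul, smul_eq_mul] at c1
    have c3 : t⁻¹ * (F (v + t • h) - F v) ≤ F (v + h) - F v := by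
      rw [inv_mul_le_iff₀ ht.1]; linarith
    have l1 := (le_abs_self _).trans (hF.norm_sub_le (v + h) h)
    have l2 := (le_abs_self _).trans (hF.norm_sub_le 0 v)
    rw [add_sub_cancel_right] at l1
    rw [zero_sub, norm_neg] at l2
    have l3 : (κ : ℝ) * ‖v‖ ≤ κ * 1 := mul_le_mul_of_nonneg_left hv.le κ.2
    show radialCutoff k v * _ ≤ (F h - F 0 + 2 * κ) * radialCutoff k v
    rw [mul_comm (F h - F 0 + 2 * κ)]
    exact mul_le_mul_of_nonneg_left (by linarith) (radialCutoff_nonneg k v)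

theorem integral_lineDeriv_radialCutoff_mul {E : Type*} [NormedAddCommGroup E]
    [InnerProductSpace ℝ E] [FiniteDimensional ℝ E] [MeasurableSpace E] [BorelSpace E]
    (μ : Measure E) [μ.IsAddHaarMeasure] (F : E → ℝ) (h : E) (j : ℕ) :
    ∫ v, lineDeriv ℝ (radialCutoff (2 * (j + 1))) v (-h) * F v ∂μ =
      ∫ v in ball 0 1, 2 * (j + 1) * ‖v‖ ^ (2 * j) * inner ℝ v h * F v ∂μ := by
  rw [← integral_indicator measurableSet_ball]
  refine integral_congr_ae ?_
  -- On the unit sphere the cutoff may fail to be differentiable, but the sphere is a null set.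
  have hz : ∀ᵐ v ∂μ, v ∉ sphere (0 : E) 1 :=
    measure_eq_zero_iff_ae_notMem.1 (Measure.addHaar_sphere_of_ne_zero μ 0 one_ne_zero)
  filter_upwards [hz] with v hv
  rw [mem_sphere_zero_iff_norm] at hv
  rcases lt_or_gt_of_ne hv with h1 | h1
  · rw [lineDeriv_radialCutoff j h h1, indicator_of_mem (by simpa using h1)]
  · rw [lineDeriv_radialCutoff_of_one_lt _ _ h1, indicator_of_notMem (by simpa using h1.le),
      zero_mul]

theorem integral_radialCutoff {E : Type*} [NormedAddCommGroup E]
    [InnerProductSpace ℝ E] [FiniteDimensional ℝ E] [Nontrivial E] [MeasurableSpace E]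
    [BorelSpace E] (μ : Measure E) [μ.IsAddHaarMeasure] (k : ℕ) :
    ∫ v, radialCutoff k v ∂μ = μ.toSphere.real univ *
      (1 / (Module.finrank ℝ E : ℝ) - 1 / (Module.finrank ℝ E + k)) := by
  obtain ⟨e, he⟩ := Nat.exists_eq_succ_of_ne_zero (Module.finrank_pos (R := ℝ) (M := E)).ne'
  have h1 : ∫ v, radialCutoff k v ∂μ = ∫ v in ball 0 1, (1 - ‖v‖ ^ k) * 1 ∂μ := by
    rw [← integral_indicator measurableSet_ball]
    refine integral_congr_ae (Eventually.of_forall fun v => ?_)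
    by_cases hv : ‖v‖ < 1
    · simp [indicator, hv, radialCutoff, min_eq_left hv.le]
    · simp [indicator, hv, radialCutoff_of_one_le k (not_lt.1 hv)]
  rw [h1, setIntegral_ball_mul_radial μ (fun ρ => 1 - ρ ^ k) (fun _ => 1), he]
  have h2 : ∀ ρ : ℝ, ρ ^ (e.succ - 1) * (1 - ρ ^ k) = ρ ^ e * (1 * ρ ^ 0) - ρ ^ e * (1 * ρ ^ k) :=
    fun ρ => by simp; ring
  simp only [h2]
  rw [intervalIntegral.integral_sub (Continuous.intervalIntegrable (by fun_prop) _ _)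
    (Continuous.intervalIntegrable (by fun_prop) _ _), integral_pow_mul_pow,
    integral_pow_mul_pow]
  simp [add_right_comm]

/-- The integration-by-parts inequality in polar coordinates. As `j` grows, the gradient of the
cutoff concentrates at the unit sphere; the subtracted term is the error made by evaluating `F` at
`v / ‖v‖` instead of `v`. -/
theorem integral_sphere_inner_mul_le_of_exponent {E : Type*} [NormedAddCommGroup E]
    [InnerProductSpace ℝ E] [FiniteDimensional ℝ E] [Nontrivial E] [MeasurableSpace E]
    [BorelSpace E] (μ : Measure E) [μ.IsAddHaarMeasure] {F : E → ℝ} {κ : NNReal}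
    (hF : LipschitzWith κ F)
    {Y : Set E} (hc : ConvexOn ℝ Y F) {h : E} (h0 : closedBall 0 1 ⊆ Y)
    (h1 : closedBall h 1 ⊆ Y) (j : ℕ) :
    (∫ u : sphere (0 : E) 1, inner ℝ u.1 h * F u ∂μ.toSphere) *
        (2 * (j + 1) / (Module.finrank ℝ E + (2 * j + 1))) -
      κ * ‖h‖ * (μ.toSphere.real univ * (2 * (j + 1) / (Module.finrank ℝ E + (2 * j + 1)) -
        2 * (j + 1) / (Module.finrank ℝ E + (2 * j + 2)))) ≤
    (F h - F 0 + 2 * κ) * (μ.toSphere.real univ *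
      (1 / (Module.finrank ℝ E : ℝ) - 1 / (Module.finrank ℝ E + (2 * j + 2)))) := by
  have A := integral_lineDeriv_radialCutoff_mul_le μ hF hc h0 h1 (2 * (j + 1))
  rw [integral_lineDeriv_radialCutoff_mul, integral_radialCutoff] at A
  obtain ⟨e, he⟩ := Nat.exists_eq_succ_of_ne_zero (Module.finrank_pos (R := ℝ) (M := E)).ne'
  have hm : Measurable F := hF.continuous.measurable
  have B1 := setIntegral_ball_mul_radial μ (fun ρ => 2 * (j + 1) * ρ ^ (2 * j + 1))
    (fun u => inner ℝ u h * F u)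
  have B2 := setIntegral_ball_mul_radial μ
    (fun ρ => 2 * (j + 1) * ρ ^ (2 * j + 1) * (1 - ρ)) (fun _ => 1)
  have hb : ∀ v : E, ‖‖v‖⁻¹ • v‖ ≤ 1 := fun v => by
    rw [norm_smul, norm_inv, norm_norm]
    exact inv_mul_le_one
  have hbF : ∀ v : E, ‖v‖ ≤ 1 → |F v| ≤ |F 0| + κ := fun v hv => by
    have l1 := hF.norm_sub_le v 0
    rw [sub_zero, Real.norm_eq_abs] at l1
    have l2 : (κ : ℝ) * ‖v‖ ≤ κ * 1 := mul_le_mul_of_nonneg_left hv κ.2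
    have l3 := abs_sub_abs_le_abs_sub (F v) (F 0)
    linarith
  have hfin : μ (ball (0 : E) 1) < ⊤ := measure_ball_lt_top
  have I1 : IntegrableOn (fun v : E => 2 * (j + 1) * ‖v‖ ^ (2 * j + 1) *
      (inner ℝ (‖v‖⁻¹ • v) h * F (‖v‖⁻¹ • v))) (ball 0 1) μ := by
    refine Measure.integrableOn_of_bounded (M := 2 * (j + 1) * (‖h‖ * (|F 0| + κ))) hfin.ne
      (Measurable.aestronglyMeasurable (by fun_prop)) ?_
    refine (ae_restrict_iff' measurableSet_ball).2 (Eventually.of_forall fun v hv => ?_)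
    rw [mem_ball_zero_iff] at hv
    have b1 : ‖v‖ ^ (2 * j + 1) ≤ 1 := pow_le_one₀ (norm_nonneg _) hv.le
    have b2 : |inner ℝ (‖v‖⁻¹ • v) h| ≤ ‖h‖ :=
      (abs_real_inner_le_norm _ _).trans (mul_le_of_le_one_left (norm_nonneg _) (hb v))
    have b3 := hbF _ (hb v)
    rw [Real.norm_eq_abs, abs_mul, abs_mul (inner ℝ _ _), abs_of_nonneg (by positivity)]
    calc _ ≤ 2 * ((j : ℝ) + 1) * 1 * (‖h‖ * (|F 0| + κ)) := by gcongr
      _ = _ := by ring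
  have I2 : IntegrableOn (fun v : E => 2 * (j + 1) * ‖v‖ ^ (2 * j + 1) * (1 - ‖v‖) * 1)
      (ball 0 1) μ :=
    (Continuous.continuousOn (by fun_prop)).integrableOn_compact
      (isCompact_closedBall (0 : E) 1) |>.mono_set ball_subset_closedBall
  have I3 : IntegrableOn (fun v : E => 2 * (j + 1) * ‖v‖ ^ (2 * j) * inner ℝ v h * F v)
      (ball 0 1) μ := by
    have := hF.continuous
    exact (Continuous.continuousOn (by fun_prop)).integrableOn_compact
      (isCompact_closedBall (0 : E) 1) |>.mono_set ball_subset_closedBall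
  -- Pointwise, `F` changes by at most `κ * (1 - ‖v‖)` between `v` and `‖v‖⁻¹ • v`. The factor `‖v‖`
  -- of `inner ℝ v h` joins the radial power, whose exponent becomes `2 * j + 1`.
  have M := setIntegral_mono_on (I1.sub (I2.const_mul (κ * ‖h‖))) I3 measurableSet_ball
    (fun v hv => by
      rw [mem_ball_zero_iff] at hv
      rcases eq_or_ne v 0 with rfl | hne
      · simp
      have hp : 0 < ‖v‖ := norm_pos_iff.2 hne
      set w := ‖v‖⁻¹ • v with hw
      have hvw : v = ‖v‖ • w := by rw [hw, smul_inv_smul₀ hp.ne']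
      have d1 : F w - F v ≤ κ * (1 - ‖v‖) ∧ -(κ * (1 - ‖v‖)) ≤ F w - F v := by
        have := hF.norm_sub_le w v
        have e : ‖w - v‖ = 1 - ‖v‖ := by
          have : w - v = (1 - ‖v‖) • w := by rw [sub_smul, one_smul, ← hvw]
          rw [this, norm_smul, Real.norm_of_nonneg (by linarith), hw, norm_smul, norm_inv,
            norm_norm, inv_mul_cancel₀ hp.ne', mul_one]
        rw [e, Real.norm_eq_abs] at this
        exact ⟨(le_abs_self _).trans this, neg_le_of_abs_le this⟩
      have d2 : |inner ℝ w h * (F w - F v)| ≤ ‖h‖ * (κ * (1 - ‖v‖)) := by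
        rw [abs_mul]
        refine mul_le_mul ((abs_real_inner_le_norm _ _).trans
          (mul_le_of_le_one_left (norm_nonneg _) (hb v))) (abs_le.2 ⟨d1.2, d1.1⟩)
          (abs_nonneg _) (norm_nonneg _)
      have d3 := (le_abs_self _).trans d2
      have d4 : inner ℝ v h = ‖v‖ * inner ℝ w h := by
        conv_lhs => rw [hvw]
        rw [real_inner_smul_left]
      simp only [Pi.sub_apply]
      rw [d4]
      have d5 : 0 ≤ 2 * ((j : ℝ) + 1) * ‖v‖ ^ (2 * j + 1) := by positivity
      have d6 := mul_le_mul_of_nonneg_left d3 d5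
      have d7 : ‖v‖ ^ (2 * j) * ‖v‖ = ‖v‖ ^ (2 * j + 1) := (pow_succ _ _).symm
      calc _ = 2 * ((j : ℝ) + 1) * ‖v‖ ^ (2 * j + 1) * (inner ℝ w h * F v) +
            (2 * ((j : ℝ) + 1) * ‖v‖ ^ (2 * j + 1) * (inner ℝ w h * (F w - F v)) -
            2 * ((j : ℝ) + 1) * ‖v‖ ^ (2 * j + 1) * (‖h‖ * (κ * (1 - ‖v‖)))) := by ring
        _ ≤ 2 * ((j : ℝ) + 1) * ‖v‖ ^ (2 * j + 1) * (inner ℝ w h * F v) := by linarith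
        _ = _ := by rw [← d7]; ring)
  simp only [Pi.sub_apply] at M
  rw [integral_sub I1 (I2.const_mul _), integral_const_mul, B1, B2] at M
  have hp2 : ∀ ρ : ℝ, ρ ^ (e.succ - 1) * (2 * (j + 1) * ρ ^ (2 * j + 1) * (1 - ρ)) =
      ρ ^ e * (2 * (j + 1) * ρ ^ (2 * j + 1)) - ρ ^ e * (2 * (j + 1) * ρ ^ (2 * j + 2)) :=
    fun ρ => by simp; ring
  simp only [he, hp2] at M
  rw [intervalIntegral.integral_sub (Continuous.intervalIntegrable (by fun_prop) _ _)
    (Continuous.intervalIntegrable (by fun_prop) _ _)] at M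
  simp only [Nat.succ_sub_one, integral_pow_mul_pow] at M
  rw [he] at A ⊢
  push_cast at A M ⊢
  simp only [integral_const, smul_eq_mul, mul_one] at M
  have r1 : (e : ℝ) + (2 * j + 1) + 1 = e + 1 + (2 * j + 1) := by ring
  have r2 : (e : ℝ) + (2 * j + 2) + 1 = e + 1 + (2 * j + 2) := by ring
  have r3 : (e : ℝ) + 1 + 2 * (j + 1) = e + 1 + (2 * j + 2) := by ring
  rw [r1, r2] at M
  rw [r3] at A
  exact M.trans A

/-- The limit `j → ∞`: the radial weight tends to `1`, the replacement error to `0`, and the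
normalised integral of the cutoff to `1 / d`. -/
theorem finrank_mul_integral_sphere_inner_mul_le {E : Type*} [NormedAddCommGroup E]
    [InnerProductSpace ℝ E] [FiniteDimensional ℝ E] [Nontrivial E] [MeasurableSpace E]
    [BorelSpace E] (μ : Measure E) [μ.IsAddHaarMeasure] {F : E → ℝ} {κ : NNReal}
    (hF : LipschitzWith κ F)
    {Y : Set E} (hc : ConvexOn ℝ Y F) {h : E} (h0 : closedBall 0 1 ⊆ Y)
    (h1 : closedBall h 1 ⊆ Y) :
    (Module.finrank ℝ E : ℝ) * ∫ u : sphere (0 : E) 1, inner ℝ u.1 h * F u ∂μ.toSphere ≤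
      (F h - F 0 + 2 * κ) * μ.toSphere.real univ := by
  set d : ℝ := (Module.finrank ℝ E : ℝ) with hd
  have hd0 : 0 < d := Nat.cast_pos.2 Module.finrank_pos
  have hT : Tendsto (fun j : ℕ => 2 * (j : ℝ)) atTop atTop :=
    tendsto_natCast_atTop_atTop.const_mul_atTop two_pos
  have lim0 : ∀ a : ℝ, Tendsto (fun j : ℕ => 1 / (d + (2 * (j : ℝ) + a))) atTop (𝓝 0) :=
    fun a => by
      simp only [one_div]
      exact (tendsto_atTop_add_const_left _ _
        (tendsto_atTop_add_const_right _ _ hT)).inv_tendsto_atTop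
  have lim1 : ∀ a : ℝ, 0 < a → Tendsto (fun j : ℕ => 2 * ((j : ℝ) + 1) / (d + (2 * j + a)))
      atTop (𝓝 1) := fun a ha => by
    have := ((lim0 a).const_mul (d + a - 2)).const_sub 1
    rw [mul_zero, sub_zero] at this
    refine this.congr fun j => ?_
    have : d + (2 * (j : ℝ) + a) ≠ 0 := by positivity
    field_simp
    ring
  have hl := ((lim1 1 one_pos).const_mul
      (∫ u : sphere (0 : E) 1, inner ℝ u.1 h * F u ∂μ.toSphere)).sub
    ((((lim1 1 one_pos).sub (lim1 2 two_pos)).const_mul (μ.toSphere.real univ)).const_mul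
      (κ * ‖h‖))
  have hr := (((lim0 2).const_sub (1 / d)).const_mul (μ.toSphere.real univ)).const_mul
    (F h - F 0 + 2 * κ)
  have := le_of_tendsto_of_tendsto' hl hr fun j =>
    integral_sphere_inner_mul_le_of_exponent μ hF hc h0 h1 j
  simp only [sub_self, mul_zero, sub_zero, mul_one] at this
  calc _ ≤ d * ((F h - F 0 + 2 * κ) * (μ.toSphere.real univ * (1 / d))) :=
        mul_le_mul_of_nonneg_left this hd0.le
    _ = _ := by field_simp

/-- In expectation, the two-point estimator is an approximate subgradient. -/
theorem le_integral_inner_gradEst {p : ℕ} (hp : 1 ≤ p) {X : Set (EuclideanSpace ℝ (Fin p))}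
    {f : EuclideanSpace ℝ (Fin p) → ℝ} (hf : ConvexOn ℝ X f) {K : ℝ} (hK0 : 0 ≤ K)
    (hK : ∀ x ∈ X, ∀ y ∈ X, |f x - f y| ≤ K * ‖x - y‖) {δ : ℝ} (hδ : 0 < δ)
    {x y : EuclideanSpace ℝ (Fin p)} (hx : closedBall x δ ⊆ X) (hy : closedBall y δ ⊆ X) :
    f x - f y - 2 * K * δ ≤
      ∫ u, inner ℝ (gradEst f δ x u.1) (x - y) ∂(sphereUniform p) := by
  have hne : Nonempty (Fin p) := ⟨⟨0, hp⟩⟩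
  lift K to NNReal using hK0
  lift δ to NNReal using hδ.le
  -- The integration by parts needs a Lipschitz function on the whole space, while convexity is
  -- needed only on `X`.
  obtain ⟨f', hf', he⟩ := (LipschitzOnWith.of_dist_le_mul (K := K) (f := f) (s := X)
    fun a ha b hb => by rw [Real.dist_eq, dist_eq_norm]; exact hK a ha b hb).extend_real
  -- Rescaling by `δ` around `x` reduces to the unit ball. The Lipschitz constant becomes `K * δ`,
  -- which is the source of the error `2 * K * δ`.
  set F : EuclideanSpace ℝ (Fin p) → ℝ := fun v => f' (x + (δ : ℝ) • v) - f x with hFdef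
  have hF : LipschitzWith (K * δ) F := LipschitzWith.of_dist_le_mul fun v w => by
    have := hf'.dist_le_mul (x + (δ : ℝ) • v) (x + (δ : ℝ) • w)
    rw [dist_add_left, dist_smul₀, Real.norm_of_nonneg hδ.le] at this
    simp only [hFdef, dist_sub_right, NNReal.coe_mul]
    linarith
  have hx0 : x ∈ X := hx (mem_closedBall_self δ.2)
  have hy0 : y ∈ X := hy (mem_closedBall_self δ.2)
  have hc : ConvexOn ℝ {v | x + (δ : ℝ) • v ∈ X} F := by
    have hcomb : ∀ (v w : EuclideanSpace ℝ (Fin p)) (a b : ℝ), a + b = 1 →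
        x + (δ : ℝ) • (a • v + b • w) = a • (x + (δ : ℝ) • v) + b • (x + (δ : ℝ) • w) := by
      intro v w a b hab
      have : x = (a + b) • x := by rw [hab, one_smul]
      nth_rewrite 1 [this]
      module
    refine ⟨fun v hv w hw a b ha hb hab => ?_, fun v hv w hw a b ha hb hab => ?_⟩
    · rw [mem_ofPred_eq, hcomb v w a b hab]
      exact hf.1 hv hw ha hb hab
    · have h1 := hf.2 hv hw ha hb hab
      have h2 := hf.1 hv hw ha hb hab
      simp only [hFdef, smul_eq_mul] at h1 ⊢
      rw [hcomb v w a b hab, ← he h2, ← he hv, ← he hw]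
      have : f x = (a + b) * f x := by rw [hab, one_mul]
      linarith
  set h := (δ : ℝ)⁻¹ • (y - x) with hh
  have hδh : x + (δ : ℝ) • h = y := by rw [hh, smul_inv_smul₀ hδ.ne', add_sub_cancel]
  have key := finrank_mul_integral_sphere_inner_mul_le
    (volume : Measure (EuclideanSpace ℝ (Fin p))) hF hc (h := h)
    (fun v hv => hx (by
      rw [mem_closedBall_zero_iff] at hv
      rw [mem_closedBall, dist_eq_norm, add_sub_cancel_left, norm_smul,
        Real.norm_of_nonneg hδ.le]
      exact mul_le_of_le_one_right hδ.le hv))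
    (fun v hv => hy (by
      rw [mem_closedBall, dist_eq_norm] at hv ⊢
      rw [← hδh, add_sub_add_left_eq_sub, ← smul_sub, norm_smul, Real.norm_of_nonneg hδ.le]
      exact mul_le_of_le_one_right hδ.le hv))
  have hF0 : F 0 = 0 := by simp only [hFdef]; rw [smul_zero, add_zero, ← he hx0, sub_self]
  have hFh : F h = f y - f x := by simp only [hFdef]; rw [hδh, ← he hy0]
  rw [hF0, hFh, finrank_euclideanSpace_fin] at key
  set σ := (volume : Measure (EuclideanSpace ℝ (Fin p))).toSphere with hσ
  have : NeZero σ := ⟨Measure.toSphere_ne_zero _⟩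
  have hpos : 0 < σ.real univ := measureReal_univ_pos
  have e1 : ∀ u : sphere (0 : EuclideanSpace ℝ (Fin p)) 1,
      inner ℝ (gradEst f δ x u.1) (x - y) = -p * (inner ℝ u.1 h * F u.1) := fun u => by
    have hu : x + (δ : ℝ) • u.1 ∈ X := hx (by
      rw [mem_closedBall, dist_eq_norm, add_sub_cancel_left, norm_smul, norm_eq_of_mem_sphere,
        Real.norm_of_nonneg hδ.le, mul_one])
    have : x - y = -((δ : ℝ) • h) := by rw [hh, smul_inv_smul₀ hδ.ne', neg_sub]
    rw [gradEst, this, inner_neg_right, real_inner_smul_left, real_inner_smul_right]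
    simp only [hFdef]
    rw [← he hu]
    field_simp
  simp only [e1]
  rw [integral_const_mul, sphereUniform, integral_smul_measure, ENNReal.toReal_inv, ← hσ,
    smul_eq_mul]
  change _ ≤ _ * ((σ.real univ)⁻¹ * _)
  rw [NNReal.coe_mul] at key
  have k2 := mul_le_mul_of_nonneg_left key (inv_nonneg.2 hpos.le)
  have k3 : (σ.real univ)⁻¹ * ((f y - f x - 0 + 2 * (K * δ)) * σ.real univ)
      = f y - f x + 2 * (K * δ) := by field_simp; ring
  rw [k3] at k2
  linarith

end DistBandit

/-! ### Mixing matrices and the contraction of disagreement. -/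

namespace DistBandit

theorem NetworkAssumption.nonneg {n : ℕ} {G : ℕ → Digraph (Fin n)}
    {W : ℕ → Matrix (Fin n) (Fin n) ℝ} {w : ℝ} {B : ℕ} (h : NetworkAssumption G W w B)
    (hw : 0 ≤ w) {t : ℕ} (ht : 1 ≤ t) (i j : Fin n) : 0 ≤ W t i j := by
  by_cases hij : (G t).Adj j i ∨ i = j
  · exact hw.trans (h.weight_ge t ht i j hij)
  · exact (h.weight_zero t ht i j hij).ge

/-- The product `W (t + k) ⋯ W (t + 1)`. -/
noncomputable def transition {n : ℕ} (W : ℕ → Matrix (Fin n) (Fin n) ℝ) (t : ℕ) :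
    ℕ → Matrix (Fin n) (Fin n) ℝ
  | 0 => 1
  | k + 1 => W (t + k + 1) * transition W t k

section Transition

variable {n : ℕ} {G : ℕ → Digraph (Fin n)} {W : ℕ → Matrix (Fin n) (Fin n) ℝ} {w : ℝ} {B : ℕ}

theorem transition_nonneg (h : NetworkAssumption G W w B) (hw : 0 ≤ w) (t k : ℕ) (i j : Fin n) :
    0 ≤ transition W t k i j := by
  induction k generalizing i with
  | zero =>
    rw [transition, Matrix.one_apply]
    split_ifs <;> norm_num
  | succ k ih =>
    rw [transition, Matrix.mul_apply]
    exact Finset.sum_nonneg fun l _ => mul_nonneg (h.nonneg hw (by omega) i l) (ih l)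

theorem transition_row_sum (h : NetworkAssumption G W w B) (t k : ℕ) (i : Fin n) :
    ∑ j, transition W t k i j = 1 := by
  induction k generalizing i with
  | zero => simp [transition, Matrix.one_apply]
  | succ k ih =>
    simp only [transition, Matrix.mul_apply]
    rw [Finset.sum_comm]
    simp only [← Finset.mul_sum, ih, mul_one]
    exact h.row_sum _ (by omega) i

theorem pow_succ_le_transition (h : NetworkAssumption G W w B) (hw : 0 ≤ w) {t k : ℕ}
    {i j l : Fin n} (hl : (G (t + k + 1)).Adj l i ∨ i = l) (hk : w ^ k ≤ transition W t k l j) :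
    w ^ (k + 1) ≤ transition W t (k + 1) i j := by
  rw [transition, Matrix.mul_apply, pow_succ']
  calc w * w ^ k ≤ W (t + k + 1) i l * transition W t k l j :=
        mul_le_mul (h.weight_ge _ (by omega) i l hl) hk (by positivity)
          (h.nonneg hw (by omega) i l)
    _ ≤ _ := Finset.single_le_sum (f := fun l => W (t + k + 1) i l * transition W t k l j)
        (fun l _ => mul_nonneg (h.nonneg hw (by omega) i l) (transition_nonneg h hw t k l j))
        (Finset.mem_univ l)

/-- The agents on which the state of agent `j` has a guaranteed influence after `k` steps. -/
noncomputable def influenced (W : ℕ → Matrix (Fin n) (Fin n) ℝ) (w : ℝ) (t : ℕ) (j : Fin n)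
    (k : ℕ) : Finset (Fin n) :=
  open scoped Classical in {i | w ^ k ≤ transition W t k i j}

theorem mem_influenced {t k : ℕ} {i j : Fin n} :
    i ∈ influenced W w t j k ↔ w ^ k ≤ transition W t k i j := by
  simp [influenced]

theorem influenced_mono (h : NetworkAssumption G W w B) (hw : 0 ≤ w) (t : ℕ) (j : Fin n) :
    Monotone (influenced W w t j) :=
  monotone_nat_of_le_succ fun _ _ hi =>
    mem_influenced.2 (pow_succ_le_transition h hw (.inr rfl) (mem_influenced.1 hi))

/-- If the set does not grow during `B` steps, it is closed under all edges active in that window.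
It contains `j`, so strong connectivity of the union graph makes it everything. -/
theorem influenced_eq_univ_or_ssubset (h : NetworkAssumption G W w B) (hw : 0 ≤ w) (t : ℕ)
    (j : Fin n) (k : ℕ) :
    influenced W w t j k = Finset.univ ∨
      influenced W w t j k ⊂ influenced W w t j (k + B) := by
  have hmono := influenced_mono h hw t j
  rcases (hmono (Nat.le_add_right k B)).eq_or_ssubset with he | hs
  · left
    refine Finset.eq_univ_iff_forall.2 fun i => ?_
    have h0 : j ∈ influenced W w t j k :=
      hmono (Nat.zero_le k) (mem_influenced.2 (by simp [transition]))
    have hcon := h.connected (t + k + 1) (by omega) j i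
    induction hcon with
    | refl => exact h0
    | tail _ hbc ih =>
      obtain ⟨l, hl, hadj⟩ := hbc
      -- An edge active at time `t + k + 1 + l` carries influence from index `k + l` to `k + l + 1`,
      -- which is at most `k + B` because `l < B`.
      have h1 := hmono (Nat.le_add_right k l) ih
      have h2 : _ ∈ influenced W w t j (k + l + 1) := mem_influenced.2
        (pow_succ_le_transition h hw (t := t) (k := k + l)
          (.inl (by rwa [show t + (k + l) + 1 = t + k + 1 + l by omega])) (mem_influenced.1 h1))
      have h3 := hmono (show k + l + 1 ≤ k + B by omega) h2
      exact he ▸ h3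
  · exact .inr hs

/-- Unless it is already full, the influenced set gains an agent in each block of `B` steps, so `n`
blocks suffice. -/
theorem pow_le_transition (h : NetworkAssumption G W w B) (hw : 0 ≤ w) (t : ℕ) (i j : Fin n) :
    w ^ (n * B) ≤ transition W t (n * B) i j := by
  have key : ∀ m, influenced W w t j (m * B) = Finset.univ ∨
      m ≤ (influenced W w t j (m * B)).card := by
    intro m
    induction m with
    | zero => exact .inr (Nat.zero_le _)
    | succ m ih =>
      have hm := influenced_mono h hw t j (show m * B ≤ (m + 1) * B by gcongr; omega)
      rcases influenced_eq_univ_or_ssubset h hw t j (m * B) with hu | hs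
      · exact .inl (Finset.univ_subset_iff.1 (hu ▸ hm))
      · rw [show m * B + B = (m + 1) * B by ring] at hs
        rcases ih with hu | hc
        · exact .inl (Finset.univ_subset_iff.1 (hu ▸ hm))
        · exact .inr (Nat.succ_le_of_lt (hc.trans_lt (Finset.card_lt_card hs)))
  refine mem_influenced.1 ?_
  rcases key n with hu | hc
  · rw [hu]; exact Finset.mem_univ i
  · have : influenced W w t j (n * B) = Finset.univ :=
      Finset.eq_univ_of_card _ (le_antisymm (Finset.card_le_univ _) (by simpa using hc))
    rw [this]; exact Finset.mem_univ i

end Transition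

/-- A stochastic matrix with entries at least `β` contracts distances by `1 - β`. -/
theorem norm_sum_smul_sub_sum_smul_le {E : Type*} [NormedAddCommGroup E] [NormedSpace ℝ E]
    {n : ℕ} {A : Matrix (Fin n) (Fin n) ℝ} {β d : ℝ} (h0 : ∀ i j, 0 ≤ A i j)
    (hβ : ∀ i j, β ≤ A i j) (h1 : ∀ i, ∑ j, A i j = 1) (hd : 0 ≤ d) {x : Fin n → E}
    (hx : ∀ k l, ‖x k - x l‖ ≤ d) (i j : Fin n) :
    ‖∑ k, A i k • x k - ∑ k, A j k • x k‖ ≤ (1 - β) * d := by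
  -- Couple rows `i` and `j` independently: the difference is an average of `x k - x l` over pairs.
  -- Diagonal pairs contribute nothing and carry mass at least `β`.
  have e1 : ∑ k, A i k • x k - ∑ k, A j k • x k
      = ∑ k, ∑ l, (A i k * A j l) • (x k - x l) := by
    have a1 : ∑ k, ∑ l, (A i k * A j l) • x k = ∑ k, A i k • x k := by
      refine Finset.sum_congr rfl fun k _ => ?_
      rw [← Finset.sum_smul, ← Finset.mul_sum, h1, mul_one]
    have a2 : ∑ k, ∑ l, (A i k * A j l) • x l = ∑ k, A j k • x k := by
      rw [Finset.sum_comm]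
      refine Finset.sum_congr rfl fun k _ => ?_
      rw [← Finset.sum_smul, ← Finset.sum_mul, h1, one_mul]
    simp only [smul_sub, Finset.sum_sub_distrib, a1, a2]
  have e2 : ∀ k l, ‖(A i k * A j l) • (x k - x l)‖ ≤
      A i k * A j l * d - if k = l then A i k * A j l * d else 0 := by
    intro k l
    rw [norm_smul, Real.norm_of_nonneg (mul_nonneg (h0 _ _) (h0 _ _))]
    split_ifs with hkl
    · subst hkl; simp
    · rw [sub_zero]
      exact mul_le_mul_of_nonneg_left (hx k l) (mul_nonneg (h0 _ _) (h0 _ _))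
  have e3 : β ≤ ∑ k, A i k * A j k := by
    calc β = ∑ k, β * A j k := by rw [← Finset.mul_sum, h1, mul_one]
      _ ≤ _ := Finset.sum_le_sum fun k _ => mul_le_mul_of_nonneg_right (hβ i k) (h0 j k)
  rw [e1]
  calc _ ≤ ∑ k, ∑ l, (A i k * A j l * d - if k = l then A i k * A j l * d else 0) :=
        norm_sum_le_of_le _ fun k _ => norm_sum_le_of_le _ fun l _ => e2 k l
    _ = d - (∑ k, A i k * A j k) * d := by
        simp only [Finset.sum_sub_distrib, ← Finset.sum_mul, ← Finset.mul_sum, h1, mul_one,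
          one_mul, Finset.sum_ite_eq, Finset.mem_univ, if_true]
    _ ≤ _ := by
        have := mul_le_mul_of_nonneg_right e3 hd
        linarith

/-- The largest distance between two agents. -/
noncomputable def disagreement {E : Type*} [NormedAddCommGroup E] {n : ℕ} (x : Fin n → E) : ℝ :=
  ⨆ k : Fin n × Fin n, ‖x k.1 - x k.2‖

theorem norm_sub_le_disagreement {E : Type*} [NormedAddCommGroup E] {n : ℕ} (x : Fin n → E)
    (i j : Fin n) : ‖x i - x j‖ ≤ disagreement x :=
  le_ciSup (f := fun k : Fin n × Fin n => ‖x k.1 - x k.2‖) (Set.finite_range _).bddAbove (i, j)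

theorem disagreement_nonneg {E : Type*} [NormedAddCommGroup E] {n : ℕ} (x : Fin n → E) :
    0 ≤ disagreement x :=
  Real.iSup_nonneg fun _ => norm_nonneg _

theorem disagreement_le {E : Type*} [NormedAddCommGroup E] {n : ℕ} {x : Fin n → E} {d : ℝ}
    (hd : 0 ≤ d) (h : ∀ i j, ‖x i - x j‖ ≤ d) : disagreement x ≤ d :=
  Real.iSup_le (fun k => h k.1 k.2) hd

section Consensus

variable {E : Type*} [NormedAddCommGroup E] [NormedSpace ℝ E] {n : ℕ}
  {G : ℕ → Digraph (Fin n)} {W : ℕ → Matrix (Fin n) (Fin n) ℝ} {w : ℝ} {B : ℕ}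

/-- Averaging by row-stochastic matrices never amplifies earlier errors, so the perturbations simply
add up. -/
theorem norm_sub_transition_le (h : NetworkAssumption G W w B) (hw : 0 ≤ w)
    {x e : ℕ → Fin n → E} {t : ℕ}
    (hx : ∀ k i, x (t + k + 1) i = ∑ j, W (t + k + 1) i j • (x (t + k) j + e (t + k) j))
    (k : ℕ) (i : Fin n) :
    ‖x (t + k) i - ∑ j, transition W t k i j • x t j‖ ≤
      ∑ s ∈ Finset.range k, ∑ j, ‖e (t + s) j‖ := by
  induction k generalizing i with
  | zero => simp [transition, Matrix.one_apply]
  | succ k ih =>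
    have e1 : x (t + (k + 1)) i - ∑ j, transition W t (k + 1) i j • x t j
        = ∑ l, W (t + k + 1) i l •
          ((x (t + k) l - ∑ j, transition W t k l j • x t j) + e (t + k) l) := by
      have e2 : ∑ j, transition W t (k + 1) i j • x t j
          = ∑ l, W (t + k + 1) i l • ∑ j, transition W t k l j • x t j := by
        simp only [transition, Matrix.mul_apply, Finset.sum_smul, Finset.smul_sum, smul_smul]
        exact Finset.sum_comm
      rw [e2, ← add_assoc, hx, ← Finset.sum_sub_distrib]
      refine Finset.sum_congr rfl fun l _ => ?_
      rw [← smul_sub]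
      congr 1
      abel
    rw [e1, Finset.sum_range_succ]
    set S := ∑ s ∈ Finset.range k, ∑ j, ‖e (t + s) j‖
    have hl : ∀ l, ‖W (t + k + 1) i l •
          ((x (t + k) l - ∑ j, transition W t k l j • x t j) + e (t + k) l)‖ ≤
        W (t + k + 1) i l * (S + ∑ j, ‖e (t + k) j‖) := fun l => by
      rw [norm_smul, Real.norm_of_nonneg (h.nonneg hw (by omega) i l)]
      refine mul_le_mul_of_nonneg_left ((norm_add_le _ _).trans (add_le_add (ih l) ?_))
        (h.nonneg hw (by omega) i l)
      exact Finset.single_le_sum (f := fun j => ‖e (t + k) j‖) (fun _ _ => norm_nonneg _)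
        (Finset.mem_univ l)
    refine (norm_sum_le_of_le _ fun l _ => hl l).trans_eq ?_
    rw [← Finset.sum_mul, h.row_sum _ (by omega), one_mul]

theorem disagreement_add_le (h : NetworkAssumption G W w B) (hw : 0 ≤ w)
    {x e : ℕ → Fin n → E} {t : ℕ}
    (hx : ∀ k i, x (t + k + 1) i = ∑ j, W (t + k + 1) i j • (x (t + k) j + e (t + k) j)) :
    disagreement (x (t + n * B)) ≤ (1 - w ^ (n * B)) * disagreement (x t) +
      2 * ∑ s ∈ Finset.range (n * B), ∑ j, ‖e (t + s) j‖ := by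
  have key : ∀ i j, ‖x (t + n * B) i - x (t + n * B) j‖ ≤
      (1 - w ^ (n * B)) * disagreement (x t) +
      2 * ∑ s ∈ Finset.range (n * B), ∑ j, ‖e (t + s) j‖ := fun i j => by
    have h1 := norm_sub_transition_le h hw hx (n * B) i
    have h2 := norm_sub_transition_le h hw hx (n * B) j
    have h3 := norm_sum_smul_sub_sum_smul_le (transition_nonneg h hw t (n * B))
      (pow_le_transition h hw t) (transition_row_sum h t (n * B)) (disagreement_nonneg (x t))
      (norm_sub_le_disagreement (x t)) i j
    rw [norm_sub_rev] at h2
    set a := ∑ k, transition W t (n * B) i k • x t k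
    set b := ∑ k, transition W t (n * B) j k • x t k
    have h4 : x (t + n * B) i - x (t + n * B) j
        = (x (t + n * B) i - a) + (a - b) + (b - x (t + n * B) j) := by abel
    rw [h4]
    refine (norm_add₃_le).trans ?_
    linarith
  by_cases hne : Nonempty (Fin n)
  · obtain ⟨i⟩ := hne
    exact disagreement_le ((norm_nonneg _).trans (key i i)) key
  -- Without agents the supremum is over the empty set and takes its default value `0`.
  · rw [not_nonempty_iff] at hne
    simp [disagreement]

end Consensus

/-- Summing the recursion counts each `E t` at most `N` times. The first `N` terms of `D` are
bounded by `Dmax`, and the contracted sum is moved to the left, which leaves the factor `β`. -/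
theorem mul_sum_le_of_contraction {D E : ℕ → ℝ} {β Dmax : ℝ} {N : ℕ} (hβ : β ≤ 1)
    (hD0 : ∀ t, 0 ≤ D t) (hD : ∀ t, D t ≤ Dmax) (hE : ∀ t, 0 ≤ E t)
    (h : ∀ t, D (t + N) ≤ (1 - β) * D t + 2 * ∑ s ∈ Finset.range N, E (t + s)) (T : ℕ) :
    β * ∑ t ∈ Finset.range T, D t ≤ N * Dmax + 2 * N * ∑ t ∈ Finset.range T, E t := by
  have hET : 0 ≤ ∑ t ∈ Finset.range T, E t := Finset.sum_nonneg fun t _ => hE t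
  have hDT : 0 ≤ ∑ t ∈ Finset.range T, D t := Finset.sum_nonneg fun t _ => hD0 t
  have hmax : 0 ≤ Dmax := (hD0 0).trans (hD 0)
  have hsum : ∀ K, ∑ t ∈ Finset.range K, D t ≤ K * Dmax := fun K => by
    simpa using Finset.sum_le_card_nsmul (Finset.range K) D Dmax fun t _ => hD t
  rcases le_total T N with hTN | hTN
  · have h1 : (T : ℝ) * Dmax ≤ N * Dmax := by gcongr
    have h2 : β * ∑ t ∈ Finset.range T, D t ≤ ∑ t ∈ Finset.range T, D t :=
      mul_le_of_le_one_left hDT hβ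
    have h3 : 0 ≤ 2 * N * ∑ t ∈ Finset.range T, E t := by positivity
    linarith [hsum T]
  · obtain ⟨K, rfl⟩ := Nat.exists_eq_add_of_le hTN
    have h1 : ∑ t ∈ Finset.range K, D (N + t) ≤ (1 - β) * ∑ t ∈ Finset.range K, D t +
        2 * ∑ s ∈ Finset.range N, ∑ t ∈ Finset.range K, E (t + s) := by
      rw [Finset.sum_comm, Finset.mul_sum, Finset.mul_sum, ← Finset.sum_add_distrib]
      exact Finset.sum_le_sum fun t _ => by rw [add_comm N t]; exact h t
    have h2 : ∑ s ∈ Finset.range N, ∑ t ∈ Finset.range K, E (t + s) ≤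
        N * ∑ t ∈ Finset.range (N + K), E t := by
      have : ∀ s ∈ Finset.range N, ∑ t ∈ Finset.range K, E (t + s) ≤
          ∑ t ∈ Finset.range (N + K), E t := fun s hs => by
        rw [Finset.range_eq_Ico, Finset.sum_Ico_add', Finset.range_eq_Ico]
        refine Finset.sum_le_sum_of_subset_of_nonneg ?_ fun t _ _ => hE t
        rw [Finset.mem_range] at hs
        exact Finset.Ico_subset_Ico (by omega) (by omega)
      simpa using Finset.sum_le_card_nsmul (Finset.range N) _ _ this
    have h3 : ∑ t ∈ Finset.range K, D t ≤ ∑ t ∈ Finset.range (N + K), D t :=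
      Finset.sum_le_sum_of_subset_of_nonneg
        (Finset.range_subset_range.2 (by omega)) fun t _ _ => hD0 t
    have h4 := mul_le_mul_of_nonneg_left h3 (sub_nonneg.2 hβ)
    have h5 := Finset.sum_range_add D N K
    have h6 := hsum N
    linarith

end DistBandit

/-! ### Step sizes and the summation of one-step inequalities. -/

namespace DistBandit

/-- The step size `t ^ (-c)`. -/
noncomputable def stepSize (c : ℝ) (t : ℕ) : ℝ := 1 / (t : ℝ) ^ c

section StepSize

variable {c : ℝ} {t : ℕ}

theorem stepSize_one : stepSize c 1 = 1 := by simp [stepSize]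

theorem stepSize_pos (ht : 1 ≤ t) : 0 < stepSize c t := by
  have : (0 : ℝ) < t := by exact_mod_cast ht
  unfold stepSize; positivity

theorem stepSize_antitone (hc : 0 ≤ c) {s : ℕ} (hs : 1 ≤ s) (hst : s ≤ t) :
    stepSize c t ≤ stepSize c s := by
  have h1 : (0 : ℝ) < s := by exact_mod_cast hs
  have h2 : (s : ℝ) ≤ t := by exact_mod_cast hst
  exact one_div_le_one_div_of_le (by positivity) (Real.rpow_le_rpow h1.le h2 hc)

theorem stepSize_le_one (hc : 0 ≤ c) (ht : 1 ≤ t) : stepSize c t ≤ 1 := by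
  simpa [stepSize_one] using stepSize_antitone hc le_rfl ht

/-- For `c ≤ 1` the ratio of consecutive step sizes is at least `t / (t + 1)`, so the decrease is at
most `stepSize c t / (t + 1)`, and `1 / (t + 1) ≤ stepSize c t`. Hence moving the comparator with
the shrinking set costs only second order. -/
theorem stepSize_sub_succ_le (hc : c ≤ 1) (ht : 1 ≤ t) :
    stepSize c t - stepSize c (t + 1) ≤ stepSize c t ^ 2 := by
  have h0 : (1 : ℝ) ≤ t := by exact_mod_cast ht
  have h1 : stepSize c (t + 1) = stepSize c t * ((t : ℝ) / (t + 1)) ^ c := by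
    rw [stepSize, stepSize, Real.div_rpow (by positivity) (by positivity)]
    push_cast
    field_simp
  have h2 : (t : ℝ) / (t + 1) ≤ ((t : ℝ) / (t + 1)) ^ c :=
    Real.self_le_rpow_of_le_one (by positivity) (by rw [div_le_one (by positivity)]; linarith) hc
  have h3 : 1 / (t + 1 : ℝ) ≤ stepSize c t := by
    refine one_div_le_one_div_of_le (by positivity) ?_
    have := Real.rpow_le_rpow_of_exponent_le h0 hc
    rw [Real.rpow_one] at this
    linarith
  have h4 : 1 - (t : ℝ) / (t + 1) = 1 / (t + 1) := by field_simp; ring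
  have h5 := stepSize_pos (c := c) ht
  rw [h1]
  nlinarith

theorem sum_stepSize_le (hc0 : 0 ≤ c) (hc : c < 1) (T : ℕ) :
    ∑ t ∈ Finset.Icc 1 T, stepSize c t ≤ (T : ℝ) ^ (1 - c) / (1 - c) := by
  have hc' : 0 < 1 - c := by linarith
  induction T with
  | zero => simp [Real.zero_rpow hc'.ne']
  | succ T ih =>
    rw [Finset.sum_Icc_succ_top (by omega)]
    have hT : (0 : ℝ) < T + 1 := by positivity
    -- Bernoulli's inequality for the exponent `1 - c` at `-1 / (T + 1)` bounds the new summand by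
    -- the increment of `T ^ (1 - c) / (1 - c)`.
    have h1 := rpow_one_add_le_one_add_mul_self (s := -1 / (T + 1 : ℝ))
      (by rw [le_div_iff₀ hT]; linarith [(Nat.cast_nonneg T : (0 : ℝ) ≤ T)]) hc'.le
      (by linarith : 1 - c ≤ 1)
    have h2 : 1 + -1 / (T + 1 : ℝ) = T / (T + 1) := by field_simp; ring
    rw [h2, Real.div_rpow (by positivity) hT.le, div_le_iff₀ (by positivity)] at h1
    have h3 : (T + 1 : ℝ) ^ (1 - c) = (T + 1) * stepSize c (T + 1) := by
      rw [stepSize, Real.rpow_sub hT, Real.rpow_one]; push_cast; ring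
    have h4 : (1 + (1 - c) * (-1 / (T + 1 : ℝ))) * (T + 1 : ℝ) ^ (1 - c)
        = (T + 1 : ℝ) ^ (1 - c) - (1 - c) * stepSize c (T + 1) := by
      rw [h3]; field_simp; ring
    rw [h4] at h1
    have h5 : ((T + 1 : ℕ) : ℝ) = T + 1 := by push_cast; rfl
    rw [h5]
    rw [le_div_iff₀ hc'] at ih ⊢
    nlinarith

end StepSize

/-- Summation by parts with weights `1 / a t`. -/
theorem sum_sub_div_le {A a : ℕ → ℝ} {Amax : ℝ} (hA : ∀ t, 1 ≤ t → A t ≤ Amax)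
    (ha : ∀ t, 1 ≤ t → 0 < a t) (hanti : ∀ t, 1 ≤ t → a (t + 1) ≤ a t) {T : ℕ} (hT : 1 ≤ T) :
    ∑ t ∈ Finset.Icc 1 T, (A t - A (t + 1)) / a t ≤ (Amax - A (T + 1)) / a T := by
  induction T, hT using Nat.le_induction with
  | base =>
    simp only [Finset.Icc_self, Finset.sum_singleton]
    have := ha 1 le_rfl
    have := hA 1 le_rfl
    gcongr
  | succ T hT ih =>
    rw [Finset.sum_Icc_succ_top (by omega)]
    have h1 : (Amax - A (T + 1)) / a T ≤ (Amax - A (T + 1)) / a (T + 1) :=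
      div_le_div_of_nonneg_left (sub_nonneg.2 (hA _ (by omega))) (ha _ (by omega)) (hanti T hT)
    have h2 : (Amax - A (T + 1)) / a (T + 1) + (A (T + 1) - A (T + 1 + 1)) / a (T + 1)
        = (Amax - A (T + 1 + 1)) / a (T + 1) := by rw [← add_div]; congr 1; ring
    linarith

/-- The regret bound implied by the one-step inequalities of the potential `A`. -/
theorem exists_regret_bound {n : ℕ} (hn : 1 ≤ n) {c γ₀ : ℝ} (hc : c ∈ Set.Ioo (0 : ℝ) 1)
    (hγ₀ : 0 < γ₀) {Amax C₁ κ : ℝ} (hAmax : 0 ≤ Amax) (hC₁ : 0 ≤ C₁) :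
    ∃ C, ∀ (A Δ M : ℕ → ℝ) (b : ℕ → Fin n → ℝ) (T : ℕ),
      (∀ t, 1 ≤ t → 0 ≤ A t ∧ A t ≤ Amax) →
      (∀ t, 1 ≤ t → t ≤ T → A (t + 1) + 2 * stepSize c t * Δ t + γ₀ / 2 * ∑ i, b t i ^ 2 +
        2 * stepSize c t * M t ≤ A t + C₁ * stepSize c t ^ 2) →
      1 ≤ T → ∑ t ∈ Finset.Icc 1 T, (1 / n * Δ t + κ * ∑ i, b t i) ≤
        C * (T : ℝ) ^ max c (1 - c) - 1 / n * ∑ t ∈ Finset.Icc 1 T, M t := by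
  have hn0 : (0 : ℝ) < n := by exact_mod_cast hn
  set C₂ := 1 / n * (C₁ / 2) + n ^ 2 * κ ^ 2 / γ₀ with hC₂
  refine ⟨1 / n * (Amax / 2) + C₂ / (1 - c), fun A Δ M b T hA hstep hT => ?_⟩
  have hC₂0 : 0 ≤ C₂ := by positivity
  have hT1 : (1 : ℝ) ≤ T := by exact_mod_cast hT
  have key : ∀ t ∈ Finset.Icc 1 T, 1 / n * Δ t + κ * ∑ i, b t i ≤
      1 / n * (1 / 2) * ((A t - A (t + 1)) / stepSize c t) + C₂ * stepSize c t
        - 1 / n * M t := by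
    intro t ht
    obtain ⟨ht, htT⟩ := Finset.mem_Icc.1 ht
    have ha := stepSize_pos (c := c) ht
    set a := stepSize c t
    have h1 : Δ t + γ₀ / (4 * a) * ∑ i, b t i ^ 2 + M t ≤
        1 / 2 * ((A t - A (t + 1)) / a) + C₁ / 2 * a := by
      have := div_le_div_of_nonneg_right (hstep t ht htT) (by positivity : 0 ≤ 2 * a)
      have e1 : (A (t + 1) + 2 * a * Δ t + γ₀ / 2 * ∑ i, b t i ^ 2 + 2 * a * M t) / (2 * a)
          = A (t + 1) / (2 * a) + Δ t + γ₀ / (4 * a) * ∑ i, b t i ^ 2 + M t := by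
        field_simp; ring
      have e2 : (A t + C₁ * a ^ 2) / (2 * a) = A t / (2 * a) + C₁ / 2 * a := by
        field_simp
      have e3 : 1 / 2 * ((A t - A (t + 1)) / a) = A t / (2 * a) - A (t + 1) / (2 * a) := by
        field_simp
      rw [e1, e2] at this
      rw [e3]
      linarith
    have h2 : κ * ∑ i, b t i ≤ 1 / n * (γ₀ / (4 * a) * ∑ i, b t i ^ 2) +
        n ^ 2 * κ ^ 2 / γ₀ * a := by
      -- Completing the square: the linear violation term caused by disagreement is absorbed by the
      -- quadratic one, at a price proportional to the step size. Summation over the agents gives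
      -- the second part of `C₂`.
      have h3 : ∀ i, κ * b t i ≤ 1 / n * (γ₀ / (4 * a)) * b t i ^ 2 + n * κ ^ 2 / γ₀ * a := by
        intro i
        have e : 1 / n * (γ₀ / (4 * a)) * b t i ^ 2 + n * κ ^ 2 / γ₀ * a - κ * b t i
            = γ₀ / (4 * a * n) * (b t i - 2 * n * a * κ / γ₀) ^ 2 := by
          field_simp; ring
        have : 0 ≤ γ₀ / (4 * a * n) * (b t i - 2 * n * a * κ / γ₀) ^ 2 := by positivity
        linarith
      rw [Finset.mul_sum]
      refine (Finset.sum_le_sum fun i _ => h3 i).trans_eq ?_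
      rw [Finset.sum_add_distrib, ← Finset.mul_sum]
      simp only [Finset.sum_const, Finset.card_univ, Fintype.card_fin, nsmul_eq_mul]
      ring
    have h4 := mul_le_mul_of_nonneg_left h1 (by positivity : 0 ≤ 1 / (n : ℝ))
    rw [hC₂]
    linarith
  have h1 := sum_sub_div_le (fun t ht => (hA t ht).2) (fun t ht => stepSize_pos (c := c) ht)
    (fun t ht => stepSize_antitone hc.1.le ht (Nat.le_succ t)) hT
  have h2 : (Amax - A (T + 1)) / stepSize c T ≤ Amax * (T : ℝ) ^ max c (1 - c) := by
    rw [stepSize, div_div_eq_mul_div, div_one]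
    have h3 : (T : ℝ) ^ c ≤ (T : ℝ) ^ max c (1 - c) :=
      Real.rpow_le_rpow_of_exponent_le hT1 (le_max_left _ _)
    have h4 := (hA (T + 1) (by omega)).1
    calc _ ≤ Amax * (T : ℝ) ^ c := by gcongr; linarith
      _ ≤ _ := by gcongr
  have h5 := sum_stepSize_le hc.1.le hc.2 T
  have h6 : (T : ℝ) ^ (1 - c) ≤ (T : ℝ) ^ max c (1 - c) :=
    Real.rpow_le_rpow_of_exponent_le hT1 (le_max_right _ _)
  have h7 : 0 < 1 - c := by linarith [hc.2]
  have h8 : C₂ * ∑ t ∈ Finset.Icc 1 T, stepSize c t ≤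
      C₂ / (1 - c) * (T : ℝ) ^ max c (1 - c) := by
    calc _ ≤ C₂ * ((T : ℝ) ^ max c (1 - c) / (1 - c)) := by
          gcongr
          exact h5.trans (by gcongr)
      _ = _ := by ring
  have h9 := mul_le_mul_of_nonneg_left (h1.trans h2) (by positivity : 0 ≤ 1 / (n : ℝ) * (1 / 2))
  refine (Finset.sum_le_sum key).trans ?_
  rw [Finset.sum_sub_distrib, Finset.sum_add_distrib, ← Finset.mul_sum, ← Finset.mul_sum,
    ← Finset.mul_sum]
  have e : (1 / n * (Amax / 2) + C₂ / (1 - c)) * (T : ℝ) ^ max c (1 - c) =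
    1 / n * (1 / 2) * (Amax * (T : ℝ) ^ max c (1 - c)) +
      C₂ / (1 - c) * (T : ℝ) ^ max c (1 - c) := by ring
  linarith

/-- The violation bound implied by the one-step inequalities of the potential `A`. -/
theorem exists_violation_bound {n : ℕ} {c γ₀ : ℝ} (hc : c ∈ Set.Ioo (0 : ℝ) 1)
    (hγ₀ : 0 < γ₀) {Amax C₁ Δmax : ℝ} (hAmax : 0 ≤ Amax) (hC₁ : 0 ≤ C₁) (hΔmax : 0 ≤ Δmax) :
    ∃ C, ∀ (A Δ M : ℕ → ℝ) (b : ℕ → Fin n → ℝ) (T : ℕ),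
      (∀ t, 1 ≤ t → 0 ≤ A t ∧ A t ≤ Amax) →
      (∀ t, 1 ≤ t → t ≤ T → |Δ t| ≤ Δmax) →
      (∀ t, 1 ≤ t → t ≤ T → A (t + 1) + 2 * stepSize c t * Δ t + γ₀ / 2 * ∑ i, b t i ^ 2 +
        2 * stepSize c t * M t ≤ A t + C₁ * stepSize c t ^ 2) →
      1 ≤ T → ∑ t ∈ Finset.Icc 1 T, ∑ i, b t i ≤
        C * (T : ℝ) ^ (1 - c / 2) -
          2 / γ₀ * (T : ℝ) ^ (c / 2) * ∑ t ∈ Finset.Icc 1 T, stepSize c t * M t := by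
  refine ⟨(Amax + (C₁ + 2 * Δmax) / (1 - c)) / γ₀ + n / 2, fun A Δ M b T hA hΔ hstep hT => ?_⟩
  have hT1 : (1 : ℝ) ≤ T := by exact_mod_cast hT
  have hc' : 0 < 1 - c := by linarith [hc.2]
  have h1 : ∀ t ∈ Finset.Icc 1 T, γ₀ / 2 * ∑ i, b t i ^ 2 ≤
      (A t - A (t + 1)) + (C₁ + 2 * Δmax) * stepSize c t - 2 * (stepSize c t * M t) := by
    intro t ht
    obtain ⟨ht, htT⟩ := Finset.mem_Icc.1 ht
    have ha := stepSize_pos (c := c) ht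
    have ha1 := stepSize_le_one hc.1.le ht
    have h2 := hstep t ht htT
    have h3 : -(2 * stepSize c t * Δ t) ≤ 2 * Δmax * stepSize c t := by
      have := mul_le_mul_of_nonneg_left (neg_le_of_abs_le (hΔ t ht htT)) ha.le
      linarith
    have h4 : C₁ * stepSize c t ^ 2 ≤ C₁ * stepSize c t := by
      gcongr
      nlinarith
    linarith
  have hs := Finset.sum_le_sum h1
  rw [Finset.sum_sub_distrib, Finset.sum_add_distrib, ← Finset.mul_sum, ← Finset.mul_sum,
    ← Finset.mul_sum] at hs
  -- Here the weights are `1`, so the potential contributes only a constant.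
  have htel : ∑ t ∈ Finset.Icc 1 T, (A t - A (t + 1)) ≤ Amax := by
    have := sum_sub_div_le (a := fun _ => 1) (fun t ht => (hA t ht).2) (fun _ _ => one_pos)
      (fun _ _ => le_rfl) hT
    simp only [div_one] at this
    linarith [(hA (T + 1) (by omega)).1]
  have hP : 1 ≤ (T : ℝ) ^ (1 - c) := Real.one_le_rpow hT1 hc'.le
  have h5 : γ₀ / 2 * ∑ t ∈ Finset.Icc 1 T, ∑ i, b t i ^ 2 ≤
      (Amax + (C₁ + 2 * Δmax) / (1 - c)) * (T : ℝ) ^ (1 - c) -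
        2 * ∑ t ∈ Finset.Icc 1 T, stepSize c t * M t := by
    have h6 := mul_le_mul_of_nonneg_left (sum_stepSize_le hc.1.le hc.2 T)
      (by positivity : 0 ≤ C₁ + 2 * Δmax)
    have h7 : (C₁ + 2 * Δmax) * ((T : ℝ) ^ (1 - c) / (1 - c))
      = (C₁ + 2 * Δmax) / (1 - c) * (T : ℝ) ^ (1 - c) := by ring
    have h8 := mul_le_mul_of_nonneg_left hP hAmax
    linarith
  -- The weight balances the two sides of `b ≤ P / 2 * b ^ 2 + P⁻¹ / 2`: both `P * T ^ (1 - c)` and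
  -- `T * P⁻¹` equal `T ^ (1 - c / 2)`.
  set P := (T : ℝ) ^ (c / 2) with hPdef
  have hPpos : 0 < P := by positivity
  have h9 : ∀ t ∈ Finset.Icc 1 T, ∑ i, b t i ≤ P / 2 * ∑ i, b t i ^ 2 + n / 2 * P⁻¹ := by
    intro t _
    have : ∀ i, b t i ≤ P / 2 * b t i ^ 2 + P⁻¹ / 2 := fun i => by
      have e : P / 2 * b t i ^ 2 + P⁻¹ / 2 - b t i = P / 2 * (b t i - P⁻¹) ^ 2 := by
        field_simp; ring
      have : 0 ≤ P / 2 * (b t i - P⁻¹) ^ 2 := by positivity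
      linarith
    refine (Finset.sum_le_sum fun i _ => this i).trans_eq ?_
    rw [Finset.sum_add_distrib, ← Finset.mul_sum]
    simp only [Finset.sum_const, Finset.card_univ, Fintype.card_fin, nsmul_eq_mul]
    ring
  have hs2 := Finset.sum_le_sum h9
  rw [Finset.sum_add_distrib, ← Finset.mul_sum] at hs2
  simp only [Finset.sum_const, Nat.card_Icc, Nat.add_sub_cancel, nsmul_eq_mul] at hs2
  have hT0 : (0 : ℝ) < T := by linarith
  have e1 : (T : ℝ) * P⁻¹ = (T : ℝ) ^ (1 - c / 2) := by
    rw [Real.rpow_sub hT0, Real.rpow_one]; rfl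
  have e2 : P * (T : ℝ) ^ (1 - c) = (T : ℝ) ^ (1 - c / 2) := by
    rw [hPdef, ← Real.rpow_add hT0]; congr 1; ring
  have h10 := mul_le_mul_of_nonneg_left h5 (by positivity : 0 ≤ P / γ₀)
  have e3 : P / γ₀ * (γ₀ / 2 * ∑ t ∈ Finset.Icc 1 T, ∑ i, b t i ^ 2)
      = P / 2 * ∑ t ∈ Finset.Icc 1 T, ∑ i, b t i ^ 2 := by field_simp
  rw [e3] at h10
  refine hs2.trans ((add_le_add_left h10 _).trans_eq ?_)
  rw [← e1] at e2 ⊢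
  have e4 : ∀ y z : ℝ, P / γ₀ * (y * (T : ℝ) ^ (1 - c) - 2 * z)
      = y / γ₀ * (P * (T : ℝ) ^ (1 - c)) - 2 / γ₀ * P * z := fun y z => by ring
  rw [e4, e2]
  ring

end DistBandit

/-! ### The one-step inequality and the disagreement of a run. -/

namespace DistBandit

open scoped Matrix

/-- How much the estimated decrease `⟪gradEst, x - y⟫` exceeds its guaranteed mean. -/
noncomputable def gradEstGap {p : ℕ} (f : EuclideanSpace ℝ (Fin p) → ℝ) (K δ : ℝ)
    (x u y : EuclideanSpace ℝ (Fin p)) : ℝ :=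
  inner ℝ (gradEst f δ x u) (x - y) - (f x - f y - 2 * K * δ)

/-- The difference of the two function values is at most `K * δ`, which cancels the division by `δ`;
a small exploration radius therefore does not enlarge the step. -/
theorem norm_gradEst_le {p : ℕ} {X : Set (EuclideanSpace ℝ (Fin p))}
    {f : EuclideanSpace ℝ (Fin p) → ℝ} {K δ : ℝ} (hδ : 0 < δ)
    (hK : ∀ x ∈ X, ∀ y ∈ X, |f x - f y| ≤ K * ‖x - y‖) {x u : EuclideanSpace ℝ (Fin p)}
    (hu : ‖u‖ = 1) (hx : Metric.closedBall x δ ⊆ X) : ‖gradEst f δ x u‖ ≤ p * K := by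
  have h1 : x + δ • u ∈ X := hx (by
    rw [Metric.mem_closedBall, dist_eq_norm, add_sub_cancel_left, norm_smul, hu,
      Real.norm_of_nonneg hδ.le, mul_one])
  have h2 := hK _ h1 _ (hx (Metric.mem_closedBall_self hδ.le))
  rw [add_sub_cancel_left, norm_smul, hu, Real.norm_of_nonneg hδ.le, mul_one] at h2
  rw [gradEst, norm_smul, hu, mul_one, Real.norm_eq_abs, abs_mul, abs_of_nonneg (by positivity)]
  calc (p : ℝ) / δ * |f (x + δ • u) - f x| ≤ p / δ * (K * δ) := by gcongr
    _ = p * K := by field_simp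

/-- The losses and constraints satisfy the convexity and Lipschitz bounds the analysis needs. -/
structure LipschitzProblem {n p : ℕ} {m : Fin n → ℕ} (X : Set (EuclideanSpace ℝ (Fin p)))
    (f : Fin n → ℕ → EuclideanSpace ℝ (Fin p) → ℝ)
    (g : (i : Fin n) → ℕ → EuclideanSpace ℝ (Fin p) → EuclideanSpace ℝ (Fin (m i)))
    (r R F G₁ L : ℝ) : Prop where
  set : SetAssumption X r R
  r_pos : 0 < r
  loss_nonneg : 0 ≤ G₁
  constraint_nonneg : 0 ≤ L
  loss_bounded : ∀ i t, 1 ≤ t → ∀ x ∈ X, |f i t x| ≤ F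
  loss_convex : ∀ i t, 1 ≤ t → ConvexOn ℝ X (f i t)
  loss_lipschitz : ∀ i t, 1 ≤ t → ∀ x ∈ X, ∀ y ∈ X, |f i t x - f i t y| ≤ G₁ * ‖x - y‖
  constraint_convex : ∀ i t, 1 ≤ t → ∀ k, ConvexOn ℝ X (fun x => g i t x k)
  constraint_lipschitz : ∀ i t, 1 ≤ t → ∀ x ∈ X, ∀ y ∈ X,
    ‖g i t x - g i t y‖ ≤ L * ‖x - y‖

/-- The Lagrangian-type function whose subgradient agent `i` estimates at time `t`. -/
noncomputable def lagrangian {n p : ℕ} {m : Fin n → ℕ}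
    (f : Fin n → ℕ → EuclideanSpace ℝ (Fin p) → ℝ)
    (g : (i : Fin n) → ℕ → EuclideanSpace ℝ (Fin p) → EuclideanSpace ℝ (Fin (m i)))
    (γ₀ c : ℝ) (i : Fin n) (t : ℕ) (a : EuclideanSpace ℝ (Fin p)) :
    EuclideanSpace ℝ (Fin p) → ℝ :=
  penalized (f i t) (g i t) ((γ₀ / stepSize c t) • clip (g i t a))

/-- The Lipschitz constant of `lagrangian`. -/
noncomputable def lagrangianConst {n p : ℕ} {m : Fin n → ℕ}
    (g : (i : Fin n) → ℕ → EuclideanSpace ℝ (Fin p) → EuclideanSpace ℝ (Fin (m i)))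
    (γ₀ c G₁ L : ℝ) (i : Fin n) (t : ℕ) (a : EuclideanSpace ℝ (Fin p)) : ℝ :=
  G₁ + L * ‖(γ₀ / stepSize c t) • clip (g i t a)‖

/-- The primal part of a run, in terms of the estimator of `lagrangian`. -/
structure PrimalRun {n p : ℕ} {m : Fin n → ℕ} (X : Set (EuclideanSpace ℝ (Fin p)))
    (f : Fin n → ℕ → EuclideanSpace ℝ (Fin p) → ℝ)
    (g : (i : Fin n) → ℕ → EuclideanSpace ℝ (Fin p) → EuclideanSpace ℝ (Fin (m i)))
    (W : ℕ → Matrix (Fin n) (Fin n) ℝ) (r γ₀ c : ℝ)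
    (u z x : Fin n → ℕ → EuclideanSpace ℝ (Fin p)) : Prop where
  init : ∀ i, z i 1 ∈ shrink X (stepSize c 1)
  consensus : ∀ i t, 1 ≤ t → x i t = ∑ j, W t i j • z j t
  primal : ∀ i t, 1 ≤ t → IsProjection (shrink X (stepSize c (t + 1)))
    (x i t - stepSize c t •
      gradEst (lagrangian f g γ₀ c i t (x i t)) (r * stepSize c t) (x i t) (u i t)) (z i (t + 1))

theorem IsRun.primalRun {n p : ℕ} {m : Fin n → ℕ} {X : Set (EuclideanSpace ℝ (Fin p))}
    {f : Fin n → ℕ → EuclideanSpace ℝ (Fin p) → ℝ}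
    {g : (i : Fin n) → ℕ → EuclideanSpace ℝ (Fin p) → EuclideanSpace ℝ (Fin (m i))}
    {W : ℕ → Matrix (Fin n) (Fin n) ℝ} {α γ ξ δ : ℕ → ℝ} {r γ₀ c : ℝ}
    {u z x : Fin n → ℕ → EuclideanSpace ℝ (Fin p)}
    {q : (i : Fin n) → ℕ → EuclideanSpace ℝ (Fin (m i))}
    {ω : Fin n → ℕ → EuclideanSpace ℝ (Fin p)}
    (h : IsRun X f g W α γ ξ δ u z x q ω)
    (hα : ∀ t : ℕ, 1 ≤ t → α t = stepSize c t)
    (hγ : ∀ t : ℕ, 1 ≤ t → γ t = γ₀ / α t)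
    (hξ : ∀ t : ℕ, 1 ≤ t → ξ t = α t)
    (hδ : ∀ t : ℕ, 1 ≤ t → δ t = r * α t) : PrimalRun X f g W r γ₀ c u z x where
  init i := by
    have := h.init i
    rwa [hξ 1 le_rfl, hα 1 le_rfl] at this
  consensus := h.consensus
  primal i t ht := by
    have := h.primal i t ht
    rwa [h.direction i t ht, gradEst_add_vecGradEst, h.dual i t ht, hγ t ht, hδ t ht,
      hξ (t + 1) (by omega), hα t ht, hα (t + 1) (by omega)] at this

section Run

variable {n p : ℕ} {m : Fin n → ℕ} {X : Set (EuclideanSpace ℝ (Fin p))}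
  {f : Fin n → ℕ → EuclideanSpace ℝ (Fin p) → ℝ}
  {g : (i : Fin n) → ℕ → EuclideanSpace ℝ (Fin p) → EuclideanSpace ℝ (Fin (m i))}
  {W : ℕ → Matrix (Fin n) (Fin n) ℝ} {G : ℕ → Digraph (Fin n)} {w : ℝ} {B : ℕ}
  {r R F G₁ L γ₀ c : ℝ} {u z x : Fin n → ℕ → EuclideanSpace ℝ (Fin p)}

theorem LipschitzProblem.abs_lagrangian_sub_le (h : LipschitzProblem X f g r R F G₁ L)
    (i : Fin n) {t : ℕ} (ht : 1 ≤ t) (a : EuclideanSpace ℝ (Fin p)) :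
    ∀ x ∈ X, ∀ y ∈ X, |lagrangian f g γ₀ c i t a x - lagrangian f g γ₀ c i t a y| ≤
      lagrangianConst g γ₀ c G₁ L i t a * ‖x - y‖ := fun _ hx _ hy =>
  abs_penalized_sub_le (h.loss_lipschitz i t ht) (h.constraint_lipschitz i t ht) hx hy

theorem LipschitzProblem.convexOn_lagrangian (h : LipschitzProblem X f g r R F G₁ L)
    (hγ₀ : 0 ≤ γ₀) (i : Fin n) {t : ℕ} (ht : 1 ≤ t) (a : EuclideanSpace ℝ (Fin p)) :
    ConvexOn ℝ X (lagrangian f g γ₀ c i t a) :=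
  convexOn_penalized (h.loss_convex i t ht) (h.constraint_convex i t ht) fun k =>
    mul_nonneg (div_nonneg hγ₀ (stepSize_pos ht).le) (clip_nonneg _ k)

theorem LipschitzProblem.lagrangianConst_nonneg (h : LipschitzProblem X f g r R F G₁ L)
    (i : Fin n) (t : ℕ) (a : EuclideanSpace ℝ (Fin p)) :
    0 ≤ lagrangianConst g γ₀ c G₁ L i t a :=
  add_nonneg h.loss_nonneg (mul_nonneg h.constraint_nonneg (norm_nonneg _))

/-- The displacement caused by one step along the estimator. -/
theorem LipschitzProblem.step_mul_norm_gradEst_le (h : LipschitzProblem X f g r R F G₁ L)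
    (hc : 0 ≤ c) (hγ₀ : 0 ≤ γ₀) (i : Fin n) {t : ℕ} (ht : 1 ≤ t)
    {x u : EuclideanSpace ℝ (Fin p)} (hu : ‖u‖ = 1) (hx : x ∈ shrink X (stepSize c t)) :
    stepSize c t * ‖gradEst (lagrangian f g γ₀ c i t x) (r * stepSize c t) x u‖ ≤
      p * (stepSize c t * G₁ + L * γ₀ * ‖clip (g i t x)‖) := by
  have ha := stepSize_pos (c := c) ht
  have h1 := norm_gradEst_le (mul_pos h.r_pos ha) (h.abs_lagrangian_sub_le (γ₀ := γ₀) (c := c)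
    i ht x) hu (h.set.closedBall_subset ha (stepSize_le_one hc ht) hx)
  refine (mul_le_mul_of_nonneg_left h1 ha.le).trans_eq ?_
  rw [lagrangianConst, norm_smul, Real.norm_of_nonneg (by positivity)]
  field_simp

/-- The square of the projected step is expanded around the comparator `(1 - stepSize c t) • y`.
Writing `b` for the violation norm, the Lagrangian yields a gain `2 γ₀ b ^ 2`; the squared step uses
up `γ₀ b ^ 2` by the bound on `γ₀`, and the terms linear in `b` use up `γ₀ / 2 * b ^ 2`. The rest is
of order `stepSize c t ^ 2`. -/
theorem LipschitzProblem.sq_norm_step_le (h : LipschitzProblem X f g r R F G₁ L)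
    (hc : 0 ≤ c) (hγ₀ : 0 < γ₀) (hL : 2 * (p : ℝ) ^ 2 * L ^ 2 * γ₀ ≤ 1)
    (i : Fin n) {t : ℕ} (ht : 1 ≤ t)
    {x u z y : EuclideanSpace ℝ (Fin p)} (hu : ‖u‖ = 1) (hx : x ∈ shrink X (stepSize c t))
    (hy : y ∈ X) (hgy : ∀ k, g i t y k ≤ 0)
    (hz : IsProjection (shrink X (stepSize c (t + 1))) (x - stepSize c t •
      gradEst (lagrangian f g γ₀ c i t x) (r * stepSize c t) x u) z) :
    ‖z - (1 - stepSize c t) • y‖ ^ 2 +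
      2 * stepSize c t * (f i t x - f i t ((1 - stepSize c t) • y)) +
      γ₀ / 2 * ‖clip (g i t x)‖ ^ 2 +
      2 * stepSize c t * gradEstGap (lagrangian f g γ₀ c i t x)
        (lagrangianConst g γ₀ c G₁ L i t x) (r * stepSize c t) x u ((1 - stepSize c t) • y) ≤
    ‖x - (1 - stepSize c t) • y‖ ^ 2 +
      (γ₀ * (2 * L * R + 4 * r * L) ^ 2 / 2 + 4 * r * G₁ + 2 * p ^ 2 * G₁ ^ 2) *
        stepSize c t ^ 2 := by
  have ha := stepSize_pos (c := c) ht
  have ha1 := stepSize_le_one hc ht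
  have hstep := h.step_mul_norm_gradEst_le hc hγ₀.le i ht hu hx
  have hys : (1 - stepSize c t) • y ∈ shrink X (stepSize c t) := ⟨y, hy, rfl⟩
  -- The projection is onto the set of time `t + 1`, which is larger, so the comparator of time `t`
  -- is fixed by it.
  have hys' : (1 - stepSize c t) • y ∈ shrink X (stepSize c (t + 1)) :=
    h.set.shrink_mono h.r_pos.le (stepSize_antitone hc ht (Nat.le_succ t)) ha1 hys
  have hyX := h.set.shrink_subset h.r_pos ha ha1 hys
  have hxX := h.set.shrink_subset h.r_pos ha ha1 hx
  have hdist : ‖(1 - stepSize c t) • y - y‖ ≤ stepSize c t * R := by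
    rw [show (1 - stepSize c t) • y - y = -(stepSize c t • y) by module, norm_neg, norm_smul,
      Real.norm_of_nonneg ha.le]
    exact mul_le_mul_of_nonneg_left (h.set.norm_le hy) ha.le
  -- The pairing of `[g]_+` with `g` is `‖[g]_+‖ ^ 2` at `x` and nonpositive at the feasible `y`;
  -- shrinking `y` costs at most `L * (stepSize c t * R)` in `g`.
  have hlag : lagrangian f g γ₀ c i t x x - lagrangian f g γ₀ c i t x ((1 - stepSize c t) • y) ≥
      f i t x - f i t ((1 - stepSize c t) • y) +
      γ₀ / stepSize c t * (‖clip (g i t x)‖ ^ 2 - ‖clip (g i t x)‖ * (L * (stepSize c t * R))) := by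
    have h1 := inner_clip_nonpos (g i t x) (g i t y) hgy
    have h2 := real_inner_le_norm (clip (g i t x)) (g i t ((1 - stepSize c t) • y) - g i t y)
    have h3 : ‖g i t ((1 - stepSize c t) • y) - g i t y‖ ≤ L * (stepSize c t * R) :=
      (h.constraint_lipschitz i t ht _ hyX _ hy).trans
        (mul_le_mul_of_nonneg_left hdist h.constraint_nonneg)
    have h4 := mul_le_mul_of_nonneg_left h3 (norm_nonneg (clip (g i t x)))
    rw [inner_sub_right] at h2
    have h5 : inner ℝ (clip (g i t x)) (g i t ((1 - stepSize c t) • y)) ≤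
        ‖clip (g i t x)‖ * (L * (stepSize c t * R)) := by linarith
    have h6 : 0 ≤ γ₀ / stepSize c t := by positivity
    simp only [lagrangian, penalized, real_inner_smul_left, inner_clip_self]
    have := mul_le_mul_of_nonneg_left h5 h6
    linarith
  have hproj := hz.norm_sub_le (h.set.convex_shrink _) (isProjection_self hys')
  have hK : lagrangianConst g γ₀ c G₁ L i t x =
      G₁ + L * (γ₀ / stepSize c t * ‖clip (g i t x)‖) := by
    rw [lagrangianConst, norm_smul, Real.norm_of_nonneg (by positivity)]
  have hgap : inner ℝ (gradEst (lagrangian f g γ₀ c i t x) (r * stepSize c t) x u)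
      (x - (1 - stepSize c t) • y) = gradEstGap (lagrangian f g γ₀ c i t x)
        (lagrangianConst g γ₀ c G₁ L i t x) (r * stepSize c t) x u ((1 - stepSize c t) • y) +
      (lagrangian f g γ₀ c i t x x - lagrangian f g γ₀ c i t x ((1 - stepSize c t) • y) -
        2 * lagrangianConst g γ₀ c G₁ L i t x * (r * stepSize c t)) := by
    rw [gradEstGap]; ring
  rw [hK] at hgap ⊢
  set M := gradEstGap (lagrangian f g γ₀ c i t x)
    (G₁ + L * (γ₀ / stepSize c t * ‖clip (g i t x)‖)) (r * stepSize c t) x u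
    ((1 - stepSize c t) • y)
  set v := gradEst (lagrangian f g γ₀ c i t x) (r * stepSize c t) x u
  set y' := (1 - stepSize c t) • y
  set a := stepSize c t
  set b := ‖clip (g i t x)‖
  have hsq : ‖z - y'‖ ^ 2 ≤ ‖x - y'‖ ^ 2 - 2 * a * inner ℝ v (x - y') + (a * ‖v‖) ^ 2 := by
    have e : x - a • v - y' = (x - y') - a • v := by abel
    have e' : ‖x - y' - a • v‖ ^ 2 =
        ‖x - y'‖ ^ 2 - 2 * (a * inner ℝ v (x - y')) + (a * ‖v‖) ^ 2 := by
      rw [norm_sub_sq_real, real_inner_smul_right, norm_smul, Real.norm_of_nonneg ha.le,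
        real_inner_comm]
    have := pow_le_pow_left₀ (norm_nonneg _) hproj 2
    rw [e, e'] at this
    linarith
  have hv2 : (a * ‖v‖) ^ 2 ≤ 2 * p ^ 2 * G₁ ^ 2 * a ^ 2 + γ₀ * b ^ 2 := by
    have h1 := pow_le_pow_left₀ (by positivity) hstep 2
    have h2 : (p * (a * G₁ + L * γ₀ * b)) ^ 2 ≤
        2 * p ^ 2 * G₁ ^ 2 * a ^ 2 + 2 * (p : ℝ) ^ 2 * L ^ 2 * γ₀ * (γ₀ * b ^ 2) := by
      have : 0 ≤ ((p : ℝ) * (a * G₁ - L * γ₀ * b)) ^ 2 := sq_nonneg _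
      nlinarith
    have h3 : 2 * (p : ℝ) ^ 2 * L ^ 2 * γ₀ * (γ₀ * b ^ 2) ≤ 1 * (γ₀ * b ^ 2) :=
      mul_le_mul_of_nonneg_right hL (by positivity)
    linarith
  have hlag2 := mul_le_mul_of_nonneg_left hlag (by positivity : 0 ≤ 2 * a)
  have e1 : 2 * a * (f i t x - f i t y' + γ₀ / a * (b ^ 2 - b * (L * (a * R)))) =
      2 * a * (f i t x - f i t y') + 2 * γ₀ * b ^ 2 - γ₀ * a * b * (2 * L * R) := by
    field_simp; ring
  have e2 : 2 * a * (2 * (G₁ + L * (γ₀ / a * b)) * (r * a)) =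
      4 * r * G₁ * a ^ 2 + γ₀ * a * b * (4 * r * L) := by
    field_simp; ring
  have e3 : γ₀ * a * b * (2 * L * R + 4 * r * L) ≤
      γ₀ * (2 * L * R + 4 * r * L) ^ 2 / 2 * a ^ 2 + γ₀ / 2 * b ^ 2 := by
    have : 0 ≤ γ₀ / 2 * ((2 * L * R + 4 * r * L) * a - b) ^ 2 := by positivity
    nlinarith
  rw [hgap] at hsq
  linarith

theorem PrimalRun.z_mem (hrun : PrimalRun X f g W r γ₀ c u z x) (i : Fin n) {t : ℕ}
    (ht : 1 ≤ t) : z i t ∈ shrink X (stepSize c t) := by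
  obtain ⟨s, rfl⟩ := Nat.exists_eq_add_of_le' ht
  rcases Nat.eq_zero_or_pos s with rfl | hs
  · exact hrun.init i
  · exact (hrun.primal i s hs).1

theorem PrimalRun.x_mem (hrun : PrimalRun X f g W r γ₀ c u z x)
    (hX : SetAssumption X r R) (hW : NetworkAssumption G W w B) (hw : 0 ≤ w) (i : Fin n) {t : ℕ}
    (ht : 1 ≤ t) : x i t ∈ shrink X (stepSize c t) := by
  rw [hrun.consensus i t ht]
  exact (hX.convex_shrink _).sum_mem (fun j _ => hW.nonneg hw ht i j) (hW.row_sum t ht i)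
    fun j _ => hrun.z_mem j ht

/-- Jensen's inequality uses the row sums, the exchange of summations the column sums. -/
theorem PrimalRun.sum_sq_norm_x_le (hrun : PrimalRun X f g W r γ₀ c u z x)
    (hW : NetworkAssumption G W w B) (hw : 0 ≤ w) {t : ℕ}
    (ht : 1 ≤ t) (y : EuclideanSpace ℝ (Fin p)) :
    ∑ i, ‖x i t - y‖ ^ 2 ≤ ∑ i, ‖z i t - y‖ ^ 2 := by
  have h1 : ∀ i, ‖x i t - y‖ ^ 2 ≤ ∑ j, W t i j * ‖z j t - y‖ ^ 2 := fun i => by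
    have e : x i t - y = ∑ j, W t i j • (z j t - y) := by
      simp only [smul_sub, Finset.sum_sub_distrib, ← Finset.sum_smul, hW.row_sum t ht i, one_smul,
        hrun.consensus i t ht]
    rw [e]
    have hconv : ConvexOn ℝ Set.univ fun v : EuclideanSpace ℝ (Fin p) => ‖v‖ ^ 2 :=
      convexOn_univ_norm.pow (fun _ _ => norm_nonneg _) 2
    simpa using hconv.map_sum_le (t := Finset.univ) (w := W t i) (p := fun j => z j t - y)
      (fun j _ => hW.nonneg hw ht i j) (hW.row_sum t ht i) (fun _ _ => Set.mem_univ _)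
  refine (Finset.sum_le_sum fun i _ => h1 i).trans_eq ?_
  rw [Finset.sum_comm]
  refine Finset.sum_congr rfl fun j _ => ?_
  rw [← Finset.sum_mul, hW.col_sum t ht j, one_mul]

/-- One step of the potential `∑ i, ‖z i t - (1 - t ^ (-c)) y‖ ^ 2`. -/
theorem PrimalRun.potential_succ_le (hrun : PrimalRun X f g W r γ₀ c u z x)
    (h : LipschitzProblem X f g r R F G₁ L) (hW : NetworkAssumption G W w B) (hw : 0 ≤ w)
    (hc0 : 0 ≤ c) (hc1 : c ≤ 1) (hγ₀ : 0 < γ₀) (hL : 2 * (p : ℝ) ^ 2 * L ^ 2 * γ₀ ≤ 1)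
    (hu : ∀ i t, 1 ≤ t → ‖u i t‖ = 1) {t : ℕ} (ht : 1 ≤ t)
    {y : EuclideanSpace ℝ (Fin p)} (hy : y ∈ X) (hgy : ∀ i k, g i t y k ≤ 0) :
    ∑ i, ‖z i (t + 1) - (1 - stepSize c (t + 1)) • y‖ ^ 2 +
      2 * stepSize c t * ∑ i, (f i t (x i t) - f i t ((1 - stepSize c t) • y)) +
      γ₀ / 2 * ∑ i, ‖clip (g i t (x i t))‖ ^ 2 +
      2 * stepSize c t * ∑ i, gradEstGap (lagrangian f g γ₀ c i t (x i t))
        (lagrangianConst g γ₀ c G₁ L i t (x i t)) (r * stepSize c t) (x i t) (u i t)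
        ((1 - stepSize c t) • y) ≤
    ∑ i, ‖z i t - (1 - stepSize c t) • y‖ ^ 2 +
      n * (γ₀ * (2 * L * R + 4 * r * L) ^ 2 / 2 + 4 * r * G₁ + 2 * p ^ 2 * G₁ ^ 2 + 4 * R ^ 2) *
        stepSize c t ^ 2 := by
  have ha := stepSize_pos (c := c) ht
  have hX := h.set
  have hR : ∀ {s : ℕ}, 1 ≤ s → ∀ {v}, v ∈ shrink X (stepSize c s) → ‖v‖ ≤ R :=
    fun hs _ hv => hX.norm_le (hX.shrink_subset h.r_pos (stepSize_pos hs)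
      (stepSize_le_one hc0 hs) hv)
  -- Changing the shrinkage of the comparator moves it by at most `stepSize c t ^ 2 * R`; factoring
  -- the difference of squares gives a further factor of at most `4 * R`.
  have hmove : ∀ i, ‖z i (t + 1) - (1 - stepSize c (t + 1)) • y‖ ^ 2 ≤
      ‖z i (t + 1) - (1 - stepSize c t) • y‖ ^ 2 + 4 * R ^ 2 * stepSize c t ^ 2 := fun i => by
    have n1 := hR (by omega) (hrun.z_mem i (t := t + 1) (by omega))
    have n2 : ‖(1 - stepSize c (t + 1)) • y‖ ≤ R := hR (s := t + 1) (by omega) ⟨y, hy, rfl⟩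
    have n3 : ‖(1 - stepSize c t) • y‖ ≤ R := hR ht ⟨y, hy, rfl⟩
    have hR0 : 0 ≤ R := (norm_nonneg _).trans n3
    have d1 : ‖(1 - stepSize c t) • y - (1 - stepSize c (t + 1)) • y‖ ≤ stepSize c t ^ 2 * R := by
      rw [← sub_smul, norm_smul, show 1 - stepSize c t - (1 - stepSize c (t + 1)) =
        -(stepSize c t - stepSize c (t + 1)) by ring, norm_neg, Real.norm_of_nonneg
        (sub_nonneg.2 (stepSize_antitone hc0 ht (Nat.le_succ t)))]
      exact mul_le_mul (stepSize_sub_succ_le hc1 ht) (hX.norm_le hy) (norm_nonneg _) (sq_nonneg _)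
    have d2 := norm_sub_le_norm_sub_add_norm_sub (z i (t + 1)) ((1 - stepSize c t) • y)
      ((1 - stepSize c (t + 1)) • y)
    have d3 := norm_sub_le (z i (t + 1)) ((1 - stepSize c t) • y)
    have d4 := norm_sub_le (z i (t + 1)) ((1 - stepSize c (t + 1)) • y)
    have d5 := norm_nonneg (z i (t + 1) - (1 - stepSize c t) • y)
    have d6 := norm_nonneg (z i (t + 1) - (1 - stepSize c (t + 1)) • y)
    set P := ‖z i (t + 1) - (1 - stepSize c (t + 1)) • y‖
    set Q := ‖z i (t + 1) - (1 - stepSize c t) • y‖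
    have d7 : P - Q ≤ stepSize c t ^ 2 * R := by linarith
    have d8 : P + Q ≤ 4 * R := by linarith
    have d9 : 0 ≤ stepSize c t ^ 2 * R := by positivity
    calc P ^ 2 = Q ^ 2 + (P - Q) * (P + Q) := by ring
      _ ≤ Q ^ 2 + (stepSize c t ^ 2 * R) * (P + Q) := by gcongr
      _ ≤ Q ^ 2 + (stepSize c t ^ 2 * R) * (4 * R) := by gcongr
      _ = _ := by ring
  have hi : ∀ i, ‖z i (t + 1) - (1 - stepSize c (t + 1)) • y‖ ^ 2 +
      2 * stepSize c t * (f i t (x i t) - f i t ((1 - stepSize c t) • y)) +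
      γ₀ / 2 * ‖clip (g i t (x i t))‖ ^ 2 +
      2 * stepSize c t * gradEstGap (lagrangian f g γ₀ c i t (x i t))
        (lagrangianConst g γ₀ c G₁ L i t (x i t)) (r * stepSize c t) (x i t) (u i t)
        ((1 - stepSize c t) • y) ≤ ‖x i t - (1 - stepSize c t) • y‖ ^ 2 +
      (γ₀ * (2 * L * R + 4 * r * L) ^ 2 / 2 + 4 * r * G₁ + 2 * p ^ 2 * G₁ ^ 2 + 4 * R ^ 2) *
        stepSize c t ^ 2 := fun i => by
    have := h.sq_norm_step_le hc0 hγ₀ hL i ht (hu i t ht) (hrun.x_mem hX hW hw i ht) hy (hgy i)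
      (hrun.primal i t ht)
    linarith [hmove i]
  have hs := Finset.sum_le_sum fun i (_ : i ∈ Finset.univ) => hi i
  simp only [Finset.sum_add_distrib, ← Finset.mul_sum, Finset.sum_const, Finset.card_univ,
    Fintype.card_fin, nsmul_eq_mul] at hs
  have := hrun.sum_sq_norm_x_le hW hw ht ((1 - stepSize c t) • y)
  linarith

/-- The decision `x i t` already lies in the next shrunken set, so projecting back cannot lengthen
the displacement. -/
theorem PrimalRun.norm_z_succ_sub_x_le (hrun : PrimalRun X f g W r γ₀ c u z x)
    (h : LipschitzProblem X f g r R F G₁ L) (hW : NetworkAssumption G W w B) (hw : 0 ≤ w)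
    (hc : 0 ≤ c) (hγ₀ : 0 ≤ γ₀) (hu : ∀ i t, 1 ≤ t → ‖u i t‖ = 1) (i : Fin n) {t : ℕ}
    (ht : 1 ≤ t) :
    ‖z i (t + 1) - x i t‖ ≤ p * (stepSize c t * G₁ + L * γ₀ * ‖clip (g i t (x i t))‖) := by
  have hx := hrun.x_mem h.set hW hw i ht
  have ha := stepSize_pos (c := c) ht
  have hx' := h.set.shrink_mono h.r_pos.le (stepSize_antitone hc ht (Nat.le_succ t))
    (stepSize_le_one hc ht) hx
  have h1 := (hrun.primal i t ht).norm_sub_le (h.set.convex_shrink _) (isProjection_self hx')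
  refine h1.trans (le_trans (le_of_eq ?_)
    (h.step_mul_norm_gradEst_le hc hγ₀ i ht (hu i t ht) hx))
  rw [sub_sub_cancel_left, norm_neg, norm_smul, Real.norm_of_nonneg ha.le]

theorem sum_Icc_one_eq_sum_range (a : ℕ → ℝ) (T : ℕ) :
    ∑ t ∈ Finset.Icc 1 T, a t = ∑ t ∈ Finset.range T, a (t + 1) := by
  rw [Finset.range_eq_Ico, Finset.sum_Ico_add', zero_add, Finset.Ico_add_one_right_eq_Icc]

/-- The run is perturbed averaging with perturbations `z i (t + 1) - x i t`. These are bounded by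
step sizes and local violations, and the contraction over `n * B` steps sums them. -/
theorem PrimalRun.sum_disagreement_le (hrun : PrimalRun X f g W r γ₀ c u z x)
    (h : LipschitzProblem X f g r R F G₁ L) (hW : NetworkAssumption G W w B) (hw0 : 0 < w)
    (hw1 : w ≤ 1) (hc : 0 ≤ c) (hγ₀ : 0 ≤ γ₀) (hu : ∀ i t, 1 ≤ t → ‖u i t‖ = 1) (T : ℕ) :
    ∑ t ∈ Finset.Icc 1 T, disagreement (fun i => x i t) ≤
      ((n * B : ℕ) * (2 * R) + 2 * (n * B : ℕ) * (n * p * G₁ * ∑ t ∈ Finset.Icc 1 T, stepSize c t +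
        p * L * γ₀ * ∑ t ∈ Finset.Icc 1 T, ∑ i, ‖clip (g i t (x i t))‖)) / w ^ (n * B) := by
  have hR : 0 ≤ R := by simpa using h.set.norm_le (h.set.zero_mem h.r_pos.le)
  have hbound : ∀ t, 1 ≤ t → disagreement (fun i => x i t) ≤ 2 * R := fun t ht => by
    refine disagreement_le (by positivity) fun i j => ?_
    have hm : ∀ i, ‖x i t‖ ≤ R := fun i => h.set.norm_le (h.set.shrink_subset h.r_pos
      (stepSize_pos ht) (stepSize_le_one hc ht) (hrun.x_mem h.set hW hw0.le i ht))
    linarith [norm_sub_le (x i t) (x j t), hm i, hm j]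
  have key := mul_sum_le_of_contraction (D := fun t => disagreement fun i => x i (t + 1))
    (E := fun t => ∑ i, ‖z i (t + 1 + 1) - x i (t + 1)‖) (β := w ^ (n * B)) (Dmax := 2 * R)
    (N := n * B) (pow_le_one₀ hw0.le hw1) (fun t => disagreement_nonneg _)
    (fun t => hbound _ (by omega)) (fun t => Finset.sum_nonneg fun _ _ => norm_nonneg _)
    (fun t => by
      have := disagreement_add_le (x := fun t i => x i t)
        (e := fun t i => z i (t + 1) - x i t) (t := t + 1) hW hw0.le fun k i => by
          rw [hrun.consensus i _ (by omega)]
          simp only [add_sub_cancel]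
      simpa only [add_right_comm] using this) T
  rw [← sum_Icc_one_eq_sum_range fun t => disagreement fun i => x i t,
    ← sum_Icc_one_eq_sum_range fun t => ∑ i, ‖z i (t + 1) - x i t‖] at key
  rw [le_div_iff₀ (by positivity), mul_comm]
  refine key.trans (add_le_add_right (mul_le_mul_of_nonneg_left ?_ (by positivity)) _)
  rw [Finset.mul_sum, Finset.mul_sum, ← Finset.sum_add_distrib]
  refine Finset.sum_le_sum fun t ht => ?_
  have ht := (Finset.mem_Icc.1 ht).1
  refine (Finset.sum_le_sum fun i _ =>
    hrun.norm_z_succ_sub_x_le h hW hw0.le hc hγ₀ hu i ht).trans_eq ?_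
  simp only [← Finset.mul_sum, Finset.sum_add_distrib, Finset.sum_const, Finset.card_univ, Fintype.card_fin, nsmul_eq_mul]
  ring

end Run

end DistBandit

/-! ### Regret and violation along one realization. -/

namespace DistBandit

/-- The gap of the estimator of `lagrangian` for agent `i` at time `t`, with comparator `y`. -/
noncomputable def lagrangianGap {n p : ℕ} {m : Fin n → ℕ}
    (f : Fin n → ℕ → EuclideanSpace ℝ (Fin p) → ℝ)
    (g : (i : Fin n) → ℕ → EuclideanSpace ℝ (Fin p) → EuclideanSpace ℝ (Fin (m i)))
    (r γ₀ c G₁ L : ℝ) (i : Fin n) (t : ℕ) (y x u : EuclideanSpace ℝ (Fin p)) : ℝ :=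
  gradEstGap (lagrangian f g γ₀ c i t x) (lagrangianConst g γ₀ c G₁ L i t x) (r * stepSize c t)
    x u ((1 - stepSize c t) • y)

section Pathwise

variable {n p : ℕ} {m : Fin n → ℕ} {X : Set (EuclideanSpace ℝ (Fin p))}
  {f : Fin n → ℕ → EuclideanSpace ℝ (Fin p) → ℝ}
  {g : (i : Fin n) → ℕ → EuclideanSpace ℝ (Fin p) → EuclideanSpace ℝ (Fin (m i))}
  {W : ℕ → Matrix (Fin n) (Fin n) ℝ} {G : ℕ → Digraph (Fin n)} {w : ℝ} {B : ℕ}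
  {r R F G₁ L γ₀ c : ℝ} {u z x : Fin n → ℕ → EuclideanSpace ℝ (Fin p)}

theorem PrimalRun.potential_mem_Icc (hrun : PrimalRun X f g W r γ₀ c u z x)
    (h : LipschitzProblem X f g r R F G₁ L) (hc : 0 ≤ c) {t : ℕ} (ht : 1 ≤ t)
    {y : EuclideanSpace ℝ (Fin p)} (hy : y ∈ X) :
    0 ≤ ∑ i, ‖z i t - (1 - stepSize c t) • y‖ ^ 2 ∧
      ∑ i, ‖z i t - (1 - stepSize c t) • y‖ ^ 2 ≤ n * (2 * R) ^ 2 := by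
  refine ⟨Finset.sum_nonneg fun _ _ => sq_nonneg _, ?_⟩
  have hR : ∀ {v}, v ∈ shrink X (stepSize c t) → ‖v‖ ≤ R := fun hv =>
    h.set.norm_le (h.set.shrink_subset h.r_pos (stepSize_pos ht) (stepSize_le_one hc ht) hv)
  have := Finset.sum_le_card_nsmul Finset.univ
    (fun i => ‖z i t - (1 - stepSize c t) • y‖ ^ 2) ((2 * R) ^ 2) fun i _ => by
      have h1 := hR (hrun.z_mem i ht)
      have h2 : ‖(1 - stepSize c t) • y‖ ≤ R := hR ⟨y, hy, rfl⟩
      have h3 := norm_sub_le (z i t) ((1 - stepSize c t) • y)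
      exact pow_le_pow_left₀ (norm_nonneg _) (by linarith) 2
  simpa using this

/-- Agent `i` is judged by every local loss, whereas the potential controls each loss only at its
own agent's decision. Exchanging the decisions costs `G₁` times the disagreement. -/
theorem LipschitzProblem.avg_globalLoss_sub_le (h : LipschitzProblem X f g r R F G₁ L)
    (hn : 1 ≤ n) (hc : 0 ≤ c) {t : ℕ} (ht : 1 ≤ t) {x : Fin n → EuclideanSpace ℝ (Fin p)}
    (hx : ∀ i, x i ∈ X) {y : EuclideanSpace ℝ (Fin p)} (hy : y ∈ X) :
    1 / (n : ℝ) * ∑ i, (globalLoss f t (x i) - globalLoss f t y) ≤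
      1 / n * ∑ i, (f i t (x i) - f i t ((1 - stepSize c t) • y)) +
        G₁ * R * stepSize c t + G₁ * disagreement x := by
  have hn0 : (0 : ℝ) < n := by exact_mod_cast hn
  have ha := stepSize_pos (c := c) ht
  have hyX : (1 - stepSize c t) • y ∈ X :=
    h.set.shrink_subset h.r_pos ha (stepSize_le_one hc ht) ⟨y, hy, rfl⟩
  have h1 : ∀ i j, f j t (x i) - f j t y ≤ (f j t (x j) - f j t ((1 - stepSize c t) • y)) +
      (G₁ * R * stepSize c t + G₁ * disagreement x) := fun i j => by
    have a1 := (le_abs_self _).trans (h.loss_lipschitz j t ht _ (hx i) _ (hx j))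
    have a2 := (le_abs_self _).trans (h.loss_lipschitz j t ht _ hyX _ hy)
    have a3 := mul_le_mul_of_nonneg_left (norm_sub_le_disagreement x i j) h.loss_nonneg
    have a4 : ‖(1 - stepSize c t) • y - y‖ ≤ stepSize c t * R := by
      rw [show (1 - stepSize c t) • y - y = -(stepSize c t • y) by module, norm_neg, norm_smul,
        Real.norm_of_nonneg ha.le]
      exact mul_le_mul_of_nonneg_left (h.set.norm_le hy) ha.le
    have a5 := mul_le_mul_of_nonneg_left a4 h.loss_nonneg
    linarith
  have h2 : ∀ i, globalLoss f t (x i) - globalLoss f t y ≤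
      1 / n * ∑ i, (f i t (x i) - f i t ((1 - stepSize c t) • y)) +
        (G₁ * R * stepSize c t + G₁ * disagreement x) := fun i => by
    have := mul_le_mul_of_nonneg_left (Finset.sum_le_sum fun j (_ : j ∈ Finset.univ) => h1 i j)
      (by positivity : 0 ≤ 1 / (n : ℝ))
    rw [Finset.sum_sub_distrib, Finset.sum_add_distrib, mul_sub, mul_add] at this
    refine this.trans_eq ?_
    congr 1
    simp only [Finset.sum_const, Finset.card_univ, Fintype.card_fin, nsmul_eq_mul]
    field_simp
  have h3 := mul_le_mul_of_nonneg_left (Finset.sum_le_sum fun i (_ : i ∈ Finset.univ) => h2 i)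
      (by positivity : 0 ≤ 1 / (n : ℝ))
  refine h3.trans_eq ?_
  simp only [Finset.sum_const, Finset.card_univ, Fintype.card_fin, nsmul_eq_mul]
  field_simp
  ring

theorem LipschitzProblem.avg_norm_clip_globalConstraint_le
    (h : LipschitzProblem X f g r R F G₁ L) (hn : 1 ≤ n) {t : ℕ} (ht : 1 ≤ t)
    {x : Fin n → EuclideanSpace ℝ (Fin p)} (hx : ∀ i, x i ∈ X) :
    1 / (n : ℝ) * ∑ i, ‖clip (globalConstraint g t (x i))‖ ≤
      ∑ i, ‖clip (g i t (x i))‖ + n * L * disagreement x := by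
  have hn0 : (0 : ℝ) < n := by exact_mod_cast hn
  have h1 : ∀ i j, ‖clip (g j t (x i))‖ ≤ ‖clip (g j t (x j))‖ + L * disagreement x :=
    fun i j => by
      have a1 := (norm_clip_sub_clip_le (g j t (x i)) (g j t (x j))).trans
        (h.constraint_lipschitz j t ht _ (hx i) _ (hx j))
      have a2 := mul_le_mul_of_nonneg_left (norm_sub_le_disagreement x i j) h.constraint_nonneg
      linarith [norm_sub_norm_le (clip (g j t (x i))) (clip (g j t (x j)))]
  have h2 : ∀ i, ‖clip (globalConstraint g t (x i))‖ ≤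
      ∑ i, ‖clip (g i t (x i))‖ + n * L * disagreement x := fun i => by
    refine (norm_clip_globalConstraint_le g t (x i)).trans
      ((Finset.sum_le_sum fun j _ => h1 i j).trans_eq ?_)
    rw [Finset.sum_add_distrib]
    simp only [Finset.sum_const, Finset.card_univ, Fintype.card_fin, nsmul_eq_mul]
    ring
  refine (mul_le_mul_of_nonneg_left (Finset.sum_le_sum fun i (_ : i ∈ Finset.univ) => h2 i)
    (by positivity : 0 ≤ 1 / (n : ℝ))).trans_eq ?_
  simp only [Finset.sum_const, Finset.card_univ, Fintype.card_fin, nsmul_eq_mul]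
  field_simp

end Pathwise

/-- Regret against a fixed comparator along one realization of the exploration directions. -/
theorem exists_pathwise_regret_bound {n p : ℕ} (hn : 1 ≤ n) {r R G₁ L w c γ₀ : ℝ} {B : ℕ}
    (hr : 0 ≤ r) (hG₁ : 0 ≤ G₁) (hw : w ∈ Set.Ioo (0 : ℝ) 1)
    (hc : c ∈ Set.Ioo (0 : ℝ) 1) (hγ₀ : 0 < γ₀) (hpL : 2 * (p : ℝ) ^ 2 * L ^ 2 * γ₀ ≤ 1) :
    ∃ C : ℝ, ∀ (m : Fin n → ℕ) (X : Set (EuclideanSpace ℝ (Fin p)))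
      (f : Fin n → ℕ → EuclideanSpace ℝ (Fin p) → ℝ)
      (g : (i : Fin n) → ℕ → EuclideanSpace ℝ (Fin p) → EuclideanSpace ℝ (Fin (m i)))
      (G : ℕ → Digraph (Fin n)) (W : ℕ → Matrix (Fin n) (Fin n) ℝ) (F : ℝ)
      (u z x : Fin n → ℕ → EuclideanSpace ℝ (Fin p)),
      LipschitzProblem X f g r R F G₁ L → NetworkAssumption G W w B →
      PrimalRun X f g W r γ₀ c u z x → (∀ i t, 1 ≤ t → ‖u i t‖ = 1) →
      ∀ (T : ℕ) (y : EuclideanSpace ℝ (Fin p)), 1 ≤ T → y ∈ feasibleSet X g T →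
      1 / (n : ℝ) * ∑ i, (∑ t ∈ Finset.Icc 1 T, globalLoss f t (x i t) -
          ∑ t ∈ Finset.Icc 1 T, globalLoss f t y) ≤
        C * (T : ℝ) ^ max c (1 - c) - 1 / n * ∑ t ∈ Finset.Icc 1 T, ∑ i,
          lagrangianGap f g r γ₀ c G₁ L i t y (x i t) (u i t) := by
  obtain ⟨hw0, hw1⟩ := hw
  set β := w ^ (n * B) with hβ
  have hβ0 : 0 < β := by positivity
  -- `κ` is the coefficient of the summed violations in `G₁` times the bound of
  -- `PrimalRun.sum_disagreement_le`.
  obtain ⟨C, hC⟩ := exists_regret_bound hn hc hγ₀ (Amax := n * (2 * R) ^ 2)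
    (C₁ := n * (γ₀ * (2 * L * R + 4 * r * L) ^ 2 / 2 + 4 * r * G₁ + 2 * p ^ 2 * G₁ ^ 2 +
      4 * R ^ 2)) (κ := G₁ * (2 * (n * B : ℕ) * (p * L * γ₀) / β))
    (by positivity) (by positivity)
  -- The constant is chosen before `X` is given, and only a set `X` forces `R ≥ 0`; hence the
  -- absolute value.
  set K := G₁ * |R| + G₁ * (2 * (n * B : ℕ) * (n * p * G₁) / β) with hK
  refine ⟨C + G₁ * ((n * B : ℕ) * (2 * |R|) / β) + K / (1 - c),
    fun m X f g G W F u z x h hW hrun hu T y hT hy => ?_⟩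
  have hR : 0 ≤ R := by simpa using h.set.norm_le (h.set.zero_mem h.r_pos.le)
  rw [abs_of_nonneg hR] at hK ⊢
  have hK0 : 0 ≤ K := by rw [hK]; positivity
  have hT1 : (1 : ℝ) ≤ T := by exact_mod_cast hT
  have h1 := hC (fun t => ∑ i, ‖z i t - (1 - stepSize c t) • y‖ ^ 2)
    (fun t => ∑ i, (f i t (x i t) - f i t ((1 - stepSize c t) • y)))
    (fun t => ∑ i, lagrangianGap f g r γ₀ c G₁ L i t y (x i t) (u i t))
    (fun t i => ‖clip (g i t (x i t))‖) T
    (fun t ht => hrun.potential_mem_Icc h hc.1.le ht hy.1)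
    (fun t ht htT => hrun.potential_succ_le h hW hw0.le hc.1.le hc.2.le hγ₀ hpL hu ht hy.1
      fun i k => hy.2 t (Finset.mem_Icc.2 ⟨ht, htT⟩) ⟨i, k⟩) hT
  have h2 := hrun.sum_disagreement_le h hW hw0 hw1.le hc.1.le hγ₀.le hu T
  have h3 := sum_stepSize_le hc.1.le hc.2 T
  have h4 : 1 / (n : ℝ) * ∑ i, (∑ t ∈ Finset.Icc 1 T, globalLoss f t (x i t) -
      ∑ t ∈ Finset.Icc 1 T, globalLoss f t y) =
      ∑ t ∈ Finset.Icc 1 T, 1 / (n : ℝ) * ∑ i, (globalLoss f t (x i t) - globalLoss f t y) := by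
    simp only [← Finset.sum_sub_distrib]
    rw [Finset.sum_comm, Finset.mul_sum]
  have h5 := Finset.sum_le_sum fun t (ht : t ∈ Finset.Icc 1 T) =>
    h.avg_globalLoss_sub_le hn hc.1.le (c := c) (Finset.mem_Icc.1 ht).1
      (x := fun i => x i t) (fun i => h.set.shrink_subset h.r_pos
        (stepSize_pos (Finset.mem_Icc.1 ht).1) (stepSize_le_one hc.1.le (Finset.mem_Icc.1 ht).1)
        (hrun.x_mem h.set hW hw0.le i (Finset.mem_Icc.1 ht).1)) hy.1
  rw [← h4] at h5
  simp only [Finset.sum_add_distrib, ← Finset.mul_sum] at h1 h5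
  have hP : (1 : ℝ) ≤ (T : ℝ) ^ max c (1 - c) :=
    Real.one_le_rpow hT1 (le_max_of_le_left hc.1.le)
  have hP2 : (T : ℝ) ^ (1 - c) ≤ (T : ℝ) ^ max c (1 - c) :=
    Real.rpow_le_rpow_of_exponent_le hT1 (le_max_right _ _)
  have hc1 : 0 < 1 - c := by linarith [hc.2]
  have h6 : K * ∑ t ∈ Finset.Icc 1 T, stepSize c t ≤ K / (1 - c) * (T : ℝ) ^ max c (1 - c) := by
    calc _ ≤ K * ((T : ℝ) ^ max c (1 - c) / (1 - c)) := by
          gcongr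
          exact h3.trans (by gcongr)
      _ = _ := by ring
  have h7 := mul_le_mul_of_nonneg_left h2 h.loss_nonneg
  have h8 : 0 ≤ G₁ * ((n * B : ℕ) * (2 * R) / β) := by positivity
  have h9 := mul_le_mul_of_nonneg_left hP h8
  rw [← hβ] at h7
  have e1 : ∀ S S' : ℝ, G₁ * (((n * B : ℕ) * (2 * R) + 2 * (n * B : ℕ) * (n * p * G₁ * S +
      p * L * γ₀ * S')) / β) = G₁ * ((n * B : ℕ) * (2 * R) / β) +
      G₁ * (2 * (n * B : ℕ) * (n * p * G₁) / β) * S +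
      G₁ * (2 * (n * B : ℕ) * (p * L * γ₀) / β) * S' := fun S S' => by ring
  rw [e1] at h7
  rw [hK, add_mul, ← hK] at h6
  linarith

/-- Constraint violation along one realization of the exploration directions. -/
theorem exists_pathwise_violation_bound {n p : ℕ} (hn : 1 ≤ n) {r R F G₁ L w c γ₀ : ℝ} {B : ℕ}
    (hr : 0 ≤ r) (hF : 0 ≤ F) (hG₁ : 0 ≤ G₁) (hL : 0 ≤ L) (hw : w ∈ Set.Ioo (0 : ℝ) 1)
    (hc : c ∈ Set.Ioo (0 : ℝ) 1) (hγ₀ : 0 < γ₀) (hpL : 2 * (p : ℝ) ^ 2 * L ^ 2 * γ₀ ≤ 1) :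
    ∃ C κ : ℝ, 0 ≤ κ ∧ ∀ (m : Fin n → ℕ) (X : Set (EuclideanSpace ℝ (Fin p)))
      (f : Fin n → ℕ → EuclideanSpace ℝ (Fin p) → ℝ)
      (g : (i : Fin n) → ℕ → EuclideanSpace ℝ (Fin p) → EuclideanSpace ℝ (Fin (m i)))
      (G : ℕ → Digraph (Fin n)) (W : ℕ → Matrix (Fin n) (Fin n) ℝ)
      (u z x : Fin n → ℕ → EuclideanSpace ℝ (Fin p)),
      LipschitzProblem X f g r R F G₁ L → NetworkAssumption G W w B →
      PrimalRun X f g W r γ₀ c u z x → (∀ i t, 1 ≤ t → ‖u i t‖ = 1) →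
      ∀ (T : ℕ) (y : EuclideanSpace ℝ (Fin p)), 1 ≤ T → y ∈ feasibleSet X g T →
      netCCV g x T ≤ C * (T : ℝ) ^ (1 - c / 2) - κ * (T : ℝ) ^ (c / 2) *
        ∑ t ∈ Finset.Icc 1 T, stepSize c t * ∑ i,
          lagrangianGap f g r γ₀ c G₁ L i t y (x i t) (u i t) := by
  obtain ⟨hw0, hw1⟩ := hw
  set β := w ^ (n * B) with hβ
  have hβ0 : 0 < β := by positivity
  obtain ⟨C, hC⟩ := exists_violation_bound (n := n) hc hγ₀ (Amax := n * (2 * R) ^ 2)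
    (C₁ := n * (γ₀ * (2 * L * R + 4 * r * L) ^ 2 / 2 + 4 * r * G₁ + 2 * p ^ 2 * G₁ ^ 2 +
      4 * R ^ 2)) (Δmax := n * (2 * F)) (by positivity) (by positivity) (by positivity)
  set K₁ := n * L * (2 * (n * B : ℕ) * (n * p * G₁) / β) with hK₁
  -- The `1` accounts for the local violations themselves, the other term for those that enter
  -- through the disagreement.
  set K₂ := 1 + n * L * (2 * (n * B : ℕ) * (p * L * γ₀) / β) with hK₂
  have hK₁0 : 0 ≤ K₁ := by positivity
  have hK₂0 : 0 ≤ K₂ := by positivity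
  refine ⟨K₂ * C + n * L * ((n * B : ℕ) * (2 * |R|) / β) + K₁ / (1 - c), K₂ * (2 / γ₀),
    by positivity, fun m X f g G W u z x h hW hrun hu T y hT hy => ?_⟩
  have hR : 0 ≤ R := by simpa using h.set.norm_le (h.set.zero_mem h.r_pos.le)
  rw [abs_of_nonneg hR]
  have hT1 : (1 : ℝ) ≤ T := by exact_mod_cast hT
  have hxX : ∀ t, 1 ≤ t → ∀ i, x i t ∈ X := fun t ht i => h.set.shrink_subset h.r_pos
    (stepSize_pos ht) (stepSize_le_one hc.1.le ht) (hrun.x_mem h.set hW hw0.le i ht)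
  have h1 := hC (fun t => ∑ i, ‖z i t - (1 - stepSize c t) • y‖ ^ 2)
    (fun t => ∑ i, (f i t (x i t) - f i t ((1 - stepSize c t) • y)))
    (fun t => ∑ i, lagrangianGap f g r γ₀ c G₁ L i t y (x i t) (u i t))
    (fun t i => ‖clip (g i t (x i t))‖) T
    (fun t ht => hrun.potential_mem_Icc h hc.1.le ht hy.1)
    (fun t ht _ => by
      have hyX : (1 - stepSize c t) • y ∈ X := h.set.shrink_subset h.r_pos
        (stepSize_pos ht) (stepSize_le_one hc.1.le ht) ⟨y, hy.1, rfl⟩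
      have : ∀ i, |f i t (x i t) - f i t ((1 - stepSize c t) • y)| ≤ 2 * F := fun i => by
        have a1 := abs_le.1 (h.loss_bounded i t ht _ (hxX t ht i))
        have a2 := abs_le.1 (h.loss_bounded i t ht _ hyX)
        exact abs_le.2 ⟨by linarith, by linarith⟩
      refine (Finset.abs_sum_le_sum_abs _ _).trans ((Finset.sum_le_sum fun i _ => this i).trans_eq
        (by simp)))
    (fun t ht htT => hrun.potential_succ_le h hW hw0.le hc.1.le hc.2.le hγ₀ hpL hu ht hy.1
      fun i k => hy.2 t (Finset.mem_Icc.2 ⟨ht, htT⟩) ⟨i, k⟩) hT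
  have h2 := hrun.sum_disagreement_le h hW hw0 hw1.le hc.1.le hγ₀.le hu T
  have h3 := sum_stepSize_le hc.1.le hc.2 T
  have h4 : netCCV g x T =
      ∑ t ∈ Finset.Icc 1 T, 1 / (n : ℝ) * ∑ i, ‖clip (globalConstraint g t (x i t))‖ := by
    rw [netCCV, Finset.sum_comm, Finset.mul_sum]
  have h5 := Finset.sum_le_sum fun t (ht : t ∈ Finset.Icc 1 T) =>
    h.avg_norm_clip_globalConstraint_le hn (Finset.mem_Icc.1 ht).1
      (x := fun i => x i t) (hxX t (Finset.mem_Icc.1 ht).1)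
  rw [← h4] at h5
  simp only [Finset.sum_add_distrib, ← Finset.mul_sum] at h5
  have hc1 : 0 < 1 - c := by linarith [hc.2]
  have hP : (1 : ℝ) ≤ (T : ℝ) ^ (1 - c / 2) :=
    Real.one_le_rpow hT1 (by linarith [hc.1])
  have hP2 : (T : ℝ) ^ (1 - c) ≤ (T : ℝ) ^ (1 - c / 2) :=
    Real.rpow_le_rpow_of_exponent_le hT1 (by linarith [hc.1])
  have h6 : K₁ * ∑ t ∈ Finset.Icc 1 T, stepSize c t ≤
      K₁ / (1 - c) * (T : ℝ) ^ (1 - c / 2) := by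
    calc _ ≤ K₁ * ((T : ℝ) ^ (1 - c / 2) / (1 - c)) := by
          gcongr
          exact h3.trans (by gcongr)
      _ = _ := by ring
  have h7 := mul_le_mul_of_nonneg_left h2 (by positivity : 0 ≤ n * L)
  have h8 : 0 ≤ n * L * ((n * B : ℕ) * (2 * R) / β) := by positivity
  have h9 := mul_le_mul_of_nonneg_left hP h8
  have h10 := mul_le_mul_of_nonneg_left h1 hK₂0
  rw [← hβ] at h7
  have e1 : ∀ S S' : ℝ, n * L * (((n * B : ℕ) * (2 * R) + 2 * (n * B : ℕ) * (n * p * G₁ * S +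
      p * L * γ₀ * S')) / β) = n * L * ((n * B : ℕ) * (2 * R) / β) + K₁ * S +
      (K₂ - 1) * S' := fun S S' => by rw [hK₁, hK₂]; ring
  rw [e1] at h7
  linarith

end DistBandit

/-! ### Measurability, independence and the sign of the mean noise. -/

namespace DistBandit

open MeasureTheory ProbabilityTheory Metric Set

section Extension

variable {n p : ℕ} {m : Fin n → ℕ} {X : Set (EuclideanSpace ℝ (Fin p))}
  {f f' : Fin n → ℕ → EuclideanSpace ℝ (Fin p) → ℝ}
  {g g' : (i : Fin n) → ℕ → EuclideanSpace ℝ (Fin p) → EuclideanSpace ℝ (Fin (m i))}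
  {r R F G₁ L γ₀ c : ℝ}

/-- The losses and constraints extend from `X` to continuous functions. -/
theorem LipschitzProblem.exists_continuous_extension (h : LipschitzProblem X f g r R F G₁ L) :
    ∃ (f' : Fin n → ℕ → EuclideanSpace ℝ (Fin p) → ℝ)
      (g' : (i : Fin n) → ℕ → EuclideanSpace ℝ (Fin p) → EuclideanSpace ℝ (Fin (m i))),
      (∀ i t, Continuous (f' i t)) ∧ (∀ i t, Continuous (g' i t)) ∧
      (∀ i t, 1 ≤ t → EqOn (f i t) (f' i t) X) ∧ ∀ i t, 1 ≤ t → EqOn (g i t) (g' i t) X := by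
  have hf : ∀ i t, ∃ f' : EuclideanSpace ℝ (Fin p) → ℝ, Continuous f' ∧
      (1 ≤ t → EqOn (f i t) f' X) := fun i t => by
    by_cases ht : 1 ≤ t
    · obtain ⟨f', h1, h2⟩ := (LipschitzOnWith.of_dist_le_mul (K := ⟨G₁, h.loss_nonneg⟩)
        (f := f i t) (s := X) fun a ha b hb => by
          rw [Real.dist_eq, dist_eq_norm]
          exact h.loss_lipschitz i t ht a ha b hb).extend_real
      exact ⟨f', h1.continuous, fun _ => h2⟩
    -- Nothing is assumed at time `0`, so any continuous function serves.
    · exact ⟨0, continuous_zero, fun h => absurd h ht⟩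
  have hg : ∀ i t, ∃ g' : EuclideanSpace ℝ (Fin p) → EuclideanSpace ℝ (Fin (m i)),
      Continuous g' ∧ (1 ≤ t → EqOn (g i t) g' X) := fun i t => by
    by_cases ht : 1 ≤ t
    · obtain ⟨g', h1, h2⟩ := (LipschitzOnWith.of_dist_le_mul (K := ⟨L, h.constraint_nonneg⟩)
        (f := g i t) (s := X) fun a ha b hb => by
          rw [dist_eq_norm, dist_eq_norm]
          exact h.constraint_lipschitz i t ht a ha b hb).extend_finite_dimension
      exact ⟨g', h1.continuous, fun _ => h2⟩
    · exact ⟨0, continuous_zero, fun h => absurd h ht⟩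
  choose f' hf1 hf2 using hf
  choose g' hg1 hg2 using hg
  exact ⟨f', g', hf1, hg1, hf2, hg2⟩

theorem continuous_lagrangian (hf : ∀ i t, Continuous (f i t)) (hg : ∀ i t, Continuous (g i t))
    (i : Fin n) (t : ℕ) {Z : Type*} [TopologicalSpace Z] {a b : Z → EuclideanSpace ℝ (Fin p)}
    (ha : Continuous a) (hb : Continuous b) :
    Continuous fun v => lagrangian f g γ₀ c i t (a v) (b v) := by
  have h1 : Continuous fun v => f i t (b v) := (hf i t).comp hb
  have h2 : Continuous fun v => g i t (b v) := (hg i t).comp hb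
  have h3 : Continuous fun v => clip (g i t (a v)) := continuous_clip.comp ((hg i t).comp ha)
  unfold lagrangian penalized
  fun_prop

theorem continuous_gradEst_lagrangian (hf : ∀ i t, Continuous (f i t))
    (hg : ∀ i t, Continuous (g i t)) (i : Fin n) (t : ℕ) (δ : ℝ) {Z : Type*}
    [TopologicalSpace Z] {a b : Z → EuclideanSpace ℝ (Fin p)}
    (ha : Continuous a) (hb : Continuous b) :
    Continuous fun v => gradEst (lagrangian f g γ₀ c i t (a v)) δ (a v) (b v) := by
  have h1 : Continuous fun v => lagrangian f g γ₀ c i t (a v) (a v + δ • b v) :=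
    continuous_lagrangian hf hg i t ha (by fun_prop)
  have h2 : Continuous fun v => lagrangian f g γ₀ c i t (a v) (a v) :=
    continuous_lagrangian hf hg i t ha ha
  unfold gradEst
  fun_prop

theorem continuous_lagrangianGap (hf : ∀ i t, Continuous (f i t))
    (hg : ∀ i t, Continuous (g i t)) (i : Fin n) (t : ℕ) (y : EuclideanSpace ℝ (Fin p))
    {Z : Type*} [TopologicalSpace Z] {a b : Z → EuclideanSpace ℝ (Fin p)}
    (ha : Continuous a) (hb : Continuous b) :
    Continuous fun v => lagrangianGap f g r γ₀ c G₁ L i t y (a v) (b v) := by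
  have h1 := continuous_gradEst_lagrangian (γ₀ := γ₀) (c := c) hf hg i t (r * stepSize c t) ha hb
  have h2 := continuous_lagrangian (γ₀ := γ₀) (c := c) hf hg i t ha ha
  have h3 := continuous_lagrangian (γ₀ := γ₀) (c := c) hf hg i t ha
    (continuous_const (y := (1 - stepSize c t) • y))
  have h4 : Continuous fun v => lagrangianConst g γ₀ c G₁ L i t (a v) := by
    have h5 : Continuous fun v => clip (g i t (a v)) := continuous_clip.comp ((hg i t).comp ha)
    unfold lagrangianConst
    fun_prop
  unfold lagrangianGap gradEstGap
  fun_prop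

theorem lagrangian_congr {i : Fin n} {t : ℕ} (hf : EqOn (f i t) (f' i t) X)
    (hg : EqOn (g i t) (g' i t) X) {x y : EuclideanSpace ℝ (Fin p)} (hx : x ∈ X) (hy : y ∈ X) :
    lagrangian f g γ₀ c i t x y = lagrangian f' g' γ₀ c i t x y := by
  simp only [lagrangian, penalized, hf hy, hg hy, hg hx]

theorem gradEst_lagrangian_congr (hX : SetAssumption X r R) (hr : 0 < r) (hc : 0 ≤ c)
    {i : Fin n} {t : ℕ} (ht : 1 ≤ t) (hf : EqOn (f i t) (f' i t) X)
    (hg : EqOn (g i t) (g' i t) X) {x u : EuclideanSpace ℝ (Fin p)}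
    (hx : x ∈ shrink X (stepSize c t)) (hu : ‖u‖ = 1) :
    gradEst (lagrangian f g γ₀ c i t x) (r * stepSize c t) x u =
      gradEst (lagrangian f' g' γ₀ c i t x) (r * stepSize c t) x u := by
  have ha := stepSize_pos (c := c) ht
  have ha1 := stepSize_le_one hc ht
  have hxX := hX.shrink_subset hr ha ha1 hx
  have hxu : x + (r * stepSize c t) • u ∈ X := hX.closedBall_subset ha ha1 hx (by
    rw [mem_closedBall, dist_eq_norm, add_sub_cancel_left, norm_smul, hu,
      Real.norm_of_nonneg (by positivity), mul_one])
  rw [gradEst, gradEst, lagrangian_congr hf hg hxX hxu, lagrangian_congr hf hg hxX hxX]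

theorem lagrangianGap_congr (hX : SetAssumption X r R) (hr : 0 < r) (hc : 0 ≤ c)
    {i : Fin n} {t : ℕ} (ht : 1 ≤ t) (hf : EqOn (f i t) (f' i t) X)
    (hg : EqOn (g i t) (g' i t) X) {x u y : EuclideanSpace ℝ (Fin p)}
    (hx : x ∈ shrink X (stepSize c t)) (hy : y ∈ X) (hu : ‖u‖ = 1) :
    lagrangianGap f g r γ₀ c G₁ L i t y x u = lagrangianGap f' g' r γ₀ c G₁ L i t y x u := by
  have ha := stepSize_pos (c := c) ht
  have ha1 := stepSize_le_one hc ht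
  have hxX := hX.shrink_subset hr ha ha1 hx
  have hyX : (1 - stepSize c t) • y ∈ X := hX.shrink_subset hr ha ha1 ⟨y, hy, rfl⟩
  rw [lagrangianGap, lagrangianGap, gradEstGap, gradEstGap,
    gradEst_lagrangian_congr hX hr hc ht hf hg hx hu, lagrangian_congr hf hg hxX hxX,
    lagrangian_congr hf hg hxX hyX, lagrangianConst, lagrangianConst, hg hxX]

end Extension

/-- Conditionally on `x`, an independent `u` may be integrated out first. -/
theorem integral_comp_nonneg_of_indepFun {Ω α β : Type*} [MeasurableSpace Ω] [MeasurableSpace α]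
    [MeasurableSpace β] {P : Measure Ω} [IsProbabilityMeasure P] {x : Ω → α} {u : Ω → β}
    (hx : Measurable x) (hu : Measurable u) (hind : IndepFun x u P) {H : α × β → ℝ}
    (hH : Measurable H) {K : Set α} (hK : MeasurableSet K) (hxK : ∀ ω, x ω ∈ K) {C : ℝ}
    (hC : ∀ a ∈ K, ∀ b, ‖H (a, b)‖ ≤ C) (hpos : ∀ a ∈ K, 0 ≤ ∫ b, H (a, b) ∂(P.map u)) :
    0 ≤ ∫ ω, H (x ω, u ω) ∂P := by
  have hxu := hx.prodMk hu
  have hint : Integrable (fun ω => H (x ω, u ω)) P :=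
    Integrable.of_bound (hH.comp hxu).aestronglyMeasurable C
      (Filter.Eventually.of_forall fun ω => hC _ (hxK ω) _)
  have hpx : IsProbabilityMeasure (P.map x) := Measure.isProbabilityMeasure_map hx.aemeasurable
  have hpu : IsProbabilityMeasure (P.map u) := Measure.isProbabilityMeasure_map hu.aemeasurable
  have hmap := (indepFun_iff_map_prod_eq_prod_map_map hx.aemeasurable hu.aemeasurable).1 hind
  have hint' : Integrable H ((P.map x).prod (P.map u)) := by
    rw [← hmap]
    exact (integrable_map_measure hH.aestronglyMeasurable hxu.aemeasurable).2 hint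
  have e : ∫ ω, H (x ω, u ω) ∂P = ∫ v, H v ∂((P.map x).prod (P.map u)) := by
    rw [← hmap, integral_map hxu.aemeasurable hH.aestronglyMeasurable]
  rw [e, integral_prod _ hint']
  refine integral_nonneg_of_ae ?_
  have : ∀ᵐ a ∂(P.map x), a ∈ K :=
    (ae_map_iff hx.aemeasurable hK).2 (Filter.Eventually.of_forall hxK)
  filter_upwards [this] with a ha using hpos a ha

section Stochastic

variable {n p : ℕ} {m : Fin n → ℕ} {X : Set (EuclideanSpace ℝ (Fin p))}
  {f : Fin n → ℕ → EuclideanSpace ℝ (Fin p) → ℝ}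
  {g : (i : Fin n) → ℕ → EuclideanSpace ℝ (Fin p) → EuclideanSpace ℝ (Fin (m i))}
  {W : ℕ → Matrix (Fin n) (Fin n) ℝ} {G : ℕ → Digraph (Fin n)} {w : ℝ} {B : ℕ}
  {r R F G₁ L γ₀ c : ℝ}
  {Ω : Type*} {u : Fin n → ℕ → Ω → sphere (0 : EuclideanSpace ℝ (Fin p)) 1}
  {z x : Fin n → ℕ → Ω → EuclideanSpace ℝ (Fin p)}

/-- The information generated by the exploration directions before time `t`. -/
abbrev history (u : Fin n → ℕ → Ω → sphere (0 : EuclideanSpace ℝ (Fin p)) 1) (t : ℕ) :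
    MeasurableSpace Ω :=
  ⨆ k ∈ {k : Fin n × ℕ | k.2 + 1 < t}, MeasurableSpace.comap (u k.1 (k.2 + 1)) inferInstance

theorem history_mono : Monotone (history u) := fun _ _ hst =>
  biSup_mono fun _ hk => lt_of_lt_of_le hk hst

theorem measurable_history (i : Fin n) {t : ℕ} (ht : 1 ≤ t) :
    Measurable[history u (t + 1)] (u i t) := by
  obtain ⟨s, rfl⟩ := Nat.exists_eq_add_of_le' ht
  refine measurable_iff_comap_le.2 ?_
  exact le_biSup (fun k : Fin n × ℕ => MeasurableSpace.comap (u k.1 (k.2 + 1)) inferInstance)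
    (show (i, s) ∈ {k : Fin n × ℕ | k.2 + 1 < s + 1 + 1} from Nat.lt_succ_self _)

theorem history_le [mΩ : MeasurableSpace Ω] (hu : ∀ i t, 1 ≤ t → Measurable (u i t)) (t : ℕ) :
    history u t ≤ mΩ :=
  iSup₂_le fun k _ => (hu k.1 (k.2 + 1) (by omega)).comap_le

/-- The history before `t` and the direction at `t` come from disjoint sets of indices of an
independent family. -/
theorem indep_history [MeasurableSpace Ω] {P : Measure Ω}
    (hu : ∀ i t, 1 ≤ t → Measurable (u i t))
    (hind : iIndepFun (fun k : Fin n × ℕ => u k.1 (k.2 + 1)) P) (i : Fin n) {t : ℕ}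
    (ht : 1 ≤ t) : Indep (history u t) (MeasurableSpace.comap (u i t) inferInstance) P := by
  obtain ⟨s, rfl⟩ := Nat.exists_eq_add_of_le' ht
  have := indep_iSup_of_disjoint (fun k : Fin n × ℕ => (hu k.1 (k.2 + 1) (by omega)).comap_le)
    hind.iIndep (S := {k | k.2 + 1 < s + 1}) (T := {(i, s)})
    (Set.disjoint_singleton_right.2 fun h => lt_irrefl (s + 1) h)
  rw [iSup_singleton] at this
  exact this

theorem measurable_sum_smul [MeasurableSpace Ω] (a : Fin n → ℝ)
    {v : Fin n → Ω → EuclideanSpace ℝ (Fin p)} (hv : ∀ j, Measurable (v j)) :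
    Measurable fun ω => ∑ j, a j • v j ω :=
  Finset.measurable_sum _ fun j _ => (hv j).const_smul (a j)

theorem measurable_comp_prodMk_sphere [MeasurableSpace Ω]
    {Φ : EuclideanSpace ℝ (Fin p) × EuclideanSpace ℝ (Fin p) → EuclideanSpace ℝ (Fin p)}
    (hΦ : Continuous Φ) {v : Ω → EuclideanSpace ℝ (Fin p)}
    {b : Ω → sphere (0 : EuclideanSpace ℝ (Fin p)) 1} (hv : Measurable v) (hb : Measurable b) :
    Measurable fun ω => Φ (v ω, (b ω).1) :=
  hΦ.measurable.comp (hv.prodMk (measurable_subtype_coe.comp hb))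

/-- By induction: each new iterate is a continuous function of the previous decision and the current
direction, so it depends only on directions already drawn. -/
theorem measurable_history_run
    (hrun : ∀ ω, PrimalRun X f g W r γ₀ c (fun i t => (u i t ω).1) (fun i t => z i t ω)
      (fun i t => x i t ω))
    (h : LipschitzProblem X f g r R F G₁ L) (hW : NetworkAssumption G W w B) (hw : 0 ≤ w)
    (hc : 0 ≤ c) {t : ℕ} (ht : 1 ≤ t) :
    (∀ i, Measurable[history u t] (z i t)) ∧ ∀ i, Measurable[history u t] (x i t) := by
  have hx : ∀ t, 1 ≤ t → (∀ i, Measurable[history u t] (z i t)) →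
      ∀ i, Measurable[history u t] (x i t) := fun t ht hz i => by
    have e : x i t = fun ω => ∑ j, W t i j • z j t ω :=
      funext fun ω => (hrun ω).consensus i t ht
    rw [e]
    exact @measurable_sum_smul n p Ω (history u t) (W t i) (fun j => z j t) hz
  suffices hz : ∀ i, Measurable[history u t] (z i t) from ⟨hz, hx t ht hz⟩
  induction t, ht using Nat.le_induction with
  | base =>
    intro i
    -- Since `stepSize c 1 = 1`, the first shrunken set is `{0}` and the start is deterministic.
    have e : z i 1 = fun _ => 0 := funext fun ω => by
      obtain ⟨y, _, hy⟩ := (hrun ω).init i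
      simpa [stepSize_one] using hy.symm
    rw [e]
    exact @measurable_const _ _ _ (history u 1) _
  | succ t ht ih =>
    intro i
    have hxt := hx t ht ih i
    -- Off `X` the losses and constraints are arbitrary, possibly not measurable. All queries lie in
    -- `X`, so continuous extensions produce the same iterates.
    obtain ⟨f', g', hf', hg', hff, hgg⟩ := h.exists_continuous_extension
    obtain ⟨π, hπ, hπe⟩ := exists_continuous_isProjection
      (h.set.convex_shrink (stepSize c (t + 1))) (h.set.isCompact_shrink _).isClosed
      ⟨_, 0, h.set.zero_mem h.r_pos.le, rfl⟩
    set Φ : EuclideanSpace ℝ (Fin p) × EuclideanSpace ℝ (Fin p) → EuclideanSpace ℝ (Fin p) :=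
      fun v => π (v.1 - stepSize c t •
        gradEst (lagrangian f' g' γ₀ c i t v.1) (r * stepSize c t) v.1 v.2)
    have e : z i (t + 1) = fun ω => Φ (x i t ω, (u i t ω).1) := funext fun ω => by
      have := hπe _ _ ((hrun ω).primal i t ht)
      rw [gradEst_lagrangian_congr h.set h.r_pos hc ht (hff i t ht) (hgg i t ht)
        ((hrun ω).x_mem h.set hW hw i ht) (norm_eq_of_mem_sphere _)] at this
      exact this
    have hΦ : Continuous Φ := by
      have := continuous_gradEst_lagrangian (γ₀ := γ₀) (c := c) hf' hg' i t (r * stepSize c t)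
        (continuous_fst (X := EuclideanSpace ℝ (Fin p)) (Y := EuclideanSpace ℝ (Fin p)))
        continuous_snd
      fun_prop
    rw [e]
    exact @measurable_comp_prodMk_sphere p Ω (history u (t + 1)) Φ hΦ _ _
      (hxt.mono (history_mono (Nat.le_succ t)) le_rfl) (measurable_history i ht)

theorem integrable_comp_of_continuous [MeasurableSpace Ω] {P : Measure Ω} [IsProbabilityMeasure P]
    {K : Set (EuclideanSpace ℝ (Fin p))} (hK : IsCompact K)
    {v : Ω → EuclideanSpace ℝ (Fin p)} (hv : Measurable v) (hvK : ∀ ω, v ω ∈ K)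
    {φ φ' : EuclideanSpace ℝ (Fin p) → ℝ} (hφ : Continuous φ') (he : EqOn φ φ' K) :
    Integrable (fun ω => φ (v ω)) P := by
  obtain ⟨C, hC⟩ := hK.exists_bound_of_continuousOn hφ.continuousOn
  have e : (fun ω => φ (v ω)) = fun ω => φ' (v ω) := funext fun ω => he (hvK ω)
  rw [e]
  exact Integrable.of_bound (hφ.measurable.comp hv).aestronglyMeasurable C
    (Filter.Eventually.of_forall fun ω => hC _ (hvK ω))

/-- The dual variable depends on the decision alone. With `x i t` fixed, the Lagrangian is thus one
fixed convex Lipschitz function, and `le_integral_inner_gradEst` applies to the average over the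
independent direction. -/
theorem integrable_lagrangianGap [MeasurableSpace Ω] {P : Measure Ω} [IsProbabilityMeasure P]
    (hp : 1 ≤ p)
    (hrun : ∀ ω, PrimalRun X f g W r γ₀ c (fun i t => (u i t ω).1) (fun i t => z i t ω)
      (fun i t => x i t ω))
    (h : LipschitzProblem X f g r R F G₁ L) (hW : NetworkAssumption G W w B) (hw : 0 ≤ w)
    (hc : 0 ≤ c) (hγ₀ : 0 ≤ γ₀) (hu : ∀ i t, 1 ≤ t → Measurable (u i t))
    (hlaw : ∀ i t, 1 ≤ t → P.map (u i t) = sphereUniform p)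
    (hind : iIndepFun (fun k : Fin n × ℕ => u k.1 (k.2 + 1)) P) (i : Fin n) {t : ℕ} (ht : 1 ≤ t)
    {y : EuclideanSpace ℝ (Fin p)} (hy : y ∈ X) :
    Integrable (fun ω => lagrangianGap f g r γ₀ c G₁ L i t y (x i t ω) (u i t ω).1) P ∧
      0 ≤ ∫ ω, lagrangianGap f g r γ₀ c G₁ L i t y (x i t ω) (u i t ω).1 ∂P := by
  have hxm := (measurable_history_run hrun h hW hw hc ht).2 i
  have hxmeas := hxm.mono (history_le hu t) le_rfl
  have hxK : ∀ ω, x i t ω ∈ shrink X (stepSize c t) := fun ω => (hrun ω).x_mem h.set hW hw i ht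
  obtain ⟨f', g', hf', hg', hff, hgg⟩ := h.exists_continuous_extension
  set H : EuclideanSpace ℝ (Fin p) × sphere (0 : EuclideanSpace ℝ (Fin p)) 1 → ℝ :=
    fun v => lagrangianGap f' g' r γ₀ c G₁ L i t y v.1 v.2.1 with hHdef
  have hHc : Continuous H := continuous_lagrangianGap hf' hg' i t y continuous_fst
    (continuous_subtype_val.comp continuous_snd)
  have he : ∀ a ∈ shrink X (stepSize c t), ∀ b : sphere (0 : EuclideanSpace ℝ (Fin p)) 1,
      lagrangianGap f g r γ₀ c G₁ L i t y a b.1 = H (a, b) := fun a ha b =>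
    lagrangianGap_congr h.set h.r_pos hc ht (hff i t ht) (hgg i t ht) ha hy
      (norm_eq_of_mem_sphere _)
  obtain ⟨C, hC⟩ := ((h.set.isCompact_shrink (stepSize c t)).prod
    (isCompact_univ (X := sphere (0 : EuclideanSpace ℝ (Fin p)) 1))).exists_bound_of_continuousOn
    hHc.continuousOn
  have hC' : ∀ a ∈ shrink X (stepSize c t), ∀ b, ‖H (a, b)‖ ≤ C := fun a ha b =>
    hC (a, b) ⟨ha, mem_univ b⟩
  have hω : ∀ ω, lagrangianGap f g r γ₀ c G₁ L i t y (x i t ω) (u i t ω).1 =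
      H (x i t ω, u i t ω) := fun ω => he _ (hxK ω) _
  simp only [hω]
  refine ⟨Integrable.of_bound (hHc.measurable.comp
    (hxmeas.prodMk (hu i t ht))).aestronglyMeasurable C
    (Filter.Eventually.of_forall fun ω => hC' _ (hxK ω) _), ?_⟩
  refine integral_comp_nonneg_of_indepFun hxmeas (hu i t ht) ?_ hHc.measurable
    (h.set.isCompact_shrink (stepSize c t)).measurableSet hxK hC' fun a ha => ?_
  · rw [IndepFun_iff_Indep]
    exact indep_of_indep_of_le_left (indep_history hu hind i ht) hxm.comap_le
  · simp only [← he a ha]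
    rw [hlaw i t ht]
    -- The normalisation is inherited from being the law of a random direction.
    have hprob : IsProbabilityMeasure (sphereUniform p) := by
      rw [← hlaw i t ht]
      exact Measure.isProbabilityMeasure_map (hu i t ht).aemeasurable
    have hδ : 0 < r * stepSize c t := mul_pos h.r_pos (stepSize_pos ht)
    have hest := le_integral_inner_gradEst hp (h.convexOn_lagrangian (c := c) hγ₀ i ht a)
      (h.lagrangianConst_nonneg (γ₀ := γ₀) (c := c) i t a)
      (h.abs_lagrangian_sub_le i ht a) hδ
      (h.set.closedBall_subset (stepSize_pos ht) (stepSize_le_one hc ht) ha)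
      (h.set.closedBall_subset (stepSize_pos ht) (stepSize_le_one hc ht)
        (⟨y, hy, rfl⟩ : (1 - stepSize c t) • y ∈ shrink X (stepSize c t)))
    simp only [lagrangianGap, gradEstGap]
    rw [integral_sub ?_ (integrable_const _), integral_const, probReal_univ, one_smul]
    · linarith
    · have hi : Integrable (fun b => H (a, b)) (sphereUniform p) :=
        Integrable.of_bound (hHc.comp (by fun_prop)).measurable.aestronglyMeasurable C
          (Filter.Eventually.of_forall fun b => hC' a ha b)
      have := hi.add (integrable_const (μ := sphereUniform p)
        (lagrangian f g γ₀ c i t a a - lagrangian f g γ₀ c i t a ((1 - stepSize c t) • y) -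
          2 * lagrangianConst g γ₀ c G₁ L i t a * (r * stepSize c t)))
      refine this.congr (Filter.Eventually.of_forall fun b => ?_)
      simp only [Pi.add_apply, ← he a ha, lagrangianGap, gradEstGap]
      ring

end Stochastic

end DistBandit

/-! ### Passage to expectations and the final bounds. -/

namespace DistBandit

open MeasureTheory ProbabilityTheory Metric Set

section Expectation

variable {n p : ℕ} {m : Fin n → ℕ} {X : Set (EuclideanSpace ℝ (Fin p))}
  {f : Fin n → ℕ → EuclideanSpace ℝ (Fin p) → ℝ}
  {g : (i : Fin n) → ℕ → EuclideanSpace ℝ (Fin p) → EuclideanSpace ℝ (Fin (m i))}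
  {r R F G₁ G₂ L γ₀ c : ℝ}

/-- `F` and `G₁` carry no sign hypothesis, and the constants are fixed before any instance that
would force one; hence the absolute values. -/
theorem lipschitzProblem_of_assumptions (hr : 0 < r) (hG₂ : 0 ≤ G₂)
    (hX : SetAssumption X r R) (hf : LossAssumption X f F G₁) (hg : ConstraintAssumption X g G₂) :
    LipschitzProblem X f g r R |F| |G₁| (√2 * G₂) where
  set := hX
  r_pos := hr
  loss_nonneg := abs_nonneg _
  constraint_nonneg := by positivity
  loss_bounded i t ht x hx := (hf.bounded i t ht x hx).trans (le_abs_self F)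
  loss_convex := hf.convex
  loss_lipschitz i t ht x hx y hy :=
    (abs_sub_le_of_subgradient (hf.subgradient i t ht) hx hy).trans
      (mul_le_mul_of_nonneg_right (le_abs_self _) (norm_nonneg _))
  constraint_convex := hg.convex
  constraint_lipschitz i t ht x hx y hy :=
    norm_sub_le_of_vecSubgradient hG₂ (hg.subgradient i t ht) hx hy

theorem two_mul_sq_mul_sq_mul_le_one (hG₂ : 0 < G₂)
    (hγ₀ : γ₀ ≤ 1 / (4 * ((p : ℝ) ^ 2 + 1) * G₂ ^ 2)) :
    2 * (p : ℝ) ^ 2 * (√2 * G₂) ^ 2 * γ₀ ≤ 1 := by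
  rw [mul_pow, Real.sq_sqrt (by norm_num)]
  calc 2 * (p : ℝ) ^ 2 * (2 * G₂ ^ 2) * γ₀
      ≤ 2 * (p : ℝ) ^ 2 * (2 * G₂ ^ 2) * (1 / (4 * ((p : ℝ) ^ 2 + 1) * G₂ ^ 2)) := by gcongr
    _ = (p : ℝ) ^ 2 / ((p : ℝ) ^ 2 + 1) := by field_simp; ring
    _ ≤ 1 := by rw [div_le_one (by positivity)]; linarith

variable {Ω : Type*} [MeasurableSpace Ω] {P : Measure Ω} [IsProbabilityMeasure P]
  {x : Fin n → ℕ → Ω → EuclideanSpace ℝ (Fin p)}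

theorem integrable_globalLoss (h : LipschitzProblem X f g r R F G₁ L) (i : Fin n) {t : ℕ}
    (ht : 1 ≤ t) (hx : Measurable (x i t)) (hxX : ∀ ω, x i t ω ∈ X) :
    Integrable (fun ω => globalLoss f t (x i t ω)) P := by
  obtain ⟨f', g', hf', hg', hff, hgg⟩ := h.exists_continuous_extension
  exact (integrable_finsetSum _ fun j _ => integrable_comp_of_continuous h.set.isCompact hx hxX
    (hf' j t) (hff j t ht)).const_mul _

theorem integrable_norm_clip_globalConstraint (h : LipschitzProblem X f g r R F G₁ L) (i : Fin n)
    {t : ℕ} (ht : 1 ≤ t) (hx : Measurable (x i t)) (hxX : ∀ ω, x i t ω ∈ X) :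
    Integrable (fun ω => ‖clip (globalConstraint g t (x i t ω))‖) P := by
  obtain ⟨f', g', hf', hg', hff, hgg⟩ := h.exists_continuous_extension
  refine integrable_comp_of_continuous (φ := fun v => ‖clip (globalConstraint g t v)‖)
    (φ' := fun v => ‖clip (globalConstraint g' t v)‖) h.set.isCompact hx hxX ?_ fun v hv => ?_
  · have h1 : Continuous fun v => globalConstraint g' t v := by
      have h2 : ∀ i, Continuous (g' i t) := fun i => hg' i t
      unfold globalConstraint
      fun_prop
    exact (continuous_clip.comp h1).norm
  · have h1 : globalConstraint g t v = globalConstraint g' t v := by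
      ext k
      simp only [globalConstraint, hgg k.1 t ht hv]
    simp only [h1]

end Expectation

end DistBandit

theorem theorem1
    (n p : ℕ) (hn : 1 ≤ n) (hp : 1 ≤ p)
    (r R F G₁ G₂ w c γ₀ : ℝ) (B : ℕ)
    (hr : 0 < r) (hG₂ : 0 < G₂) (hw : w ∈ Set.Ioo (0 : ℝ) 1) (hB : 0 < B)
    (hc : c ∈ Set.Ioo (0 : ℝ) 1)
    (hγ₀ : γ₀ ∈ Set.Ioc (0 : ℝ) (1 / (4 * ((p : ℝ) ^ 2 + 1) * G₂ ^ 2)))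
    (α γ ξ δ : ℕ → ℝ)
    (hα : ∀ t : ℕ, 1 ≤ t → α t = 1 / (t : ℝ) ^ c)
    (hγ : ∀ t : ℕ, 1 ≤ t → γ t = γ₀ / α t)
    (hξ : ∀ t : ℕ, 1 ≤ t → ξ t = α t)
    (hδ : ∀ t : ℕ, 1 ≤ t → δ t = r * α t) :
    ∃ C : ℝ, ∀ (m : Fin n → ℕ) (X : Set (EuclideanSpace ℝ (Fin p)))
      (f : Fin n → ℕ → EuclideanSpace ℝ (Fin p) → ℝ)
      (g : (i : Fin n) → ℕ → EuclideanSpace ℝ (Fin p) → EuclideanSpace ℝ (Fin (m i)))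
      (G : ℕ → Digraph (Fin n)) (W : ℕ → Matrix (Fin n) (Fin n) ℝ)
      (Ω : Type*) [MeasurableSpace Ω] (P : MeasureTheory.Measure Ω)
      [MeasureTheory.IsProbabilityMeasure P]
      (u : Fin n → ℕ → Ω → Metric.sphere (0 : EuclideanSpace ℝ (Fin p)) 1)
      (z x : Fin n → ℕ → Ω → EuclideanSpace ℝ (Fin p))
      (q : (i : Fin n) → ℕ → Ω → EuclideanSpace ℝ (Fin (m i)))
      (dir : Fin n → ℕ → Ω → EuclideanSpace ℝ (Fin p)),
      DistBandit.SetAssumption X r R →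
      DistBandit.LossAssumption X f F G₁ →
      DistBandit.ConstraintAssumption X g G₂ →
      DistBandit.NetworkAssumption G W w B →
      (∀ T : ℕ, 1 ≤ T → (DistBandit.feasibleSet X g T).Nonempty) →
      -- the exploration directions are independent and uniform on the unit sphere
      (∀ i t, 1 ≤ t → Measurable (u i t)) →
      (∀ i t, 1 ≤ t → MeasureTheory.Measure.map (u i t) P = DistBandit.sphereUniform p) →
      ProbabilityTheory.iIndepFun (fun k : Fin n × ℕ => u k.1 (k.2 + 1)) P →
      (∀ ω, DistBandit.IsRun X f g W α γ ξ δ (fun i t => (u i t ω).1)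
        (fun i t => z i t ω) (fun i t => x i t ω) (fun i t => q i t ω)
        (fun i t => dir i t ω)) →
      ∀ T : ℕ, 1 ≤ T →
        (MeasureTheory.Integrable
            (fun ω => DistBandit.netReg X f g (fun i t => x i t ω) T) P ∧
          ∫ ω, DistBandit.netReg X f g (fun i t => x i t ω) T ∂P
            ≤ C * (T : ℝ) ^ (max c (1 - c))) ∧
        (MeasureTheory.Integrable
            (fun ω => DistBandit.netCCV g (fun i t => x i t ω) T) P ∧
          ∫ ω, DistBandit.netCCV g (fun i t => x i t ω) T ∂P
            ≤ C * (T : ℝ) ^ (1 - c / 2)) := by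
  have hL := DistBandit.two_mul_sq_mul_sq_mul_le_one (p := p) hG₂ hγ₀.2
  obtain ⟨C₁, hC₁⟩ := DistBandit.exists_pathwise_regret_bound (p := p) (R := R) (B := B) hn hr.le
    (abs_nonneg G₁) hw hc hγ₀.1 hL
  obtain ⟨C₂, κ, hκ, hC₂⟩ := DistBandit.exists_pathwise_violation_bound (p := p) (R := R) (B := B)
    hn hr.le (abs_nonneg F) (abs_nonneg G₁) (by positivity : 0 ≤ √2 * G₂) hw hc hγ₀.1 hL
  refine ⟨max C₁ C₂, ?_⟩
  intro m X f g G W Ω _ P _ u z x q dir hX hf hg hW hfeas hum hlaw hind hrun T hT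
  have h := DistBandit.lipschitzProblem_of_assumptions hr hG₂.le hX hf hg
  have hprim : ∀ ω, DistBandit.PrimalRun X f g W r γ₀ c (fun i t => (u i t ω).1)
      (fun i t => z i t ω) (fun i t => x i t ω) := fun ω => (hrun ω).primalRun hα hγ hξ hδ
  have hu : ∀ ω i t, 1 ≤ t → ‖(u i t ω).1‖ = 1 := fun ω i t _ => norm_eq_of_mem_sphere _
  have hn0 : (0 : ℝ) < n := by exact_mod_cast hn
  have hxm : ∀ i t, 1 ≤ t → Measurable (x i t) := fun i t ht =>
    ((DistBandit.measurable_history_run hprim h hW hw.1.le hc.1.le ht).2 i).mono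
      (DistBandit.history_le hum t) le_rfl
  have hxX : ∀ i t, 1 ≤ t → ∀ ω, x i t ω ∈ X := fun i t ht ω =>
    hX.shrink_subset hr (DistBandit.stepSize_pos ht) (DistBandit.stepSize_le_one hc.1.le ht)
      ((hprim ω).x_mem hX hW hw.1.le i ht)
  have hgap := fun (i : Fin n) (t : ℕ) (ht : 1 ≤ t) (y : EuclideanSpace ℝ (Fin p))
    (hy : y ∈ X) => DistBandit.integrable_lagrangianGap hp hprim h hW hw.1.le hc.1.le hγ₀.1.le hum
      hlaw hind i ht hy
  have hT0 : (0 : ℝ) < T := by exact_mod_cast hT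
  constructor
  · set I := sInf ((fun y => ∑ t ∈ Finset.Icc 1 T, DistBandit.globalLoss f t y) ''
      DistBandit.feasibleSet X g T) with hI
    set A : Ω → ℝ := fun ω =>
      1 / (n : ℝ) * ∑ i, ∑ t ∈ Finset.Icc 1 T, DistBandit.globalLoss f t (x i t ω) with hA
    have hAint : MeasureTheory.Integrable A P :=
      (MeasureTheory.integrable_finsetSum _ fun i _ => MeasureTheory.integrable_finsetSum _
        fun t ht => DistBandit.integrable_globalLoss h i (Finset.mem_Icc.1 ht).1
          (hxm i t (Finset.mem_Icc.1 ht).1) (hxX i t (Finset.mem_Icc.1 ht).1)).const_mul _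
    have hconst : ∀ (a : Fin n → ℝ) (b : ℝ),
        1 / (n : ℝ) * ∑ i, (a i - b) = 1 / (n : ℝ) * ∑ i, a i - b := fun a b => by
      rw [Finset.sum_sub_distrib]
      simp only [Finset.sum_const, Finset.card_univ, Fintype.card_fin, nsmul_eq_mul]
      field_simp
    have hreg : (fun ω => DistBandit.netReg X f g (fun i t => x i t ω) T) = fun ω => A ω - I :=
      funext fun ω => hconst _ _
    rw [hreg]
    refine ⟨hAint.sub (MeasureTheory.integrable_const _), ?_⟩
    rw [MeasureTheory.integral_sub hAint (MeasureTheory.integrable_const _),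
      MeasureTheory.integral_const, MeasureTheory.probReal_univ, one_smul]
    -- The bound is proved in expectation against each fixed feasible `y`, and the infimum is taken
    -- afterwards; no minimiser is needed, and the comparator stays deterministic.
    have hlow : ∫ ω, A ω ∂P - C₁ * (T : ℝ) ^ max c (1 - c) ≤ I := by
      refine le_csInf ((hfeas T hT).image _) ?_
      rintro _ ⟨y, hy, rfl⟩
      have hMint : MeasureTheory.Integrable (fun ω => 1 / (n : ℝ) * ∑ t ∈ Finset.Icc 1 T, ∑ i,
          DistBandit.lagrangianGap f g r γ₀ c |G₁| (√2 * G₂) i t y (x i t ω) (u i t ω).1) P :=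
        (MeasureTheory.integrable_finsetSum _ fun t ht => MeasureTheory.integrable_finsetSum _
          fun i _ => (hgap i t (Finset.mem_Icc.1 ht).1 y hy.1).1).const_mul _
      have hM0 : 0 ≤ ∫ ω, 1 / (n : ℝ) * ∑ t ∈ Finset.Icc 1 T, ∑ i,
          DistBandit.lagrangianGap f g r γ₀ c |G₁| (√2 * G₂) i t y (x i t ω) (u i t ω).1 ∂P := by
        rw [MeasureTheory.integral_const_mul, MeasureTheory.integral_finsetSum _ fun t ht =>
          MeasureTheory.integrable_finsetSum _
            fun i _ => (hgap i t (Finset.mem_Icc.1 ht).1 y hy.1).1]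
        refine mul_nonneg (by positivity) (Finset.sum_nonneg fun t ht => ?_)
        rw [MeasureTheory.integral_finsetSum _
          fun i _ => (hgap i t (Finset.mem_Icc.1 ht).1 y hy.1).1]
        exact Finset.sum_nonneg fun i _ => (hgap i t (Finset.mem_Icc.1 ht).1 y hy.1).2
      have hpt : ∀ ω, A ω ≤ (∑ t ∈ Finset.Icc 1 T, DistBandit.globalLoss f t y +
          C₁ * (T : ℝ) ^ max c (1 - c)) - 1 / (n : ℝ) * ∑ t ∈ Finset.Icc 1 T, ∑ i,
          DistBandit.lagrangianGap f g r γ₀ c |G₁| (√2 * G₂) i t y (x i t ω) (u i t ω).1 :=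
        fun ω => by
          have := hC₁ m X f g G W |F| _ _ _ h hW (hprim ω) (hu ω) T y hT hy
          rw [hconst] at this
          linarith
      have := MeasureTheory.integral_mono hAint
        ((MeasureTheory.integrable_const _).sub hMint) hpt
      simp only [Pi.sub_apply] at this
      rw [MeasureTheory.integral_sub (MeasureTheory.integrable_const _) hMint,
        MeasureTheory.integral_const, MeasureTheory.probReal_univ, one_smul] at this
      linarith
    have : C₁ * (T : ℝ) ^ max c (1 - c) ≤ max C₁ C₂ * (T : ℝ) ^ max c (1 - c) :=
      mul_le_mul_of_nonneg_right (le_max_left _ _) (by positivity)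
    linarith
  · have hVint : MeasureTheory.Integrable
        (fun ω => DistBandit.netCCV g (fun i t => x i t ω) T) P :=
      (MeasureTheory.integrable_finsetSum _ fun i _ => MeasureTheory.integrable_finsetSum _
        fun t ht => DistBandit.integrable_norm_clip_globalConstraint h i (Finset.mem_Icc.1 ht).1
          (hxm i t (Finset.mem_Icc.1 ht).1) (hxX i t (Finset.mem_Icc.1 ht).1)).const_mul _
    refine ⟨hVint, ?_⟩
    -- For the violation any feasible comparator will do.
    obtain ⟨y, hy⟩ := hfeas T hT
    have hSint : ∀ t ∈ Finset.Icc 1 T, MeasureTheory.Integrable (fun ω =>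
        DistBandit.stepSize c t * ∑ i, DistBandit.lagrangianGap f g r γ₀ c |G₁| (√2 * G₂) i t y
          (x i t ω) (u i t ω).1) P := fun t ht =>
      (MeasureTheory.integrable_finsetSum _
        fun i _ => (hgap i t (Finset.mem_Icc.1 ht).1 y hy.1).1).const_mul _
    have hMint := (MeasureTheory.integrable_finsetSum _ hSint).const_mul
      (κ * (T : ℝ) ^ (c / 2))
    have hM0 : 0 ≤ ∫ ω, κ * (T : ℝ) ^ (c / 2) * ∑ t ∈ Finset.Icc 1 T,
        DistBandit.stepSize c t * ∑ i, DistBandit.lagrangianGap f g r γ₀ c |G₁| (√2 * G₂) i t y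
          (x i t ω) (u i t ω).1 ∂P := by
      rw [MeasureTheory.integral_const_mul, MeasureTheory.integral_finsetSum _ hSint]
      refine mul_nonneg (by positivity) (Finset.sum_nonneg fun t ht => ?_)
      rw [MeasureTheory.integral_const_mul, MeasureTheory.integral_finsetSum _
        fun i _ => (hgap i t (Finset.mem_Icc.1 ht).1 y hy.1).1]
      exact mul_nonneg (DistBandit.stepSize_pos (Finset.mem_Icc.1 ht).1).le
        (Finset.sum_nonneg fun i _ => (hgap i t (Finset.mem_Icc.1 ht).1 y hy.1).2)
    have := MeasureTheory.integral_mono hVint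
      ((MeasureTheory.integrable_const (C₂ * (T : ℝ) ^ (1 - c / 2))).sub hMint) fun ω =>
        hC₂ m X f g G W _ _ _ h hW (hprim ω) (hu ω) T y hT hy
    simp only [Pi.sub_apply] at this
    rw [MeasureTheory.integral_sub (MeasureTheory.integrable_const _) hMint,
      MeasureTheory.integral_const, MeasureTheory.probReal_univ, one_smul] at this
    have h2 : C₂ * (T : ℝ) ^ (1 - c / 2) ≤ max C₁ C₂ * (T : ℝ) ^ (1 - c / 2) :=
      mul_le_mul_of_nonneg_right (le_max_right _ _) (by positivity)
    linarith
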